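/- \textbf{Setting.} Let $\mathcal C$ be a finite non-empty index set, $d\ge 1$, $b,m,T,k_3,k_4>0$, and for $c\in\mathcal C$ let $a_c\in\mathbb R^d$ and let $\Lambda_c$ be a symmetric positive definite $d\times d$ matrix. Put $\Lambda_{\mathcal C}=(\sum_c\Lambda_c^{-1})^{-1}$ and, for $x=(x^{(c)})_{c\in\mathcal C}$, $\tilde x=\Lambda_{\mathcal C}\sum_c\Lambda_c^{-1}x^{(c)}$. Let $f_c$ be the density of $\mathcal N_d(a_c,\frac{b|\mathcal C|}{m}\Lambda_c)$ and $$\phi_c=\tfrac12\big(\nabla\log f_c^{\top}\Lambda_c\nabla\log f_c+\mathrm{Tr}(\Lambda_c\nabla^2\log f_c)\big),\qquad \nu(x)=\frac1{|\mathcal C|}\sum_{c\in\mathcal C}(x^{(c)}-a_c)^{\top}\Lambda_c^{-1}(x^{(c)}-a_c).$$ \textbf{One iteration} from time $t_{j-1}$ to time $t_j$, where $0\le t_{j-1}<t_j\le T$ and $\Delta_j=t_j-t_{j-1}$. There are $N$ particles with states $x_{j-1,i}=(x_{j-1,i}^{(c)})_c$, $i\le N$. They may depend on each other, but they represent a probability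 law $\mu_{j-1}$ with $\mathbb E[\nu_j]:=\int\nu\,d\mu_{j-1}<\infty$: for every bounded measurable $f$, $N^{-1}\sum_{i\le N}f(x_{j-1,i})\to\int f\,d\mu_{j-1}$ in probability as $N\to\infty$ (for example, they are independent draws from $\mu_{j-1}$). Given all these states, the following is done independently for each $i$. \begin{itemize} \item $x_{j,i}$ is drawn from the normal law on $(\mathbb R^d)^{\mathcal C}$ whose mean has the components $\frac{T-t_j}{T-t_{j-1}}x_{j-1,i}^{(c)}+\frac{\Delta_j}{T-t_{j-1}}\tilde x_{j-1,i}$ and whose covariance matrix has the blocks $\delta_{cc'}\frac{\Delta_j(T-t_j)}{T-t_{j-1}}\Lambda_c+\frac{\Delta_j^2}{T-t_{j-1}}\Lambda_{\mathcal C}$. \item For each $c$, independently, $X^{(c)}$ is a Brownian bridge on $[t_{j-1},t_j]$ with covariance matrix $\Lambda_c$ from $x_{j-1,i}^{(c)}$ to $x_{j,i}^{(c)}$. A compact region $R_c$ that contains the path is determined from the path by a fixed rule, and $U_j^{(c)}$ is a (measurable) upper bound of $\phi_c$ on $R_c$ that depends only on $R_c$. \item Times $\xi_{c,1},\xi_{c,2},\dots$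 are drawn independently and uniformly from $[t_{j-1},t_j]$; given the paths and independently of the times and of each other, the $\kappa_c$ are Poisson variables with the intensities $\lambda_c=\big[\Delta_j\int_{t_{j-1}}^{t_j}(U_j^{(c)}-\phi_c(X_t^{(c)}))^2\,dt\big]^{1/2}$; let $p_c(k)=e^{-\lambda_c}\lambda_c^k/k!$. \item The weight is $$\tilde\rho_{j,i}=\prod_{c\in\mathcal C}\Big(\frac{\Delta_j^{\kappa_c}e^{-U_j^{(c)}\Delta_j}}{\kappa_c!\,p_c(\kappa_c)}\prod_{k=1}^{\kappa_c}\big[U_j^{(c)}-\phi_c(X^{(c)}_{\xi_{c,k}})\big]\Big).$$ \end{itemize} Let $\mathrm{CESS}_j=(\sum_{i\le N}\tilde\rho_{j,i})^2/\sum_{i\le N}\tilde\rho_{j,i}^2$. \textbf{Theorem.} Consider a sequence of such iterations with $\Delta_j\to0$, along which $t_{j-1}$, $t_j$, $\mu_{j-1}$ and the rules for $R_c$, $U_j^{(c)}$ may vary while $\mathcal C,d,\Lambda_c,a_c,b,m,T,k_3,k_4$ are fixed, and suppose that throughout $$\Delta_j\le\min\Big\{\frac{b^2|\mathcal C|k_3}{\mathbb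 E[\nu_j]m^2},\ \Big(\frac{b^2|\mathcal C|k_4}{2m^2d}\Big)^{1/2}\Big\}$$ (the first bound being $+\infty$ if $\mathbb E[\nu_j]=0$). Then for each iteration of the sequence the limit in probability $\operatorname{plim}_{N\to\infty}N^{-1}\mathrm{CESS}_j$ exists and is a constant; the limit inferior of these constants as $\Delta_j\to0$ is at least $e^{-k_3-k_4}$; and if $\mathbb E[\nu_j]$ stays bounded along the sequence (for instance, if $t_{j-1}$ and $\mu_{j-1}$ are fixed), then the constants converge, so that $$\lim_{\Delta_j\to0}\ \operatorname{plim}_{N\to\infty}N^{-1}\mathrm{CESS}_j\ \ge\ e^{-k_3-k_4}.$$ -/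

import Mathlib

open MeasureTheory ProbabilityTheory Filter Topology
open scoped ENNReal NNReal Matrix

namespace GBF

noncomputable section

/-- Points of `ℝ^d`. -/
abbrev Pt (d : ℕ) : Type := EuclideanSpace ℝ (Fin d)

/-- Joint states `(x^{(c)})_{c ∈ C}` of the trajectories, one point of `ℝ^d` for each index. -/
abbrev Config (ι : Type*) (d : ℕ) := ι → Pt d

/-- The quadratic form `vᵀ A v`. -/
def quad {d : ℕ} (A : Matrix (Fin d) (Fin d) ℝ) (v : Pt d) : ℝ :=
  v.ofLp ⬝ᵥ (A *ᵥ v.ofLp)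

/-- The density of `N_d(a, S)`. -/
def gaussianDensity {d : ℕ} (a : Pt d) (S : Matrix (Fin d) (Fin d) ℝ) (x : Pt d) : ℝ :=
  (Real.sqrt ((2 * Real.pi) ^ d * S.det))⁻¹ * Real.exp (-(1 / 2) * quad S⁻¹ (x - a))

/-- The Hessian matrix of a real function on `ℝ^d`. -/
def hessian {d : ℕ} (g : Pt d → ℝ) (x : Pt d) : Matrix (Fin d) (Fin d) ℝ :=
  Matrix.of fun i j =>
    iteratedFDeriv ℝ 2 g x ![EuclideanSpace.single i 1, EuclideanSpace.single j 1]

/-- `φ(x) = ½ (∇ log f(x)ᵀ Λ ∇ log f(x) + Tr(Λ ∇² log f(x)))`. -/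
def phiOf {d : ℕ} (Λ : Matrix (Fin d) (Fin d) ℝ) (f : Pt d → ℝ) (x : Pt d) : ℝ :=
  (1 / 2) * (quad Λ (gradient (fun y => Real.log (f y)) x) +
    (Λ * hessian (fun y => Real.log (f y)) x).trace)

/-- The data of the idealised setting: the sub-posteriors are `N_d(a_c, (b|C|/m) Λ_c)`, and the
trajectories coalesce at the time horizon `T`. -/
structure GaussianModel (ι : Type*) (d : ℕ) where
  Λ : ι → Matrix (Fin d) (Fin d) ℝ
  Λ_posDef : ∀ c, (Λ c).PosDef
  a : ι → Pt d
  b : ℝ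
  m : ℝ
  T : ℝ
  b_pos : 0 < b
  m_pos : 0 < m
  T_pos : 0 < T

namespace GaussianModel

variable {ι : Type*} [Fintype ι] {d : ℕ} (M : GaussianModel ι d)

/-- The number `|C|` of sub-posteriors, as a real number. -/
def card (_ : GaussianModel ι d) : ℝ := (Fintype.card ι : ℝ)

/-- The sub-posterior density `f_c`. -/
def subposterior (c : ι) : Pt d → ℝ :=
  gaussianDensity (M.a c) ((M.b * M.card / M.m) • M.Λ c)

/-- The function `φ_c` of the sub-posterior `f_c`. -/
def phi (c : ι) : Pt d → ℝ := phiOf (M.Λ c) (M.subposterior c)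

/-- `Λ_C = (∑_c Λ_c⁻¹)⁻¹`. -/
def ΛC : Matrix (Fin d) (Fin d) ℝ := (∑ c, (M.Λ c)⁻¹)⁻¹

/-- The weighted mean `x̃ = (∑_c Λ_c⁻¹)⁻¹ (∑_c Λ_c⁻¹ x^{(c)})`. -/
def wmean (x : Config ι d) : Pt d :=
  WithLp.toLp 2 (M.ΛC *ᵥ ∑ c, (M.Λ c)⁻¹ *ᵥ (x c).ofLp)

/-- The mean `M_{s,t}` of the proposal transition from time `s` to time `t`. -/
def transMean (s t : ℝ) (x : Config ι d) (c : ι) : Pt d :=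
  ((M.T - t) / (M.T - s)) • x c + ((t - s) / (M.T - s)) • M.wmean x

/-- The covariance matrix `V_{s,t}` of the proposal transition from time `s` to time `t`. For
`t = T` all its blocks are `(T - s) Λ_C`: the trajectories coalesce. -/
def transCov [DecidableEq ι] (s t : ℝ) : Matrix (ι × Fin d) (ι × Fin d) ℝ :=
  Matrix.of fun p q =>
    (if p.1 = q.1 then (t - s) * (M.T - t) / (M.T - s) * M.Λ p.1 p.2 q.2 else 0) +
      (t - s) ^ 2 / (M.T - s) * M.ΛC p.2 q.2

/-- `ν(x) = |C|⁻¹ ∑_c (x^{(c)} - a_c)ᵀ Λ_c⁻¹ (x^{(c)} - a_c)`. -/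
def nu (x : Config ι d) : ℝ :=
  (M.card)⁻¹ * ∑ c, quad (M.Λ c)⁻¹ (x c - M.a c)

/-- `t - s ≤ min { b²|C|k₃ / (E[ν] m²), (b²|C|k₄ / (2m²d))^{1/2} }`, where `E[ν]` is taken over the
law `μ` of the state at time `s`. The first bound is void if `E[ν] = 0`. -/
def MeshCondition (k₃ k₄ : ℝ) (μ : Measure (Config ι d)) (s t : ℝ) : Prop :=
  (t - s) * ((∫ x, M.nu x ∂μ) * M.m ^ 2) ≤ M.b ^ 2 * M.card * k₃ ∧
    t - s ≤ Real.sqrt (M.b ^ 2 * M.card * k₄ / (2 * M.m ^ 2 * d))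

end GaussianModel

/-- Continuous paths `[s,t] → ℝ^d`. -/
abbrev Path (d : ℕ) (s t : ℝ) := C(Set.Icc s t, Pt d)

/-- Lebesgue measure on the interval `[s,t]`. -/
def timeMeasure (s t : ℝ) : Measure (Set.Icc s t) := Measure.comap Subtype.val volume

/-- The σ-algebra on the path space that is generated by the evaluations. -/
@[reducible] def pathSigma (d : ℕ) (s t : ℝ) : MeasurableSpace (Path d s t) :=
  ⨆ u : Set.Icc s t, MeasurableSpace.comap (fun w : Path d s t => w u) inferInstance

/-- Layer information for paths on `[s,t]`: each path `w` is assigned a compact region `R(w)`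
that contains it, and each region `R` comes with bounds `L(R) ≤ φ ≤ U(R)` on `R`. -/
structure LayerScheme {d : ℕ} (s t : ℝ) (φ : Pt d → ℝ) where
  region : Path d s t → Set (Pt d)
  lower : Set (Pt d) → ℝ
  upper : Set (Pt d) → ℝ
  isCompact_region : ∀ w, IsCompact (region w)
  mem_region : ∀ w u, w u ∈ region w
  lower_le : ∀ w, ∀ x ∈ region w, lower (region w) ≤ φ x
  le_upper : ∀ w, ∀ x ∈ region w, φ x ≤ upper (region w)
  measurable_upper : Measurable[pathSigma d s t] fun w => upper (region w)

/-- The optimal intensity `λ = [(t-s) ∫_s^t (U - φ(w_u))² du]^{1/2}`. -/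
def optimalIntensity {d : ℕ} {s t : ℝ} (φ : Pt d → ℝ) (U : ℝ) (w : Path d s t) : ℝ≥0 :=
  Real.toNNReal (Real.sqrt ((t - s) * ∫ u, (U - φ (w u)) ^ 2 ∂(timeMeasure s t)))

/-- One factor of the estimator,
`Δ^κ e^{-UΔ} / (κ! p(κ)) ∏_{r=1}^κ (U - φ(w_{ξ_r}))` with `Δ = t - s`, where `p` is the probability
mass function of `κ`. -/
def estimatorFactor {d : ℕ} {s t : ℝ} (φ : Pt d → ℝ) (U : ℝ) (p : ℕ → ℝ) (w : Path d s t)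
    (κ : ℕ) (ξ : ℕ → Set.Icc s t) : ℝ :=
  (t - s) ^ κ * Real.exp (-(U * (t - s))) / (κ.factorial * p κ) *
    ∏ r ∈ Finset.range κ, (U - φ (w (ξ r)))

/-- The point at time `u` of the segment that is at `x` at time `s` and at `y` at time `t`. -/
def interpolate {d : ℕ} {s t : ℝ} (x y : Pt d) (u : Set.Icc s t) : Pt d :=
  ((t - u) / (t - s)) • x + ((u - s) / (t - s)) • y

/-- `B` is a Brownian bridge on `[s,t]` from `0` to `0` with covariance matrix `Λ`: a centred
Gaussian process with `Cov(B_u, B_v) = (min u v - s)(t - max u v)/(t - s) Λ`. A Brownian bridge from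
`x` to `y` is the sum of such a process and of the segment from `x` to `y`. -/
structure IsBrownianBridge {Ω : Type*} [MeasurableSpace Ω] {d : ℕ} {s t : ℝ}
    (Λ : Matrix (Fin d) (Fin d) ℝ) (B : Set.Icc s t → Ω → Pt d) (P : Measure Ω) : Prop where
  gaussian : IsGaussianProcess B P
  mean : ∀ u i, ∫ ω, B u ω i ∂P = 0
  covariance : ∀ u v i j, cov[fun ω => B u ω i, fun ω => B v ω j; P] =
    (min (u : ℝ) v - s) * (t - max (u : ℝ) v) / (t - s) * Λ i j

/-- The sources of randomness of one iteration: the starting positions of all particles, and for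
each particle its move, its bridges, and the times at which the bridges are inspected. -/
inductive Source (ι : Type*) (N : ℕ) where
  | start : Source ι N
  | move (i : Fin N) : Source ι N
  | bridge (i : Fin N) (c : ι) : Source ι N
  | time (i : Fin N) (c : ι) (r : ℕ) : Source ι N

/-- The random variables of one iteration of the algorithm, from time `s` to time `t`, for `N`
particles: the states at the times `s` and `t`, the connecting paths, the numbers `κ` and the
times `ξ`. -/
structure StepData (ι : Type*) (d : ℕ) (s t : ℝ) (Ω : Type*) (N : ℕ) where
  prev : Fin N → Ω → Config ι d
  next : Fin N → Ω → Config ι d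
  path : Fin N → ι → Ω → Path d s t
  κ : Fin N → ι → Ω → ℕ
  ξ : Fin N → ι → ℕ → Ω → Set.Icc s t

namespace StepData

variable {ι : Type*} [Fintype ι] {d : ℕ} {s t : ℝ} {Ω : Type*} {N : ℕ}
  (D : StepData ι d s t Ω N) (M : GaussianModel ι d)

/-- `x_j - M_j`, the deviation of the new state from its conditional mean. -/
def innovation (i : Fin N) (ω : Ω) : EuclideanSpace ℝ (ι × Fin d) :=
  WithLp.toLp 2 fun p => D.next i ω p.1 p.2 - M.transMean s t (D.prev i ω) p.1 p.2

/-- The deviation of a path from the segment between the old and the new position. -/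
def fluctuation (i : Fin N) (c : ι) (u : Set.Icc s t) (ω : Ω) : Pt d :=
  D.path i c ω u - interpolate (D.prev i ω c) (D.next i ω c) u

/-- The σ-algebra of each source of randomness. -/
@[reducible] def sigma : Source ι N → MeasurableSpace Ω
  | .start => MeasurableSpace.comap (fun ω i => D.prev i ω) inferInstance
  | .move i => MeasurableSpace.comap (D.innovation M i) inferInstance
  | .bridge i c => ⨆ u, MeasurableSpace.comap (D.fluctuation i c u) inferInstance
  | .time i c r => MeasurableSpace.comap (D.ξ i c r) inferInstance

variable (R : ∀ c, LayerScheme s t (M.phi c))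

/-- `U^{(c)}`, the upper bound of `φ_c` on the layer of the path. -/
def U (i : Fin N) (c : ι) (ω : Ω) : ℝ := (R c).upper ((R c).region (D.path i c ω))

/-- The optimal Poisson intensity for `κ_c`. -/
def intensity (i : Fin N) (c : ι) (ω : Ω) : ℝ≥0 :=
  optimalIntensity (M.phi c) (D.U M R i c ω) (D.path i c ω)

/-- The weight `ρ̃` of particle `i`. -/
def rho (i : Fin N) (ω : Ω) : ℝ :=
  ∏ c, estimatorFactor (M.phi c) (D.U M R i c ω)
    (fun k => (poissonMeasure (D.intensity M R i c ω)).real {k})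
    (D.path i c ω) (D.κ i c ω) (fun r => D.ξ i c r ω)

/-- The conditional effective sample size `(∑ ρ̃_i)² / ∑ ρ̃_i²`. -/
def cess (ω : Ω) : ℝ := (∑ i, D.rho M R i ω) ^ 2 / ∑ i, D.rho M R i ω ^ 2

/-- The joint law of the random variables of one iteration. Given the states `x_{j-1}` of the
particles, independently for each particle: `x_j ~ N(M_{s,t}, V_{s,t})`; for each `c` the path is a
Brownian bridge with covariance matrix `Λ_c` from `x_{j-1}^{(c)}` to `x_j^{(c)}`; the times `ξ` are
independent and uniform on `[s,t]`; given all this, the `κ_c` are independent Poisson variables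
with the optimal intensities. -/
structure IsStep [DecidableEq ι] [MeasurableSpace Ω] (P : Measure Ω) : Prop where
  measurable_prev : ∀ i, Measurable (D.prev i)
  measurable_next : ∀ i, Measurable (D.next i)
  measurable_path : ∀ i c u, Measurable fun ω => D.path i c ω u
  measurable_κ : ∀ i c, Measurable (D.κ i c)
  measurable_ξ : ∀ i c r, Measurable (D.ξ i c r)
  move_law : ∀ i, HasLaw (D.innovation M i) (multivariateGaussian 0 (M.transCov s t)) P
  bridge_law : ∀ i c, IsBrownianBridge (M.Λ c) (D.fluctuation i c) P
  time_law : ∀ i c r, pdf.IsUniform (D.ξ i c r) Set.univ P (timeMeasure s t)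
  indep : iIndep (D.sigma M) P
  κ_law : ∀ k : Fin N → ι → ℕ,
    P[Set.indicator {ω | ∀ i c, D.κ i c ω = k i c} (fun _ => (1 : ℝ)) | ⨆ q, D.sigma M q] =ᵐ[P]
      fun ω => ∏ i, ∏ c, (poissonMeasure (D.intensity M R i c ω)).real {k i c}

end StepData

/-- The particles `X N i`, `i < N`, represent the law `μ` as `N → ∞`: the average over the
particles of each bounded measurable function tends in probability to its expectation under `μ`.
Independent draws from `μ` are an example. -/
def Represents {Ω S : Type*} [MeasurableSpace Ω] [MeasurableSpace S]
    (X : (N : ℕ) → Fin N → Ω → S) (μ : Measure S) (P : Measure Ω) : Prop :=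
  ∀ f : S → ℝ, Measurable f → (∃ K, ∀ x, |f x| ≤ K) →
    TendstoInMeasure P (fun (N : ℕ) ω => (N : ℝ)⁻¹ * ∑ i, f (X N i ω)) atTop fun _ => ∫ x, f x ∂μ

end

end GBF

/-! Write `σ = m/(b|C|)` (`scale`) and `Δ = t - s`. For Gaussian sub-posteriors `φ_c(x) = ½(σ² (x -
a_c)ᵀ Λ_c⁻¹ (x - a_c) - σ d)` (`phi_eq`), so `φ_c` is bounded below by a constant and above by a
quadratic form. Everything rests on two conditional moments of the weight given the paths: the
Poisson estimator is unbiased, with mean `exp(-∑_c ∫ φ_c)`, and with the optimal intensities its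
mean square is `exp(∑_c 2(λ_c - U_c Δ))` (`lintegral_weight`, `lintegral_weight_sq`).

The lower bound on `φ_c` gives `λ_c ≤ Δ(U_c + σd/2)`. The layer bound `U_c` therefore cancels, and
both conditional moments given the old state are bounded by constants. A truncated weak law of large
numbers for conditionally independent particles (`tendstoInMeasure_average`) then applies to the
weights and to their squares, and `N⁻¹ CESS` tends in probability to `(E ρ)² / E ρ²` (`cessLimit`).

For the size of this constant, `E ρ² ≤ exp(|C|σdΔ)`, while Jensen's inequality bounds `E ρ` below by
`exp(-E ∑_c ∫ φ_c)` up to the upper estimate of `φ_c`. Along a path the sum of the quadratic forms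
is at most `(1 + η)|C| ν(x)` plus a noise term: the drift towards the weighted mean is a convex
combination with an orthogonal projection, and Young's inequality with parameter `η` separates the
noise. Hence `cessLimit ≥ exp(-(1 + η) σ²|C| Δ E[ν] - C_η Δ)` (`exp_le_cessLimit`, `costBound_eq`).

The mesh condition says `σ²|C| Δ E[ν] ≤ k₃`, and `η = k₄/k₃` turns the main term into `k₃ + k₄`. A
free `η` is what permits `E[ν]` to grow while `Δ E[ν]` stays bounded. If `E[ν]` is bounded, the
whole exponent vanishes and the constants tend to `1`, their upper bound by Cauchy–Schwarz. -/

namespace GBF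

noncomputable section

/-! ### Quadratic forms on `ℝ^d` -/

section Quadratic

variable {d : ℕ}

lemma quad_eq_inner (A : Matrix (Fin d) (Fin d) ℝ) (v : Pt d) :
    quad A v = inner ℝ v (Matrix.toEuclideanCLM (𝕜 := ℝ) A v) := by
  rw [Matrix.inner_toEuclideanCLM]; rfl

lemma inner_toEuclideanCLM_comm {A : Matrix (Fin d) (Fin d) ℝ} (hA : A.IsHermitian) (v w : Pt d) :
    inner ℝ v (Matrix.toEuclideanCLM (𝕜 := ℝ) A w) =
      inner ℝ w (Matrix.toEuclideanCLM (𝕜 := ℝ) A v) := by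
  have hT : Aᵀ = A := by simpa [Matrix.IsHermitian] using hA
  rw [Matrix.inner_toEuclideanCLM, Matrix.inner_toEuclideanCLM, Matrix.dotProduct_mulVec,
    ← Matrix.mulVec_transpose, hT, dotProduct_comm]

lemma continuous_quad (A : Matrix (Fin d) (Fin d) ℝ) : Continuous (quad A) := by
  simp only [funext (quad_eq_inner A)]
  fun_prop

lemma quad_nonneg {A : Matrix (Fin d) (Fin d) ℝ} (hA : A.PosDef) (v : Pt d) : 0 ≤ quad A v := by
  simpa [quad] using hA.posSemidef.dotProduct_mulVec_nonneg v.ofLp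

lemma quad_add {A : Matrix (Fin d) (Fin d) ℝ} (hA : A.IsHermitian) (v w : Pt d) :
    quad A (v + w) =
      quad A v + 2 * inner ℝ v (Matrix.toEuclideanCLM (𝕜 := ℝ) A w) + quad A w := by
  simp only [quad_eq_inner, map_add, inner_add_left, inner_add_right]
  rw [inner_toEuclideanCLM_comm hA w v]; ring

lemma quad_smul (A : Matrix (Fin d) (Fin d) ℝ) (r : ℝ) (v : Pt d) :
    quad A (r • v) = r ^ 2 * quad A v := by
  simp only [quad_eq_inner, map_smul, inner_smul_left, inner_smul_right]
  simp; ring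

/-- Young's inequality for a quadratic form. -/
lemma quad_add_le {A : Matrix (Fin d) (Fin d) ℝ} (hA : A.PosDef) {η : ℝ} (hη : 0 < η)
    (v w : Pt d) : quad A (v + w) ≤ (1 + η) * quad A v + (1 + η⁻¹) * quad A w := by
  -- `η` times the form at `v - η⁻¹ w` is exactly the difference of the two sides.
  have h := quad_nonneg hA (v + (-η⁻¹) • w)
  rw [quad_add hA.isHermitian, quad_smul] at h
  simp only [map_smul, inner_smul_right] at h
  rw [quad_add hA.isHermitian]
  have h2 := mul_nonneg hη.le h
  have e : η * (quad A v + 2 * (-η⁻¹ * inner ℝ v (Matrix.toEuclideanCLM (𝕜 := ℝ) A w)) +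
      (-η⁻¹) ^ 2 * quad A w) = η * quad A v -
        2 * inner ℝ v (Matrix.toEuclideanCLM (𝕜 := ℝ) A w) + η⁻¹ * quad A w := by
    field_simp
    ring
  rw [e] at h2
  linarith

/-- The gap between the two sides equals `r (1 - r)` times the form at `v - w`. -/
lemma quad_convex {A : Matrix (Fin d) (Fin d) ℝ} (hA : A.PosDef) {r : ℝ} (h0 : 0 ≤ r)
    (h1 : r ≤ 1) (v w : Pt d) :
    quad A ((1 - r) • v + r • w) ≤ (1 - r) * quad A v + r * quad A w := by
  have h := mul_nonneg (mul_nonneg h0 (sub_nonneg.2 h1)) (quad_nonneg hA (v + (-1 : ℝ) • w))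
  rw [quad_add hA.isHermitian, quad_smul] at h
  simp only [map_smul, inner_smul_right] at h
  rw [quad_add hA.isHermitian, quad_smul, quad_smul]
  simp only [map_smul, inner_smul_right, inner_smul_left]
  simp only [conj_trivial]
  nlinarith [h]

lemma quad_le_norm (A : Matrix (Fin d) (Fin d) ℝ) (v : Pt d) :
    quad A v ≤ ‖Matrix.toEuclideanCLM (𝕜 := ℝ) A‖ * ‖v‖ ^ 2 := by
  rw [quad_eq_inner]
  calc _ ≤ ‖v‖ * ‖Matrix.toEuclideanCLM (𝕜 := ℝ) A v‖ := real_inner_le_norm _ _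
    _ ≤ ‖v‖ * (‖Matrix.toEuclideanCLM (𝕜 := ℝ) A‖ * ‖v‖) := by
      gcongr; exact ContinuousLinearMap.le_opNorm _ _
    _ = _ := by ring

end Quadratic

/-! ### The function `φ` of a Gaussian density -/

section LogGaussian

variable {d : ℕ}

lemma log_gaussianDensity (a : Pt d) {S : Matrix (Fin d) (Fin d) ℝ} (hS : S.PosDef) (x : Pt d) :
    Real.log (gaussianDensity a S x) =
      Real.log (Real.sqrt ((2 * Real.pi) ^ d * S.det))⁻¹ + -(1 / 2) * quad S⁻¹ (x - a) := by
  have h : 0 < Real.sqrt ((2 * Real.pi) ^ d * S.det) :=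
    Real.sqrt_pos.2 (mul_pos (by positivity) hS.det_pos)
  rw [gaussianDensity, Real.log_mul (inv_ne_zero h.ne') (Real.exp_ne_zero _), Real.log_exp]

lemma hasFDerivAt_const_sub_quad (C : ℝ) {A : Matrix (Fin d) (Fin d) ℝ} (hA : A.IsHermitian)
    (a x : Pt d) :
    HasFDerivAt (fun y => C + -(1 / 2) * quad A (y - a))
      (-(innerSL ℝ (Matrix.toEuclideanCLM (𝕜 := ℝ) A (x - a)))) x := by
  have h1 : HasFDerivAt (fun y : Pt d => y - a) (ContinuousLinearMap.id ℝ (Pt d)) x :=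
    (hasFDerivAt_id x).sub_const a
  have h2 := h1.inner ℝ ((Matrix.toEuclideanCLM (𝕜 := ℝ) A).hasFDerivAt.comp x h1)
  simp only [quad_eq_inner]
  refine ((h2.const_mul (-(1 / 2))).const_add C).congr_fderiv ?_
  ext v
  simp only [ContinuousLinearMap.comp_id, neg_apply, smul_apply,
    ContinuousLinearMap.comp_apply, ContinuousLinearMap.prod_apply, ContinuousLinearMap.id_apply,
    fderivInnerCLM_apply, Function.comp_apply, smul_eq_mul, innerSL_apply_apply]
  rw [inner_toEuclideanCLM_comm hA (x - a) v, real_inner_comm v]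
  ring

/-- The log density is quadratic, with gradient `-S⁻¹(x - a)` and constant Hessian `-S⁻¹`. -/
lemma phiOf_gaussianDensity (Λ : Matrix (Fin d) (Fin d) ℝ) (a : Pt d)
    {S : Matrix (Fin d) (Fin d) ℝ} (hS : S.PosDef) (x : Pt d) :
    phiOf Λ (gaussianDensity a S) x =
      (1 / 2) * (quad Λ (Matrix.toEuclideanCLM (𝕜 := ℝ) S⁻¹ (x - a)) - (Λ * S⁻¹).trace) := by
  have hA : (S⁻¹).IsHermitian := hS.inv.isHermitian
  have hf := fun y => hasFDerivAt_const_sub_quad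
    (Real.log (Real.sqrt ((2 * Real.pi) ^ d * S.det))⁻¹) hA a y
  unfold phiOf
  simp only [funext (log_gaussianDensity a hS)]
  have hg : gradient (fun y => Real.log (Real.sqrt ((2 * Real.pi) ^ d * S.det))⁻¹ +
      -(1 / 2) * quad S⁻¹ (y - a)) x = -(Matrix.toEuclideanCLM (𝕜 := ℝ) S⁻¹ (x - a)) := by
    apply HasGradientAt.gradient
    rw [hasGradientAt_iff_hasFDerivAt]
    refine (hf x).congr_fderiv ?_
    ext v
    simp
  have hh : hessian (fun y => Real.log (Real.sqrt ((2 * Real.pi) ^ d * S.det))⁻¹ +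
      -(1 / 2) * quad S⁻¹ (y - a)) x = -S⁻¹ := by
    ext i j
    have hfd : fderiv ℝ (fun y => Real.log (Real.sqrt ((2 * Real.pi) ^ d * S.det))⁻¹ +
      -(1 / 2) * quad S⁻¹ (y - a)) =
      fun y => -(innerSL ℝ (Matrix.toEuclideanCLM (𝕜 := ℝ) S⁻¹ (y - a))) :=
      funext fun y => (hf y).fderiv
    have h2 : HasFDerivAt (fun y => -(innerSL ℝ (Matrix.toEuclideanCLM (𝕜 := ℝ) S⁻¹ (y - a))))
        (-((innerSL ℝ).comp (Matrix.toEuclideanCLM (𝕜 := ℝ) S⁻¹))) x := by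
      have h1 : HasFDerivAt (fun y : Pt d => y - a) (ContinuousLinearMap.id ℝ (Pt d)) x :=
        (hasFDerivAt_id x).sub_const a
      exact (((innerSL ℝ).comp (Matrix.toEuclideanCLM (𝕜 := ℝ) S⁻¹)).hasFDerivAt.comp x h1).neg
    rw [hessian, Matrix.of_apply, iteratedFDeriv_two_apply, hfd, h2.fderiv]
    simp
    rw [real_inner_comm, inner_toEuclideanCLM_comm hA, Matrix.inner_toEuclideanCLM]
    simp
  rw [hg, hh, show -(Matrix.toEuclideanCLM (𝕜 := ℝ) S⁻¹ (x - a)) =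
    (-1 : ℝ) • Matrix.toEuclideanCLM (𝕜 := ℝ) S⁻¹ (x - a) by simp, quad_smul]
  simp; ring

end LogGaussian

namespace GaussianModel

variable {ι : Type*} [Fintype ι] {d : ℕ} (M : GaussianModel ι d)

lemma card_pos [Nonempty ι] : 0 < M.card := by
  unfold card; exact_mod_cast Fintype.card_pos

/-- The function `φ_c` of a Gaussian sub-posterior. -/
lemma phi_eq [Nonempty ι] (c : ι) (x : Pt d) :
    M.phi c x = (1 / 2) * ((M.m / (M.b * M.card)) ^ 2 * quad (M.Λ c)⁻¹ (x - M.a c) -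
      M.m / (M.b * M.card) * d) := by
  have hb := M.b_pos
  have hm := M.m_pos
  have hc := M.card_pos
  set r := M.b * M.card / M.m with hr
  have hr0 : 0 < r := by positivity
  have hS : (r • M.Λ c).PosDef := (M.Λ_posDef c).smul hr0
  have hdet : IsUnit (M.Λ c).det := (M.Λ_posDef c).det_pos.ne'.isUnit
  have hinv : (r • M.Λ c)⁻¹ = r⁻¹ • (M.Λ c)⁻¹ := by
    let _ := invertibleOfNonzero hr0.ne'
    rw [Matrix.inv_smul _ _ hdet, invOf_eq_inv]
  have hrinv : r⁻¹ = M.m / (M.b * M.card) := by rw [hr, inv_div]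
  rw [phi, subposterior, phiOf_gaussianDensity _ _ hS, hinv, map_smul,
    smul_apply, quad_smul, hrinv]
  congr 2
  · congr 1
    simp only [quad, Matrix.ofLp_toEuclideanCLM, Matrix.mulVec_mulVec, Matrix.mul_nonsing_inv _ hdet,
      Matrix.one_mulVec]
    rw [dotProduct_comm]
  · rw [Matrix.mul_smul, Matrix.mul_nonsing_inv _ hdet]
    simp

lemma continuous_phi [Nonempty ι] (c : ι) : Continuous (M.phi c) := by
  simp only [funext (M.phi_eq c)]
  have := continuous_quad (M.Λ c)⁻¹
  fun_prop

end GaussianModel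


/-! ### A weak law of large numbers for conditionally independent particles -/

section LargeNumbers

variable {Ω : Type*} [MeasurableSpace Ω] {P : Measure Ω} [IsProbabilityMeasure P]

/-- Convergence in probability may be checked on approximations in mean. -/
lemma tendstoInMeasure_of_approx {A : ℕ → Ω → ℝ} (hA : ∀ N, Measurable (A N)) {a : ℝ}
    (h : ∀ δ > 0, ∃ (A' : ℕ → Ω → ℝ) (a' : ℝ), (∀ N, Measurable (A' N)) ∧
      TendstoInMeasure P A' atTop (fun _ => a') ∧ |a' - a| ≤ δ ∧
      ∀ᶠ N in atTop, ∫⁻ ω, ENNReal.ofReal |A N ω - A' N ω| ∂P ≤ ENNReal.ofReal δ) :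
    TendstoInMeasure P A atTop fun _ => a := by
  rw [tendstoInMeasure_iff_measureReal_norm]
  intro ε hε
  rw [Metric.tendsto_atTop]
  intro η hη
  -- `ε/3 + ε/3 + ε/4 < ε` leaves room for three errors, and Markov's inequality at level `ε/3`
  -- turns a mean of at most `ηε/6` into a probability of at most `η/2`.
  set δ := min (ε / 4) (η * ε / 6) with hδ
  have hδ0 : 0 < δ := by positivity
  obtain ⟨A', a', hA', hT, ha, hE⟩ := h δ hδ0
  rw [tendstoInMeasure_iff_measureReal_norm] at hT
  have hT' := (hT (ε / 3) (by positivity)).eventually (gt_mem_nhds (half_pos hη))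
  obtain ⟨n, hn⟩ := eventually_atTop.1 (hT'.and hE)
  refine ⟨n, fun N hN => ?_⟩
  obtain ⟨h1, h2⟩ := hn N hN
  rw [Real.dist_0_eq_abs, abs_of_nonneg measureReal_nonneg]
  have hm : Measurable fun ω => |A N ω - A' N ω| := by
    have := hA N; have := hA' N; fun_prop
  have hint : Integrable (fun ω => |A N ω - A' N ω|) P := by
    refine ⟨hm.aestronglyMeasurable, ?_⟩
    rw [hasFiniteIntegral_iff_ofReal (ae_of_all _ fun _ => abs_nonneg _)]
    exact h2.trans_lt ENNReal.ofReal_lt_top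
  have h3 : ∫ ω, |A N ω - A' N ω| ∂P ≤ δ := by
    rw [← ENNReal.ofReal_le_ofReal_iff hδ0.le, ofReal_integral_eq_lintegral_ofReal hint
      (ae_of_all _ fun _ => abs_nonneg _)]
    exact h2
  have h4 := mul_meas_ge_le_integral_of_nonneg (ae_of_all _ fun _ => abs_nonneg _) hint (ε / 3)
  have h5 : P.real {ω | ε / 3 ≤ |A N ω - A' N ω|} ≤ η / 2 := by
    have h6 : δ ≤ η * ε / 6 := min_le_right _ _
    have h7 := (h4.trans h3).trans h6
    have : ε / 3 * P.real {ω | ε / 3 ≤ |A N ω - A' N ω|} ≤ ε / 3 * (η / 2) := by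
      refine h7.trans (le_of_eq ?_); ring
    exact le_of_mul_le_mul_left this (by positivity)
  calc P.real {ω | ε ≤ ‖A N ω - a‖}
      ≤ P.real ({ω | ε / 3 ≤ |A N ω - A' N ω|} ∪ {ω | ε / 3 ≤ ‖A' N ω - a'‖}) := by
        refine measureReal_mono fun ω hω => ?_
        by_contra hcon
        simp only [Set.mem_union, Set.mem_ofPred_eq, not_or, not_le, Real.norm_eq_abs] at hcon hω
        have h8 : |A N ω - a| ≤ |A N ω - A' N ω| + |A' N ω - a'| + |a' - a| :=
          (abs_sub_le _ a' _).trans (by gcongr; exact abs_sub_le _ _ _)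
        have h9 : δ ≤ ε / 4 := min_le_left _ _
        linarith [hcon.1, hcon.2]
    _ ≤ _ := measureReal_union_le _ _
    _ < η := by linarith

/-- Bounded convergence for convergence in probability to a constant. -/
lemma TendstoInMeasure.eventually_integral_le {A : ℕ → Ω → ℝ} (hA : ∀ N, Measurable (A N))
    {a K : ℝ} (hK : ∀ N ω, |A N ω| ≤ K) (h : TendstoInMeasure P A atTop fun _ => a)
    {δ : ℝ} (hδ : 0 < δ) : ∀ᶠ N in atTop, ∫ ω, A N ω ∂P ≤ a + δ := by
  rw [tendstoInMeasure_iff_measureReal_norm] at h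
  have hK0 : 0 ≤ K := by
    obtain ⟨ω⟩ : Nonempty Ω := nonempty_of_isProbabilityMeasure P
    exact (abs_nonneg _).trans (hK 0 ω)
  have hC : 0 < K + |a| + 1 := by positivity
  have h1 := (h (δ / 2) (half_pos hδ)).eventually
    (gt_mem_nhds (show 0 < δ / 2 / (K + |a| + 1) by positivity))
  filter_upwards [h1] with N hN
  have hmeas : MeasurableSet {ω | δ / 2 ≤ ‖A N ω - a‖} := by
    have := hA N
    exact measurableSet_le measurable_const (by fun_prop)
  have hle : ∀ ω, A N ω ≤
      (a + δ / 2) + {ω | δ / 2 ≤ ‖A N ω - a‖}.indicator (fun _ => K + |a| + 1) ω := by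
    intro ω
    by_cases hω : δ / 2 ≤ ‖A N ω - a‖
    · rw [Set.indicator_of_mem (by exact hω)]
      linarith [le_abs_self (A N ω), hK N ω, neg_abs_le a]
    · rw [Set.indicator_of_notMem (by exact hω)]
      rw [not_le, Real.norm_eq_abs] at hω
      linarith [le_abs_self (A N ω - a)]
  have hi : Integrable (A N) P := Integrable.of_bound (hA N).aestronglyMeasurable K
    (ae_of_all _ fun ω => hK N ω)
  have hi2 : Integrable ({ω | δ / 2 ≤ ‖A N ω - a‖}.indicator (fun _ => K + |a| + 1)) P :=
    (integrable_const _).indicator hmeas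
  calc ∫ ω, A N ω ∂P ≤ ∫ ω, ((a + δ / 2) +
        {ω | δ / 2 ≤ ‖A N ω - a‖}.indicator (fun _ => K + |a| + 1) ω) ∂P :=
        integral_mono hi ((integrable_const _).add hi2) hle
    _ = a + δ / 2 + P.real {ω | δ / 2 ≤ ‖A N ω - a‖} * (K + |a| + 1) := by
        rw [integral_add (integrable_const _) hi2, integral_indicator hmeas]
        simp
    _ ≤ a + δ := by
        have := (lt_div_iff₀ hC).1 hN
        linarith

variable {S E : Type*} [MeasurableSpace S] [MeasurableSpace E]

/-- Random elements `Z i` whose conditional laws given the `X i` are the `J (X i)`, and that are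
pairwise conditionally independent. -/
structure IsConditionalSample (J : Kernel S E) {N : ℕ} (X : Fin N → Ω → S) (Z : Fin N → Ω → E)
    (P : Measure Ω) : Prop where
  measurable_left : ∀ i, Measurable (X i)
  measurable_right : ∀ i, Measurable (Z i)
  lintegral_eq : ∀ i (F : S × E → ℝ≥0∞), Measurable F →
    ∫⁻ ω, F (X i ω, Z i ω) ∂P = ∫⁻ ω, ∫⁻ z, F (X i ω, z) ∂J (X i ω) ∂P
  lintegral_mul_eq : ∀ i j, i ≠ j → ∀ F F' : S × E → ℝ≥0∞, Measurable F → Measurable F' →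
    ∫⁻ ω, F (X i ω, Z i ω) * F' (X j ω, Z j ω) ∂P =
      ∫⁻ ω, (∫⁻ z, F (X i ω, z) ∂J (X i ω)) * (∫⁻ z, F' (X j ω, z) ∂J (X j ω)) ∂P

variable {J : Kernel S E} [IsMarkovKernel J]

lemma integral_kernel_mem_Icc {F : S × E → ℝ} {K : ℝ} (h0 : ∀ p, 0 ≤ F p) (hK : ∀ p, F p ≤ K) (x : S) :
    0 ≤ ∫ z, F (x, z) ∂J x ∧ ∫ z, F (x, z) ∂J x ≤ K := by
  refine ⟨integral_nonneg fun z => h0 _, ?_⟩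
  calc _ ≤ ∫ _, K ∂J x := by
        refine integral_mono_of_nonneg (ae_of_all _ fun z => h0 _) (integrable_const _)
          (ae_of_all _ fun z => hK _)
    _ = K := by simp

lemma ofReal_integral_kernel {F : S × E → ℝ} {K : ℝ} (hF : Measurable F)
    (h0 : ∀ p, 0 ≤ F p) (hK : ∀ p, F p ≤ K) (x : S) :
    ENNReal.ofReal (∫ z, F (x, z) ∂J x) = ∫⁻ z, ENNReal.ofReal (F (x, z)) ∂J x := by
  refine ofReal_integral_eq_lintegral_ofReal ?_ (ae_of_all _ fun z => h0 _)
  refine Integrable.of_bound (hF.comp measurable_prodMk_left).aestronglyMeasurable K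
    (ae_of_all _ fun z => ?_)
  rw [Real.norm_eq_abs, abs_of_nonneg (h0 _)]; exact hK _

lemma measurable_integral_kernel {F : S × E → ℝ} (hF : Measurable F) :
    Measurable fun x => ∫ z, F (x, z) ∂J x :=
  hF.stronglyMeasurable.integral_kernel_prod_right'.measurable

omit [IsProbabilityMeasure P] in
lemma IsConditionalSample.integral_mul_eq {N : ℕ} {X : Fin N → Ω → S} {Z : Fin N → Ω → E}
    (h : IsConditionalSample J X Z P) {i j : Fin N} (hij : i ≠ j) {F F' : S × E → ℝ} {K : ℝ}
    (hF : Measurable F) (h0 : ∀ p, 0 ≤ F p) (hK : ∀ p, F p ≤ K)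
    (hF' : Measurable F') (h0' : ∀ p, 0 ≤ F' p) (hK' : ∀ p, F' p ≤ K) :
    ∫ ω, F (X i ω, Z i ω) * F' (X j ω, Z j ω) ∂P =
      ∫ ω, (∫ z, F (X i ω, z) ∂J (X i ω)) * (∫ z, F' (X j ω, z) ∂J (X j ω)) ∂P := by
  have hXm := h.measurable_left
  have hZm := h.measurable_right
  have m1 := measurable_integral_kernel (J := J) hF
  have m2 := measurable_integral_kernel (J := J) hF'
  rw [integral_eq_lintegral_of_nonneg_ae (ae_of_all _ fun ω => mul_nonneg (h0 _) (h0' _))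
      (by fun_prop), integral_eq_lintegral_of_nonneg_ae (ae_of_all _ fun ω => mul_nonneg
      (integral_kernel_mem_Icc h0 hK _).1 (integral_kernel_mem_Icc h0' hK' _).1)
      ((m1.comp (hXm i)).mul (m2.comp (hXm j))).aestronglyMeasurable]
  congr 1
  have e := h.lintegral_mul_eq i j hij (fun p => ENNReal.ofReal (F p))
    (fun p => ENNReal.ofReal (F' p)) (by fun_prop) (by fun_prop)
  simp only [← ofReal_integral_kernel hF h0 hK, ← ofReal_integral_kernel hF' h0' hK',
    ← ENNReal.ofReal_mul (h0 _)] at e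
  rw [e]
  refine lintegral_congr fun ω => ?_
  rw [ENNReal.ofReal_mul (integral_kernel_mem_Icc h0 hK _).1]

/-- The deviations of the `F (X i, Z i)` from their conditional means are pairwise orthogonal and
bounded by `K`, so only `N` diagonal terms of the double sum survive the factor `N⁻²`. -/
lemma IsConditionalSample.integral_sq_average_le {N : ℕ} {X : Fin N → Ω → S} {Z : Fin N → Ω → E}
    (h : IsConditionalSample J X Z P) {F : S × E → ℝ} {K : ℝ}
    (hF : Measurable F) (h0 : ∀ p, 0 ≤ F p) (hK : ∀ p, F p ≤ K) :
    ∫ ω, ((N : ℝ)⁻¹ * ∑ i, F (X i ω, Z i ω) -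
      (N : ℝ)⁻¹ * ∑ i, ∫ z, F (X i ω, z) ∂J (X i ω)) ^ 2 ∂P ≤ K ^ 2 * (N : ℝ)⁻¹ := by
  have hXm := h.measurable_left
  have hZm := h.measurable_right
  set f : S → ℝ := fun x => ∫ z, F (x, z) ∂J x with hf
  have m1 : Measurable f := measurable_integral_kernel (J := J) hF
  have hf0 : ∀ x, 0 ≤ f x := fun x => (integral_kernel_mem_Icc h0 hK x).1
  have hfK : ∀ x, f x ≤ K := fun x => (integral_kernel_mem_Icc h0 hK x).2
  set D : Fin N → Ω → ℝ := fun i ω => F (X i ω, Z i ω) - f (X i ω) with hD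
  have mD : ∀ i, Measurable (D i) := fun i => by
    have := m1.comp (hXm i)
    have h3 : Measurable fun ω => F (X i ω, Z i ω) := by fun_prop
    exact h3.sub this
  have bD : ∀ i ω, |D i ω| ≤ K := fun i ω => by
    rw [abs_le]; constructor <;> simp only [hD] <;>
    linarith [h0 (X i ω, Z i ω), hK (X i ω, Z i ω), hf0 (X i ω), hfK (X i ω)]
  have bb : ∀ (u v : Ω → ℝ), Measurable u → Measurable v → (∀ ω, |u ω| ≤ K) → (∀ ω, |v ω| ≤ K) →
      Integrable (fun ω => u ω * v ω) P := fun u v hu hv hu' hv' => by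
    refine Integrable.of_bound (by fun_prop) (K * K) (ae_of_all _ fun ω => ?_)
    rw [norm_mul]
    exact mul_le_mul (hu' ω) (hv' ω) (norm_nonneg _) ((abs_nonneg _).trans (hu' ω))
  have iD : ∀ i j, Integrable (fun ω => D i ω * D j ω) P := fun i j =>
    bb _ _ (mD i) (mD j) (bD i) (bD j)
  -- The conditional mean `f`, read as a function on `S × E` that ignores its second argument, is
  -- its own conditional mean. Hence all four products in the expansion have the same integral.
  have cross : ∀ i j, i ≠ j → ∫ ω, D i ω * D j ω ∂P = 0 := by
    intro i j hij
    have mf : Measurable fun p : S × E => f p.1 := m1.comp measurable_fst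
    have e1 := h.integral_mul_eq hij hF h0 hK hF h0 hK
    have e2 := h.integral_mul_eq hij hF h0 hK mf (fun p => hf0 _) (fun p => hfK _)
    have e3 := h.integral_mul_eq hij mf (fun p => hf0 _) (fun p => hfK _) hF h0 hK
    simp only [integral_const, probReal_univ, one_smul] at e2 e3
    have m3 : ∀ i, Measurable fun ω => F (X i ω, Z i ω) := fun i => by fun_prop
    have m4 : ∀ i, Measurable fun ω => f (X i ω) := fun i => m1.comp (hXm i)
    have b3 : ∀ i ω, |F (X i ω, Z i ω)| ≤ K := fun i ω => by
      rw [abs_of_nonneg (h0 _)]; exact hK _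
    have b4 : ∀ i ω, |f (X i ω)| ≤ K := fun i ω => by
      rw [abs_of_nonneg (hf0 _)]; exact hfK _
    have e : ∀ ω, D i ω * D j ω = (F (X i ω, Z i ω) * F (X j ω, Z j ω) -
        F (X i ω, Z i ω) * f (X j ω)) - (f (X i ω) * F (X j ω, Z j ω) - f (X i ω) * f (X j ω)) :=
      fun ω => by simp only [hD]; ring
    simp only [e]
    rw [integral_sub, integral_sub, integral_sub, e1, e2, e3]
    · ring
    · exact bb _ _ (m4 i) (m3 j) (b4 i) (b3 j)
    · exact bb _ _ (m4 i) (m4 j) (b4 i) (b4 j)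
    · exact bb _ _ (m3 i) (m3 j) (b3 i) (b3 j)
    · exact bb _ _ (m3 i) (m4 j) (b3 i) (b4 j)
    · exact (bb _ _ (m3 i) (m3 j) (b3 i) (b3 j)).sub (bb _ _ (m3 i) (m4 j) (b3 i) (b4 j))
    · exact (bb _ _ (m4 i) (m3 j) (b4 i) (b3 j)).sub (bb _ _ (m4 i) (m4 j) (b4 i) (b4 j))
  have e : ∀ ω, ((N : ℝ)⁻¹ * ∑ i, F (X i ω, Z i ω) - (N : ℝ)⁻¹ * ∑ i, f (X i ω)) ^ 2 =
      (N : ℝ)⁻¹ ^ 2 * ∑ i, ∑ j, D i ω * D j ω := by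
    intro ω
    rw [← mul_sub, ← Finset.sum_sub_distrib, mul_pow, sq (∑ _, _), Finset.sum_mul_sum]
  have diag : ∀ i, ∫ ω, D i ω * D i ω ∂P ≤ K ^ 2 := by
    intro i
    calc _ ≤ ∫ _, K ^ 2 ∂P := integral_mono (iD i i) (integrable_const _) fun ω => by
          simp only
          rw [← sq, ← sq_abs]
          exact pow_le_pow_left₀ (abs_nonneg _) (bD i ω) 2
      _ = K ^ 2 := by simp
  change ∫ ω, ((N : ℝ)⁻¹ * ∑ i, F (X i ω, Z i ω) - (N : ℝ)⁻¹ * ∑ i, f (X i ω)) ^ 2 ∂P ≤ _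
  simp only [e]
  rw [integral_const_mul, integral_finsetSum _ fun i _ => integrable_finsetSum _ fun j _ => iD i j]
  simp only [integral_finsetSum _ fun j _ => iD _ j]
  have hs : ∀ i, ∑ j, ∫ ω, D i ω * D j ω ∂P ≤ K ^ 2 := fun i => by
    rw [Finset.sum_eq_single i (fun j _ hj => cross i j hj.symm) (by simp)]
    exact diag i
  calc _ ≤ (N : ℝ)⁻¹ ^ 2 * ∑ _i : Fin N, K ^ 2 := by
        gcongr with i
        exact hs i
    _ = K ^ 2 * (N : ℝ)⁻¹ := by
        rcases Nat.eq_zero_or_pos N with rfl | hN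
        · simp
        · have : (N : ℝ) ≠ 0 := by positivity
          simp
          field_simp

variable {μ : Measure S} [IsProbabilityMeasure μ]
  {X : (N : ℕ) → Fin N → Ω → S} {Z : (N : ℕ) → Fin N → Ω → E}

/-- The weak law of large numbers for conditionally independent bounded variables. -/
lemma tendstoInMeasure_average_of_bounded (h : ∀ N, IsConditionalSample J (X N) (Z N) P)
    (hrep : Represents X μ P) {F : S × E → ℝ} {K : ℝ}
    (hF : Measurable F) (h0 : ∀ p, 0 ≤ F p) (hK : ∀ p, F p ≤ K) :
    TendstoInMeasure P (fun (N : ℕ) ω => (N : ℝ)⁻¹ * ∑ i, F (X N i ω, Z N i ω)) atTop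
      fun _ => ∫ p, F p ∂(μ ⊗ₘ J) := by
  have hXm := fun N => (h N).measurable_left
  have hZm := fun N => (h N).measurable_right
  have m1 := measurable_integral_kernel (J := J) hF
  have mA : ∀ N : ℕ, Measurable fun ω => (N : ℝ)⁻¹ * ∑ i, F (X N i ω, Z N i ω) := fun N => by fun_prop
  have mA' : ∀ N : ℕ, Measurable fun ω => (N : ℝ)⁻¹ * ∑ i, ∫ z, F (X N i ω, z) ∂J (X N i ω) :=
    fun N => (Finset.measurable_sum _ fun i _ => m1.comp (hXm N i)).const_mul _
  have hint : Integrable F (μ ⊗ₘ J) := Integrable.of_bound hF.aestronglyMeasurable K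
    (ae_of_all _ fun p => by rw [Real.norm_eq_abs, abs_of_nonneg (h0 _)]; exact hK _)
  -- The approximants are the averages of the conditional means: `Represents` gives their limit, and
  -- the variance bound of order `1/N` makes the difference small in mean.
  refine tendstoInMeasure_of_approx mA fun δ hδ =>
    ⟨fun (N : ℕ) ω => (N : ℝ)⁻¹ * ∑ i, ∫ z, F (X N i ω, z) ∂J (X N i ω), ∫ p, F p ∂(μ ⊗ₘ J), mA',
      ?_, by simpa using hδ.le, ?_⟩
  · rw [Measure.integral_compProd hint]
    refine hrep (fun x => ∫ z, F (x, z) ∂J x) m1 ⟨K, fun x => ?_⟩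
    obtain ⟨h1, h2⟩ := integral_kernel_mem_Icc (J := J) h0 hK x
    rwa [abs_of_nonneg h1]
  · have hlim : Tendsto (fun N : ℕ => δ / 2 + (2 * δ)⁻¹ * (K ^ 2 * (N : ℝ)⁻¹)) atTop
        (𝓝 (δ / 2 + (2 * δ)⁻¹ * (K ^ 2 * 0))) :=
      ((tendsto_inv_atTop_nhds_zero_nat.const_mul _).const_mul _).const_add _
    filter_upwards [hlim.eventually (gt_mem_nhds (show δ / 2 + (2 * δ)⁻¹ * (K ^ 2 * 0) < δ by
      linarith))] with N hN
    set B : Ω → ℝ := fun ω => (N : ℝ)⁻¹ * ∑ i, F (X N i ω, Z N i ω) -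
      (N : ℝ)⁻¹ * ∑ i, ∫ z, F (X N i ω, z) ∂J (X N i ω) with hB
    have mB : Measurable B := (mA N).sub (mA' N)
    have hav : ∀ g : Fin N → ℝ, (∀ i, 0 ≤ g i ∧ g i ≤ K) →
        0 ≤ (N : ℝ)⁻¹ * ∑ i, g i ∧ (N : ℝ)⁻¹ * ∑ i, g i ≤ |K| := by
      intro g hg
      refine ⟨mul_nonneg (by positivity) (Finset.sum_nonneg fun i _ => (hg i).1), ?_⟩
      rcases Nat.eq_zero_or_pos N with h00 | hN0
      · simp [h00]
      · rw [inv_mul_le_iff₀ (by positivity)]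
        calc _ ≤ ∑ _i : Fin N, |K| := Finset.sum_le_sum fun i _ => (hg i).2.trans (le_abs_self _)
          _ = _ := by simp
    have bB : ∀ ω, |B ω| ≤ |K| := fun ω => by
      have h1 := hav (fun i => F (X N i ω, Z N i ω)) fun i => ⟨h0 _, hK _⟩
      have h2 := hav (fun i => ∫ z, F (X N i ω, z) ∂J (X N i ω))
        fun i => integral_kernel_mem_Icc h0 hK _
      rw [abs_le]; constructor <;> simp only [hB] <;> linarith [h1.1, h1.2, h2.1, h2.2]
    have iB : Integrable (fun ω => |B ω|) P := Integrable.of_bound (by fun_prop) |K|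
      (ae_of_all _ fun ω => by simpa using bB ω)
    have iB2 : Integrable (fun ω => (B ω) ^ 2) P := Integrable.of_bound (by fun_prop) (|K| ^ 2)
      (ae_of_all _ fun ω => by
        rw [Real.norm_eq_abs, abs_pow]; exact pow_le_pow_left₀ (abs_nonneg _) (bB ω) 2)
    rw [← ofReal_integral_eq_lintegral_ofReal iB (ae_of_all _ fun _ => abs_nonneg _)]
    apply ENNReal.ofReal_le_ofReal
    calc ∫ ω, |B ω| ∂P ≤ ∫ ω, (δ / 2 + (2 * δ)⁻¹ * (B ω) ^ 2) ∂P := by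
          refine integral_mono iB ((integrable_const _).add (iB2.const_mul _)) fun ω => ?_
          -- Completing the square bounds the first absolute moment by the second moment, with an
          -- error `δ/2`.
          have : δ / 2 + (2 * δ)⁻¹ * (B ω) ^ 2 - |B ω| = (2 * δ)⁻¹ * (δ - |B ω|) ^ 2 := by
            rw [← sq_abs (B ω)]; generalize |B ω| = u; field_simp; ring
          have h3 : 0 ≤ (2 * δ)⁻¹ * (δ - |B ω|) ^ 2 := by positivity
          simp only
          linarith
      _ = δ / 2 + (2 * δ)⁻¹ * ∫ ω, (B ω) ^ 2 ∂P := by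
          rw [integral_add (integrable_const _) (iB2.const_mul _), integral_const_mul]
          simp
      _ ≤ δ / 2 + (2 * δ)⁻¹ * (K ^ 2 * (N : ℝ)⁻¹) := by
          gcongr
          exact (h N).integral_sq_average_le hF h0 hK
      _ ≤ δ := hN.le

/-- The weak law of large numbers for conditionally independent variables with bounded conditional
means. -/
theorem tendstoInMeasure_average (h : ∀ N, IsConditionalSample J (X N) (Z N) P)
    (hrep : Represents X μ P) {G : S × E → ℝ} {C : ℝ}
    (hG : Measurable G) (h0 : ∀ p, 0 ≤ G p)
    (hC : ∀ x, ∫⁻ z, ENNReal.ofReal (G (x, z)) ∂J x ≤ ENNReal.ofReal C) :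
    TendstoInMeasure P (fun (N : ℕ) ω => (N : ℝ)⁻¹ * ∑ i, G (X N i ω, Z N i ω)) atTop
      fun _ => ∫ p, G p ∂(μ ⊗ₘ J) := by
  have hXm := fun N => (h N).measurable_left
  have hZm := fun N => (h N).measurable_right
  have hfin : ∫⁻ p, ENNReal.ofReal (G p) ∂(μ ⊗ₘ J) ≤ ENNReal.ofReal C := by
    rw [Measure.lintegral_compProd (by fun_prop)]
    calc _ ≤ ∫⁻ _, ENNReal.ofReal C ∂μ := lintegral_mono hC
      _ = _ := by simp
  have hint : Integrable G (μ ⊗ₘ J) := by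
    refine ⟨hG.aestronglyMeasurable, ?_⟩
    rw [hasFiniteIntegral_iff_ofReal (ae_of_all _ h0)]
    exact hfin.trans_lt ENNReal.ofReal_lt_top
  have htail : Tendsto (fun n : ℕ => ∫⁻ p, ENNReal.ofReal (G p - min (G p) n) ∂(μ ⊗ₘ J)) atTop
      (𝓝 (∫⁻ _, 0 ∂(μ ⊗ₘ J))) := by
    refine tendsto_lintegral_filter_of_dominated_convergence (fun p => ENNReal.ofReal (G p))
      (Eventually.of_forall fun n => by fun_prop) (Eventually.of_forall fun n =>
        ae_of_all _ fun p => ?_) (hfin.trans_lt ENNReal.ofReal_lt_top).ne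
        (ae_of_all _ fun p => ?_)
    · apply ENNReal.ofReal_le_ofReal
      have : 0 ≤ min (G p) n := le_min (h0 p) (by positivity)
      linarith
    · obtain ⟨n, hn⟩ := exists_nat_ge (G p)
      refine tendsto_const_nhds.congr' ?_
      filter_upwards [eventually_ge_atTop n] with k hk
      rw [min_eq_left (hn.trans (by exact_mod_cast hk))]
      simp
  rw [lintegral_zero] at htail
  refine tendstoInMeasure_of_approx (fun N => by fun_prop) fun δ hδ => ?_
  have hδ2 : (0 : ℝ≥0∞) < ENNReal.ofReal (δ / 2) := by simpa using hδ
  -- The truncation level: `H`, the excess of `G` over `n`, has mean below `δ/2` under the limiting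
  -- law.
  obtain ⟨n, hn⟩ := (htail.eventually (gt_mem_nhds hδ2)).exists
  set F : S × E → ℝ := fun p => min (G p) n with hFdef
  set H : S × E → ℝ := fun p => G p - min (G p) n with hHdef
  have mF : Measurable F := by fun_prop
  have mH : Measurable H := by fun_prop
  have hF0 : ∀ p, 0 ≤ F p := fun p => le_min (h0 p) (by positivity)
  have hFn : ∀ p, F p ≤ n := fun p => min_le_right _ _
  have hH0 : ∀ p, 0 ≤ H p := fun p => sub_nonneg.2 (min_le_left _ _)
  have hHG : ∀ p, H p ≤ G p := fun p => by
    have := hF0 p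
    simp only [hHdef, hFdef] at this ⊢; linarith
  have intH : Integrable H (μ ⊗ₘ J) := hint.mono' mH.aestronglyMeasurable
    (ae_of_all _ fun p => by rw [Real.norm_eq_abs, abs_of_nonneg (hH0 p)]; exact hHG p)
  have hHint : ∫ p, H p ∂(μ ⊗ₘ J) ≤ δ / 2 := by
    rw [← ENNReal.ofReal_le_ofReal_iff (half_pos hδ).le,
      ofReal_integral_eq_lintegral_ofReal intH (ae_of_all _ hH0)]
    exact hn.le
  refine ⟨fun (N : ℕ) ω => (N : ℝ)⁻¹ * ∑ i, F (X N i ω, Z N i ω), ∫ p, F p ∂(μ ⊗ₘ J),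
    fun N => by fun_prop, tendstoInMeasure_average_of_bounded h hrep mF hF0 hFn, ?_, ?_⟩
  · have intF : Integrable F (μ ⊗ₘ J) := hint.mono' mF.aestronglyMeasurable
      (ae_of_all _ fun p => by
        rw [Real.norm_eq_abs, abs_of_nonneg (hF0 p)]; exact min_le_left _ _)
    have e : ∫ p, G p ∂(μ ⊗ₘ J) - ∫ p, F p ∂(μ ⊗ₘ J) = ∫ p, H p ∂(μ ⊗ₘ J) := by
      rw [← integral_sub hint intF]
    rw [abs_sub_comm, e, abs_of_nonneg (integral_nonneg hH0)]
    linarith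
  · -- the conditional means of the excess
    set r : S → ℝ := fun x => ∫ z, H (x, z) ∂J x with hr
    have mr : Measurable r := measurable_integral_kernel mH
    have hHC : ∀ x, ∫⁻ z, ENNReal.ofReal (H (x, z)) ∂J x ≤ ENNReal.ofReal C := fun x =>
      (lintegral_mono fun z => ENNReal.ofReal_le_ofReal (hHG _)).trans (hC x)
    have ir : ∀ x, ENNReal.ofReal (r x) = ∫⁻ z, ENNReal.ofReal (H (x, z)) ∂J x := fun x => by
      refine ofReal_integral_eq_lintegral_ofReal ⟨
        (mH.comp measurable_prodMk_left).aestronglyMeasurable, ?_⟩ (ae_of_all _ fun z => hH0 _)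
      rw [hasFiniteIntegral_iff_ofReal (ae_of_all _ fun z => hH0 _)]
      exact (hHC x).trans_lt ENNReal.ofReal_lt_top
    have hr0 : ∀ x, 0 ≤ r x := fun x => integral_nonneg fun z => hH0 _
    -- The excess itself is unbounded, but its conditional mean `r` is bounded. `Represents`
    -- therefore applies to `r` and controls the mean excess for finite `N`, although the particles
    -- need not have the law `μ`.
    have hrC : ∀ x, r x ≤ |C| := fun x => by
      rw [← ENNReal.ofReal_le_ofReal_iff (abs_nonneg C), ir]
      exact (hHC x).trans (ENNReal.ofReal_le_ofReal (le_abs_self C))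
    have hrT := hrep r mr ⟨|C|, fun x => by rw [abs_of_nonneg (hr0 x)]; exact hrC x⟩
    rw [hr, ← Measure.integral_compProd intH] at hrT
    have mR : ∀ N : ℕ, Measurable fun ω => (N : ℝ)⁻¹ * ∑ i, r (X N i ω) := fun N =>
      (Finset.measurable_sum _ fun i _ => mr.comp (hXm N i)).const_mul _
    have hRn : ∀ (N : ℕ) ω, 0 ≤ (N : ℝ)⁻¹ * ∑ i, r (X N i ω) := fun N ω =>
      mul_nonneg (by positivity) (Finset.sum_nonneg fun i _ => hr0 _)
    have hRb : ∀ (N : ℕ) ω, |(N : ℝ)⁻¹ * ∑ i, r (X N i ω)| ≤ |C| := fun N ω => by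
      rw [abs_of_nonneg (hRn N ω)]
      rcases Nat.eq_zero_or_pos N with h00 | hN0
      · simp [h00]
      · rw [inv_mul_le_iff₀ (by positivity)]
        calc _ ≤ ∑ _i : Fin N, |C| := Finset.sum_le_sum fun i _ => hrC _
          _ = _ := by simp
    filter_upwards [TendstoInMeasure.eventually_integral_le mR hRb hrT (half_pos hδ)] with N hN
    have e1 : ∀ ω, |(N : ℝ)⁻¹ * ∑ i, G (X N i ω, Z N i ω) -
        (N : ℝ)⁻¹ * ∑ i, F (X N i ω, Z N i ω)| = (N : ℝ)⁻¹ * ∑ i, H (X N i ω, Z N i ω) := by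
      intro ω
      rw [← mul_sub, ← Finset.sum_sub_distrib, abs_of_nonneg]
      exact mul_nonneg (by positivity) (Finset.sum_nonneg fun i _ => hH0 _)
    have hN0 : (0 : ℝ) ≤ (N : ℝ)⁻¹ := by positivity
    have e2 : ∫⁻ ω, ENNReal.ofReal ((N : ℝ)⁻¹ * ∑ i, H (X N i ω, Z N i ω)) ∂P =
        ∫⁻ ω, ENNReal.ofReal ((N : ℝ)⁻¹ * ∑ i, r (X N i ω)) ∂P := by
      simp only [ENNReal.ofReal_mul hN0, ENNReal.ofReal_sum_of_nonneg fun i _ => hH0 _,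
        ENNReal.ofReal_sum_of_nonneg fun i _ => hr0 _]
      rw [lintegral_const_mul' _ _ ENNReal.ofReal_ne_top,
        lintegral_const_mul' _ _ ENNReal.ofReal_ne_top,
        lintegral_finsetSum _ fun i _ => by fun_prop, lintegral_finsetSum (μ := P) (f := fun i ω => ENNReal.ofReal (r (X N i ω))) _
          fun i _ => (mr.comp (hXm N i)).ennreal_ofReal]
      congr 1
      refine Finset.sum_congr rfl fun i _ => ?_
      rw [(h N).lintegral_eq i (fun p => ENNReal.ofReal (H p)) (by fun_prop)]
      simp only [ir]
    simp only [e1]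
    rw [e2, ← ofReal_integral_eq_lintegral_ofReal (Integrable.of_bound
      (mR N).aestronglyMeasurable |C| (ae_of_all _ (hRb N))) (ae_of_all _ (hRn N))]
    apply ENNReal.ofReal_le_ofReal
    linarith

end LargeNumbers


/-! ### Laws on the path space and uniqueness of the Brownian bridge -/

section PathSpace

variable {d : ℕ} {s t : ℝ}

instance : MeasurableSpace (Path d s t) := pathSigma d s t

lemma measurable_path_eval (u : Set.Icc s t) : Measurable fun w : Path d s t => w u :=
  measurable_iff_comap_le.2 (le_iSup (fun u : Set.Icc s t =>
    MeasurableSpace.comap (fun w : Path d s t => w u) inferInstance) u)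

lemma measurable_to_path {α : Type*} {mα : MeasurableSpace α} {f : α → Path d s t}
    (h : ∀ u, Measurable fun x => f x u) : Measurable f := by
  rw [measurable_iff_comap_le]
  change MeasurableSpace.comap f (⨆ u, _) ≤ mα
  rw [MeasurableSpace.comap_iSup]
  refine iSup_le fun u => ?_
  rw [MeasurableSpace.comap_comp]
  exact measurable_iff_comap_le.1 (h u)

lemma measurable_path_eval_uncurry :
    Measurable fun p : Path d s t × Set.Icc s t => p.1 p.2 := by
  have h : Measurable (Function.uncurry fun (u : Set.Icc s t) (w : Path d s t) => w u) :=
    measurable_uncurry_of_continuous_of_measurable (fun w => w.continuous) measurable_path_eval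
  exact h.comp measurable_swap

/-- Laws on the path space are determined by the laws of the evaluations. -/
lemma path_measure_ext {ν ν' : Measure (Path d s t)}
    (h : ν.map (fun w u => w u) = ν'.map (fun w u => w u)) : ν = ν' := by
  have hm : Measurable fun (w : Path d s t) (u : Set.Icc s t) => w u :=
    measurable_pi_lambda _ measurable_path_eval
  refine Measure.ext fun A hA => ?_
  have hle : (inferInstance : MeasurableSpace (Path d s t)) ≤
      MeasurableSpace.comap (fun (w : Path d s t) (u : Set.Icc s t) => w u) inferInstance := by
    refine iSup_le fun u => ?_
    rw [← measurable_iff_comap_le]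
    exact (measurable_pi_apply u).comp (comap_measurable _)
  obtain ⟨A', hA', rfl⟩ := hle A hA
  rw [← Measure.map_apply hm hA', ← Measure.map_apply hm hA', h]

lemma StrongDual.apply_eq_sum_coord {I : Type*} [Fintype I] [DecidableEq I]
    (L : StrongDual ℝ (I → Pt d)) (x : I → Pt d) :
    L x = ∑ p : I × Fin d, L (Pi.single p.1 (EuclideanSpace.single p.2 1)) * x p.1 p.2 := by
  have h1 : x = ∑ u, ∑ i, x u i • (Pi.single u (EuclideanSpace.single i 1) : I → Pt d) := by
    ext u i
    simp [Finset.sum_apply, Pi.single_apply, apply_ite]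
  conv_lhs => rw [h1]
  simp only [map_sum, map_smul, smul_eq_mul]
  rw [Fintype.sum_prod_type]
  exact Finset.sum_congr rfl fun u _ => Finset.sum_congr rfl fun i _ => mul_comm _ _

variable {Ω Ω' : Type*} [MeasurableSpace Ω] [MeasurableSpace Ω'] {P : Measure Ω} {P' : Measure Ω'}

lemma IsBrownianBridge.memLp {Λ : Matrix (Fin d) (Fin d) ℝ} {B : Set.Icc s t → Ω → Pt d}
    (h : IsBrownianBridge Λ B P) (u : Set.Icc s t) (i : Fin d) :
    MemLp (fun ω => B u ω i) 2 P :=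
  ((h.gaussian.hasGaussianLaw_eval u).map_fun (EuclideanSpace.proj i)).memLp_two

/-- The right side contains only `Λ`, the times and `L`: a centred Gaussian law is determined by its
covariances. This is what makes any two bridges with the same `Λ` comparable. -/
lemma IsBrownianBridge.charFunDual_restrict_eq {Λ : Matrix (Fin d) (Fin d) ℝ}
    {B : Set.Icc s t → Ω → Pt d} (h : IsBrownianBridge Λ B P) (I : Finset (Set.Icc s t))
    (L : StrongDual ℝ (I → Pt d)) :
    charFunDual (P.map fun ω => I.restrict (B · ω)) L =
      Complex.exp (-((∑ p : I × Fin d, ∑ q : I × Fin d,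
        L (Pi.single p.1 (EuclideanSpace.single p.2 1)) *
        (L (Pi.single q.1 (EuclideanSpace.single q.2 1)) *
        ((min (p.1 : ℝ) (q.1 : ℝ) - s) * (t - max (p.1 : ℝ) (q.1 : ℝ)) / (t - s) *
          Λ p.2 q.2)) : ℝ) : ℂ) / 2) := by
  have hP := h.gaussian.isProbabilityMeasure
  rw [(h.gaussian.hasGaussianLaw I).charFunDual_map_eq_fun L]
  have e : (fun ω => L (I.restrict (B · ω))) = fun ω => ∑ p : I × Fin d,
      L (Pi.single p.1 (EuclideanSpace.single p.2 1)) * B p.1 ω p.2 :=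
    funext fun ω => StrongDual.apply_eq_sum_coord L _
  rw [e]
  have hm : ∀ p : I × Fin d, MemLp (fun ω => L (Pi.single p.1 (EuclideanSpace.single p.2 1)) *
      B p.1 ω p.2) 2 P := fun p => (h.memLp _ _).const_mul _
  rw [integral_finsetSum _ fun p _ => (hm p).integrable (by norm_num), variance_fun_sum hm]
  have h1 : ∀ p : I × Fin d, ∫ ω, L (Pi.single p.1 (EuclideanSpace.single p.2 1)) *
      B p.1 ω p.2 ∂P = 0 := fun p => by rw [integral_const_mul, h.mean, mul_zero]
  have h2 : ∀ p q : I × Fin d, cov[fun ω => L (Pi.single p.1 (EuclideanSpace.single p.2 1)) *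
      B p.1 ω p.2, fun ω => L (Pi.single q.1 (EuclideanSpace.single q.2 1)) * B q.1 ω q.2; P] =
      L (Pi.single p.1 (EuclideanSpace.single p.2 1)) *
        (L (Pi.single q.1 (EuclideanSpace.single q.2 1)) *
        ((min (p.1 : ℝ) (q.1 : ℝ) - s) * (t - max (p.1 : ℝ) (q.1 : ℝ)) / (t - s) *
          Λ p.2 q.2)) := fun p q => by
    rw [covariance_const_mul_left, covariance_const_mul_right, h.covariance]
  simp only [h1, h2]
  rw [Finset.sum_const_zero, Complex.ofReal_zero, zero_mul, zero_sub, neg_div]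

/-- All Brownian bridges with the same covariance matrix have the same law. -/
lemma IsBrownianBridge.map_eq {Λ : Matrix (Fin d) (Fin d) ℝ} {B : Ω → Path d s t}
    {B' : Ω' → Path d s t} (h : IsBrownianBridge Λ (fun u ω => B ω u) P)
    (h' : IsBrownianBridge Λ (fun u ω => B' ω u) P') (hB : Measurable B) (hB' : Measurable B') :
    P.map B = P'.map B' := by
  have hP := h.gaussian.isProbabilityMeasure
  have hP' := h'.gaussian.isProbabilityMeasure
  have hm : Measurable fun (w : Path d s t) (u : Set.Icc s t) => w u :=
    measurable_pi_lambda _ measurable_path_eval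
  apply path_measure_ext
  rw [Measure.map_map hm hB, Measure.map_map hm hB']
  have e : ∀ I : Finset (Set.Icc s t), P.map (fun ω => I.restrict (fun u => B ω u)) =
      P'.map (fun ω => I.restrict (fun u => B' ω u)) := by
    intro I
    have := (h.gaussian.hasGaussianLaw I).isGaussian_map
    have := (h'.gaussian.hasGaussianLaw I).isGaussian_map
    apply Measure.ext_of_charFunDual
    ext L
    rw [h.charFunDual_restrict_eq, h'.charFunDual_restrict_eq]
  -- Both laws on the full product space are projective limits of the same finite-dimensional
  -- marginals.
  have l1 := isProjectiveLimit_map (X := fun u ω => B ω u) (P := P) (hm.comp hB).aemeasurable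
  have l2 := isProjectiveLimit_map (X := fun u ω => B' ω u) (P := P') (hm.comp hB').aemeasurable
  simp only [e] at l1
  exact l1.unique l2

/-- The segment from `x` to `y` as a path. -/
def segmentPath (x y : Pt d) : Path d s t :=
  ⟨fun u => interpolate x y u, by unfold interpolate; fun_prop⟩

end PathSpace


/-! ### The noise of one particle, its law and its independence of the old states -/

section Noise

/-- The values of the sources of randomness of one particle: the deviation of the new state from
its mean, the deviations of the paths from the segments, and the times. -/
abbrev Noise (ι : Type*) (d : ℕ) (s t : ℝ) : Type _ :=
  EuclideanSpace ℝ (ι × Fin d) × (ι → Path d s t) × (ι × ℕ → Set.Icc s t)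

set_option synthInstance.maxHeartbeats 400000 in
instance {ι : Type*} [Fintype ι] {d : ℕ} {s t : ℝ} (Q : Measure (Noise ι d s t))
    [IsProbabilityMeasure Q] : SFinite Q := inferInstance

instance {ι : Type*} [Fintype ι] {d : ℕ} {s t : ℝ} (Q : Measure (Noise ι d s t))
    [IsProbabilityMeasure Q] : SFinite (Q.prod Q) := Measure.prod.instSFinite

/-- The uniform distribution on `[s,t]`. -/
def uniformTime (s t : ℝ) : Measure (Set.Icc s t) :=
  ProbabilityTheory.cond (timeMeasure s t) Set.univ

lemma timeMeasure_univ (s t : ℝ) : timeMeasure s t Set.univ = ENNReal.ofReal (t - s) := by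
  rw [timeMeasure, comap_subtype_coe_apply measurableSet_Icc, Set.image_univ,
    Subtype.range_coe, Real.volume_Icc]

instance (s t : ℝ) : IsFiniteMeasure (timeMeasure s t) :=
  ⟨by rw [timeMeasure_univ]; exact ENNReal.ofReal_lt_top⟩

lemma isProbabilityMeasure_uniformTime {s t : ℝ} (hst : s < t) :
    IsProbabilityMeasure (uniformTime s t) :=
  cond_isProbabilityMeasure (by rw [timeMeasure_univ]; simpa using hst)

/-- The particle to which a source of randomness belongs. -/
def Source.owner {ι : Type*} {N : ℕ} : Source ι N → Option (Fin N)
  | .start => none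
  | .move i => some i
  | .bridge i _ => some i
  | .time i _ _ => some i

variable {ι : Type*} [Fintype ι] {d : ℕ} (M : GaussianModel ι d)

/-- The law of the noise of one particle, if `β c` is the law of the bridge for `c`. -/
def noiseLaw [DecidableEq ι] {s t : ℝ} (β : ι → Measure (Path d s t)) : Measure (Noise ι d s t) :=
  (multivariateGaussian 0 (M.transCov s t)).prod
    ((Measure.pi β).prod (Measure.infinitePi fun _ => uniformTime s t))

lemma GaussianModel.continuous_wmean : Continuous M.wmean := by
  unfold GaussianModel.wmean
  fun_prop

lemma GaussianModel.continuous_transMean (s t : ℝ) : Continuous (M.transMean s t) := by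
  have := M.continuous_wmean
  refine continuous_pi fun c => ?_
  unfold GaussianModel.transMean
  fun_prop

namespace StepData

variable {s t : ℝ} {Ω : Type*} {N : ℕ} (D : StepData ι d s t Ω N)

/-- The deviation of a path from the segment between the endpoints, as a path. -/
def bridge (i : Fin N) (c : ι) (ω : Ω) : Path d s t :=
  D.path i c ω - segmentPath (D.prev i ω c) (D.next i ω c)

/-- The noise of one particle. -/
def noise (i : Fin N) (ω : Ω) : Noise ι d s t :=
  (D.innovation M i ω, fun c => D.bridge i c ω, fun p => D.ξ i p.1 p.2 ω)

lemma measurable_sigma {S : Set (Source ι N)} {q : Source ι N} (hq : q ∈ S) {β : Type*}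
    {mβ : MeasurableSpace β} {f : Ω → β} (hf : Measurable[D.sigma M q] f) :
    Measurable[⨆ q ∈ S, D.sigma M q] f :=
  hf.mono (le_iSup₂ (f := fun q (_ : q ∈ S) => D.sigma M q) q hq) le_rfl

lemma measurable_innovation_sigma (i : Fin N) :
    Measurable[D.sigma M (.move i)] (D.innovation M i) := comap_measurable _

lemma measurable_bridge_sigma (i : Fin N) (c : ι) :
    Measurable[D.sigma M (.bridge i c)] (D.bridge i c) := by
  refine measurable_to_path (mα := D.sigma M (.bridge i c)) fun u => ?_
  exact measurable_iff_comap_le.2 (le_iSup (fun u =>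
    MeasurableSpace.comap (D.fluctuation i c u) inferInstance) u)

lemma measurable_time_sigma (i : Fin N) (c : ι) (r : ℕ) :
    Measurable[D.sigma M (.time i c r)] (D.ξ i c r) := comap_measurable _

lemma measurable_prev_sigma (i : Fin N) : Measurable[D.sigma M .start] (D.prev i) :=
  (measurable_pi_apply i).comp (comap_measurable fun ω i => D.prev i ω)

/-- The noise of particle `i` uses only the sources that it owns. Sorting the sources by
`Source.owner` thus yields the disjoint sets needed for independence. -/
lemma measurable_noise_sigma {S : Set (Source ι N)} {i : Fin N}
    (hS : ∀ q : Source ι N, q.owner = some i → q ∈ S) :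
    Measurable[⨆ q ∈ S, D.sigma M q] (D.noise M i) := by
  refine Measurable.prodMk ?_ (Measurable.prodMk ?_ ?_)
  · exact D.measurable_sigma M (hS (.move i) rfl) (D.measurable_innovation_sigma M i)
  · exact @measurable_pi_lambda _ _ _ (⨆ q ∈ S, D.sigma M q) _ _ fun c =>
      D.measurable_sigma M (hS (.bridge i c) rfl) (D.measurable_bridge_sigma M i c)
  · exact @measurable_pi_lambda _ _ _ (⨆ q ∈ S, D.sigma M q) _ _ fun p =>
      D.measurable_sigma M (hS (.time i p.1 p.2) rfl) (D.measurable_time_sigma M i p.1 p.2)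

variable {D M} [DecidableEq ι] [MeasurableSpace Ω] {P : Measure Ω}
  {R : ∀ c, LayerScheme s t (M.phi c)}

namespace IsStep

lemma measurable_prev_comp (h : D.IsStep M R P) (i : Fin N) (c : ι) :
    Measurable fun ω => D.prev i ω c := (measurable_pi_apply c).comp (h.measurable_prev i)

lemma measurable_next_comp (h : D.IsStep M R P) (i : Fin N) (c : ι) :
    Measurable fun ω => D.next i ω c := (measurable_pi_apply c).comp (h.measurable_next i)

lemma measurable_innovation (h : D.IsStep M R P) (i : Fin N) :
    Measurable (D.innovation M i) := by
  have h1 := (M.continuous_transMean s t).measurable.comp (h.measurable_prev i)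
  have h2 := h.measurable_next i
  refine (WithLp.measurable_toLp 2 _).comp (measurable_pi_lambda _ fun p => ?_)
  have e1 : Measurable fun ω => D.next i ω p.1 := (measurable_pi_apply p.1).comp h2
  have e2 : Measurable fun ω => M.transMean s t (D.prev i ω) p.1 := (measurable_pi_apply p.1).comp h1
  fun_prop

lemma measurable_fluctuation (h : D.IsStep M R P) (i : Fin N) (c : ι) (u : Set.Icc s t) :
    Measurable (D.fluctuation i c u) := by
  have h1 := h.measurable_prev_comp i c
  have h2 := h.measurable_next_comp i c
  have h3 := h.measurable_path i c u
  unfold fluctuation interpolate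
  fun_prop

lemma sigma_le (h : D.IsStep M R P) (q : Source ι N) :
    D.sigma M q ≤ (inferInstance : MeasurableSpace Ω) := by
  cases q with
  | start => exact measurable_iff_comap_le.1 (measurable_pi_lambda _ h.measurable_prev)
  | move i => exact measurable_iff_comap_le.1 (h.measurable_innovation i)
  | bridge i c => exact iSup_le fun u => measurable_iff_comap_le.1 (h.measurable_fluctuation i c u)
  | time i c r => exact measurable_iff_comap_le.1 (h.measurable_ξ i c r)

lemma iSup_sigma_le (h : D.IsStep M R P) (S : Set (Source ι N)) :
    ⨆ q ∈ S, D.sigma M q ≤ (inferInstance : MeasurableSpace Ω) :=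
  iSup₂_le fun q _ => h.sigma_le q

lemma measurable_noise (h : D.IsStep M R P) (i : Fin N) : Measurable (D.noise M i) :=
  (D.measurable_noise_sigma M (S := Set.univ) fun _ _ => trivial).mono (h.iSup_sigma_le _) le_rfl

lemma measurable_bridge (h : D.IsStep M R P) (i : Fin N) (c : ι) : Measurable (D.bridge i c) :=
  (D.measurable_bridge_sigma M i c).mono (h.sigma_le _) le_rfl

lemma indepFun (h : D.IsStep M R P) {S S' : Set (Source ι N)} (hS : Disjoint S S')
    {β γ : Type*} {mβ : MeasurableSpace β} {mγ : MeasurableSpace γ} {f : Ω → β} {g : Ω → γ}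
    (hf : Measurable[⨆ q ∈ S, D.sigma M q] f) (hg : Measurable[⨆ q ∈ S', D.sigma M q] g) :
    IndepFun f g P := by
  rw [IndepFun_iff_Indep]
  exact indep_of_indep_of_le (indep_iSup_of_disjoint h.sigma_le h.indep hS)
    (measurable_iff_comap_le.1 hf) (measurable_iff_comap_le.1 hg)

/-- Innovation, bridges and times use disjoint families of sources (`i1`, `i2`), and within the last
two families the sources are independent (`i3`, `i4`). So the joint law is a product. -/
lemma map_noise [IsProbabilityMeasure P] (h : D.IsStep M R P) (i : Fin N) :
    P.map (D.noise M i) = noiseLaw M fun c => P.map (D.bridge i c) := by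
  set S₁ : Set (Source ι N) := {.move i}
  set S₂ : Set (Source ι N) := Set.range (Source.bridge i)
  set S₃ : Set (Source ι N) := Set.range fun p : ι × ℕ => Source.time i p.1 p.2
  have m1 : ∀ {S : Set (Source ι N)}, S₁ ⊆ S →
      Measurable[⨆ q ∈ S, D.sigma M q] (D.innovation M i) := fun hS =>
    D.measurable_sigma M (hS rfl) (D.measurable_innovation_sigma M i)
  have m2 : ∀ {S : Set (Source ι N)}, S₂ ⊆ S →
      Measurable[⨆ q ∈ S, D.sigma M q] (fun ω c => D.bridge i c ω) := fun {S} hS =>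
    @measurable_pi_lambda _ _ _ (⨆ q ∈ S, D.sigma M q) _ _ fun c =>
      D.measurable_sigma M (hS ⟨c, rfl⟩) (D.measurable_bridge_sigma M i c)
  have m3 : ∀ {S : Set (Source ι N)}, S₃ ⊆ S →
      Measurable[⨆ q ∈ S, D.sigma M q] (fun ω (p : ι × ℕ) => D.ξ i p.1 p.2 ω) := fun {S} hS =>
    @measurable_pi_lambda _ _ _ (⨆ q ∈ S, D.sigma M q) _ _ fun p =>
      D.measurable_sigma M (hS ⟨p, rfl⟩) (D.measurable_time_sigma M i p.1 p.2)
  have i1 : IndepFun (D.innovation M i)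
      (fun ω => ((fun c => D.bridge i c ω), fun p : ι × ℕ => D.ξ i p.1 p.2 ω)) P := by
    refine h.indepFun (S := S₁) (S' := S₂ ∪ S₃) ?_ (m1 subset_rfl)
      (Measurable.prodMk (m2 Set.subset_union_left) (m3 Set.subset_union_right))
    rw [Set.disjoint_left]
    rintro q rfl (⟨c, hc⟩ | ⟨c, hc⟩) <;> simp at hc
  have i2 : IndepFun (fun ω c => D.bridge i c ω) (fun ω (p : ι × ℕ) => D.ξ i p.1 p.2 ω) P := by
    refine h.indepFun (S := S₂) (S' := S₃) ?_ (m2 subset_rfl) (m3 subset_rfl)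
    rw [Set.disjoint_left]
    rintro q ⟨c, rfl⟩ ⟨c', hc⟩
    simp at hc
  have i3 : iIndepFun (fun c => D.bridge i c) P := by
    rw [iIndepFun_iff_iIndep]
    refine iIndep_of_iIndep_of_le (h.indep.precomp (g := fun c => Source.bridge i c) ?_)
      fun c => measurable_iff_comap_le.1 (D.measurable_bridge_sigma M i c)
    intro c c' hc
    simpa using hc
  have i4 : iIndepFun (fun (p : ι × ℕ) => D.ξ i p.1 p.2) P := by
    rw [iIndepFun_iff_iIndep]
    refine iIndep_of_iIndep_of_le (h.indep.precomp (g := fun p : ι × ℕ => Source.time i p.1 p.2) ?_)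
      fun p => measurable_iff_comap_le.1 (D.measurable_time_sigma M i p.1 p.2)
    intro c c' hc
    simp only [Source.time.injEq, true_and] at hc
    exact Prod.ext hc.1 hc.2
  have n1 := h.measurable_innovation i
  have n2 : Measurable (fun ω c => D.bridge i c ω) := measurable_pi_lambda _ (h.measurable_bridge i)
  have n3 : Measurable (fun ω (p : ι × ℕ) => D.ξ i p.1 p.2 ω) :=
    measurable_pi_lambda _ fun p => h.measurable_ξ i p.1 p.2
  have e1 := (indepFun_iff_map_prod_eq_prod_map_map n1.aemeasurable
    (n2.prodMk n3).aemeasurable).1 i1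
  have e2 := (indepFun_iff_map_prod_eq_prod_map_map n2.aemeasurable n3.aemeasurable).1 i2
  have e3 := i3.map_fun_eq_pi_map fun c => (h.measurable_bridge i c).aemeasurable
  have e4 := i4.map_fun_eq_infinitePi_map fun p : ι × ℕ => h.measurable_ξ i p.1 p.2
  -- `pdf.IsUniform` unfolds to an equation between the law and the conditioned measure that defines
  -- `uniformTime`.
  have e5 : ∀ p : ι × ℕ, P.map (D.ξ i p.1 p.2) = uniformTime s t := fun p => h.time_law i p.1 p.2
  simp only [e5] at e4
  unfold noise noiseLaw
  rw [e1, e2, e3, e4, (h.move_law i).map_eq]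

lemma map_prev_noise [IsProbabilityMeasure P] (h : D.IsStep M R P) (i : Fin N) :
    P.map (fun ω => (D.prev i ω, D.noise M i ω)) =
      (P.map (D.prev i)).prod (P.map (D.noise M i)) := by
  refine (indepFun_iff_map_prod_eq_prod_map_map (h.measurable_prev i).aemeasurable
    (h.measurable_noise i).aemeasurable).1 ?_
  refine h.indepFun (S := {q | q.owner = none}) (S' := {q | q.owner = some i}) ?_
    (D.measurable_sigma M (S := {q | q.owner = none}) (q := .start) rfl (D.measurable_prev_sigma M i))
    (D.measurable_noise_sigma M fun _ hq => hq)
  rw [Set.disjoint_left]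
  intro q hq hq'
  simp only [Set.mem_ofPred_eq] at hq hq'
  simp [hq] at hq'

/-- The old states of two particles may be dependent, so their joint law is kept whole; only the
noises split off. -/
lemma map_prev_noise_pair [IsProbabilityMeasure P] (h : D.IsStep M R P) {i j : Fin N}
    (hij : i ≠ j) :
    P.map (fun ω => ((D.prev i ω, D.prev j ω), (D.noise M i ω, D.noise M j ω))) =
      (P.map fun ω => (D.prev i ω, D.prev j ω)).prod
        ((P.map (D.noise M i)).prod (P.map (D.noise M j))) := by
  have h1 : IndepFun (fun ω => (D.prev i ω, D.prev j ω)) (fun ω => (D.noise M i ω, D.noise M j ω))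
      P := by
    refine h.indepFun (S := {q | q.owner = none}) (S' := {q | q.owner ≠ none}) ?_
      (Measurable.prodMk (D.measurable_sigma M (S := {q | q.owner = none}) (q := .start) rfl (D.measurable_prev_sigma M i))
        (D.measurable_sigma M (S := {q | q.owner = none}) (q := .start) rfl (D.measurable_prev_sigma M j)))
      (Measurable.prodMk (D.measurable_noise_sigma M fun q hq => by simp [hq])
        (D.measurable_noise_sigma M fun q hq => by simp [hq]))
    rw [Set.disjoint_left]
    intro q hq hq'
    exact hq' hq
  have h2 : IndepFun (D.noise M i) (D.noise M j) P := by
    refine h.indepFun (S := {q | q.owner = some i}) (S' := {q | q.owner = some j}) ?_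
      (D.measurable_noise_sigma M fun _ hq => hq) (D.measurable_noise_sigma M fun _ hq => hq)
    rw [Set.disjoint_left]
    intro q hq hq'
    simp only [Set.mem_ofPred_eq] at hq hq'
    rw [hq] at hq'
    exact hij (Option.some.inj hq')
  rw [(indepFun_iff_map_prod_eq_prod_map_map
    ((h.measurable_prev i).prodMk (h.measurable_prev j)).aemeasurable
    ((h.measurable_noise i).prodMk (h.measurable_noise j)).aemeasurable).1 h1,
    (indepFun_iff_map_prod_eq_prod_map_map (h.measurable_noise i).aemeasurable
    (h.measurable_noise j).aemeasurable).1 h2]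

end IsStep

end StepData

end Noise


/-! ### Weight and Poisson numbers as functions of old state and noise -/

section Products

lemma lintegral_pi_prod {ι : Type*} [Fintype ι] {α : ι → Type*} [∀ i, MeasurableSpace (α i)]
    (μ : ∀ i, Measure (α i)) [∀ i, IsProbabilityMeasure (μ i)] {f : ∀ i, α i → ℝ≥0∞}
    (hf : ∀ i, Measurable (f i)) :
    ∫⁻ x, ∏ i, f i (x i) ∂Measure.pi μ = ∏ i, ∫⁻ y, f i y ∂μ i := by
  rw [lintegral_prod_eq_prod_lintegral_of_indepFun Finset.univ (fun i (x : ∀ i, α i) => f i (x i))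
    (iIndepFun_pi fun i => (hf i).aemeasurable) fun i => (hf i).comp (measurable_pi_apply i)]
  exact Finset.prod_congr rfl fun i _ => (measurePreserving_eval μ i).lintegral_comp (hf i)

end Products

section Weight

variable {ι : Type*} [Fintype ι] {d : ℕ} (M : GaussianModel ι d) {s t : ℝ}

/-- The path of a particle for the index `c`, as a function of its old state and its noise. -/
def pathOf (p : Config ι d × Noise ι d s t) (c : ι) : Path d s t :=
  p.2.2.1 c + segmentPath (p.1 c)
    (WithLp.toLp 2 fun i => M.transMean s t p.1 c i + p.2.1 (c, i))

variable (R : ∀ c, LayerScheme s t (M.phi c))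

/-- The upper bound of `φ_c` on the layer of the path. -/
def upperOf (p : Config ι d × Noise ι d s t) (c : ι) : ℝ :=
  (R c).upper ((R c).region (pathOf M p c))

/-- The optimal intensity as a function of the old state and the noise. -/
def intensityOf (p : Config ι d × Noise ι d s t) (c : ι) : ℝ≥0 :=
  optimalIntensity (M.phi c) (upperOf M R p c) (pathOf M p c)

/-- The weight as a function of the old state, the noise and the numbers `κ`. -/
def weight (q : Config ι d × (Noise ι d s t × (ι → ℕ))) : ℝ :=
  ∏ c, estimatorFactor (M.phi c) (upperOf M R (q.1, q.2.1) c)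
    (fun k => (poissonMeasure (intensityOf M R (q.1, q.2.1) c)).real {k})
    (pathOf M (q.1, q.2.1) c) (q.2.2 c) (fun r => q.2.1.2.2 (c, r))

lemma measurable_pathOf (c : ι) :
    Measurable fun p : Config ι d × Noise ι d s t => pathOf M p c := by
  refine measurable_to_path fun u => ?_
  have h1 : Measurable fun p : Config ι d × Noise ι d s t => p.2.2.1 c u :=
    (measurable_path_eval u).comp (by fun_prop)
  have h2 : Measurable fun p : Config ι d × Noise ι d s t => M.transMean s t p.1 c :=
    (measurable_pi_apply c).comp ((M.continuous_transMean s t).measurable.comp measurable_fst)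
  have h3 : Measurable fun p : Config ι d × Noise ι d s t =>
      (WithLp.toLp 2 fun i => M.transMean s t p.1 c i + p.2.1 (c, i) : Pt d) := by fun_prop
  have h4 : Measurable fun p : Config ι d × Noise ι d s t => p.1 c := by fun_prop
  change Measurable fun p : Config ι d × Noise ι d s t => p.2.2.1 c u +
    interpolate (p.1 c) (WithLp.toLp 2 fun i => M.transMean s t p.1 c i + p.2.1 (c, i)) u
  unfold interpolate
  fun_prop

lemma measurable_upperOf (c : ι) : Measurable fun p => upperOf M R p c :=
  (R c).measurable_upper.comp (measurable_pathOf M c)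

lemma measurable_pathOf_uncurry (c : ι) :
    Measurable fun q : (Config ι d × Noise ι d s t) × Set.Icc s t => pathOf M q.1 c q.2 :=
  measurable_path_eval_uncurry.comp
    (((measurable_pathOf M c).comp measurable_fst).prodMk measurable_snd)

lemma measurable_phi_pathOf [Nonempty ι] (c : ι) :
    Measurable fun q : (Config ι d × Noise ι d s t) × Set.Icc s t =>
      M.phi c (pathOf M q.1 c q.2) :=
  (M.continuous_phi c).measurable.comp (measurable_pathOf_uncurry M c)

lemma measurable_intensityOf [Nonempty ι] (c : ι) : Measurable fun p => intensityOf M R p c := by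
  have h1 := measurable_phi_pathOf M (s := s) (t := t) c
  have h2 : Measurable fun q : (Config ι d × Noise ι d s t) × Set.Icc s t =>
      upperOf M R q.1 c := (measurable_upperOf M R c).comp measurable_fst
  have h3 : Measurable fun q : (Config ι d × Noise ι d s t) × Set.Icc s t =>
      (upperOf M R q.1 c - M.phi c (pathOf M q.1 c q.2)) ^ 2 := (h2.sub h1).pow_const 2
  have h4 := (h3.stronglyMeasurable.integral_prod_right' (ν := timeMeasure s t)).measurable
  exact (((h4.const_mul (t - s)).sqrt)).real_toNNReal

lemma measurable_poisson_real (k : ℕ) : Measurable fun r : ℝ≥0 => (poissonMeasure r).real {k} := by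
  simp only [poissonMeasure_real_singleton]
  fun_prop

lemma measurable_poisson (k : ℕ) : Measurable fun r : ℝ≥0 => poissonMeasure r {k} := by
  simp only [poissonMeasure_singleton]
  fun_prop

lemma measurable_weight [Nonempty ι] : Measurable (weight M R) := by
  have h : Measurable fun q : (Config ι d × Noise ι d s t) × (ι → ℕ) =>
      weight M R (q.1.1, (q.1.2, q.2)) := by
    -- The number of factors in the weight depends on `κ`. As `κ` takes countably many values, it
    -- may be fixed.
    refine measurable_from_prod_countable_left fun k => ?_
    unfold weight estimatorFactor
    refine Finset.measurable_fun_prod _ fun c _ => ?_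
    have h1 := measurable_upperOf M R c
    have h2 := (measurable_poisson_real (k c)).comp (measurable_intensityOf M R c)
    have h3 : ∀ r, Measurable fun p : Config ι d × Noise ι d s t =>
        M.phi c (pathOf M p c (p.2.2.2 (c, r))) := fun r =>
      (measurable_phi_pathOf M c).comp (f := fun p : Config ι d × Noise ι d s t =>
        (p, p.2.2.2 (c, r))) (by fun_prop)
    have h4 : Measurable fun p : Config ι d × Noise ι d s t =>
        ∏ r ∈ Finset.range (k c), (upperOf M R p c - M.phi c (pathOf M p c (p.2.2.2 (c, r)))) :=
      Finset.measurable_fun_prod _ fun r _ => h1.sub (h3 r)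
    have h5 : Measurable fun p : Config ι d × Noise ι d s t =>
        (t - s) ^ k c * Real.exp (-(upperOf M R p c * (t - s))) /
          ((k c).factorial * (poissonMeasure (intensityOf M R p c)).real {k c}) :=
      (measurable_const.mul (h1.mul_const (t - s)).neg.exp).div
        (h2.const_mul ((k c).factorial : ℝ))
    exact h5.mul h4
  exact h.comp (f := fun q : Config ι d × (Noise ι d s t × (ι → ℕ)) => ((q.1, q.2.1), q.2.2))
    (by fun_prop)

/-- The conditional law of the numbers `κ_c`. -/
def poissonKernel [Nonempty ι] : Kernel (Config ι d × Noise ι d s t) (ι → ℕ) where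
  toFun p := Measure.pi fun c => poissonMeasure (intensityOf M R p c)
  measurable' := by
    refine Measure.measurable_of_measurable_coe _ fun A _ => ?_
    -- The space `ι → ℕ` is countable, so the mass of `A` is a sum of point masses, each a product
    -- of measurable Poisson probabilities.
    have e : ∀ p : Config ι d × Noise ι d s t,
        (Measure.pi fun c => poissonMeasure (intensityOf M R p c)) A =
        ∑' k, A.indicator (fun k : ι → ℕ => ∏ c, poissonMeasure (intensityOf M R p c) {k c}) k := by
      intro p
      rw [← Measure.tsum_indicator_apply_singleton _ A (MeasurableSet.of_discrete)]
      refine tsum_congr fun k => ?_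
      congr 1
      funext k
      rw [Measure.pi_singleton]
    simp only [e]
    refine Measurable.tsum fun k => ?_
    by_cases hk : k ∈ A
    · simp only [Set.indicator_of_mem hk]
      exact Finset.measurable_prod _ fun c _ =>
        (measurable_poisson (k c)).comp (measurable_intensityOf M R c)
    · simp only [Set.indicator_of_notMem hk]
      exact measurable_const

lemma poissonKernel_apply [Nonempty ι] (p : Config ι d × Noise ι d s t) :
    poissonKernel M R p = Measure.pi fun c => poissonMeasure (intensityOf M R p c) := rfl

instance [Nonempty ι] : IsMarkovKernel (poissonKernel M R) :=
  ⟨fun p => by rw [poissonKernel_apply]; infer_instance⟩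

/-- The conditional law of the noise and the numbers `κ_c`, if the noise has the law `Q`. -/
def particleKernel [Nonempty ι] (Q : Measure (Noise ι d s t)) :
    Kernel (Config ι d) (Noise ι d s t × (ι → ℕ)) :=
  Kernel.const _ Q ⊗ₖ poissonKernel M R

instance [Nonempty ι] (Q : Measure (Noise ι d s t)) [IsProbabilityMeasure Q] :
    IsMarkovKernel (particleKernel M R Q) := by
  unfold particleKernel; infer_instance

lemma lintegral_particleKernel [Nonempty ι] (Q : Measure (Noise ι d s t)) [IsProbabilityMeasure Q]
    {f : Noise ι d s t × (ι → ℕ) → ℝ≥0∞} (hf : Measurable f) (x : Config ι d) :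
    ∫⁻ z, f z ∂particleKernel M R Q x = ∫⁻ y, ∫⁻ k, f (y, k) ∂poissonKernel M R (x, y) ∂Q := by
  rw [particleKernel, Kernel.lintegral_compProd _ _ _ hf, Kernel.const_apply]

end Weight

/-! ### The particles form a conditional sample given the old states -/

namespace StepData

variable {ι : Type*} [Fintype ι] {d : ℕ} {M : GaussianModel ι d}
  {s t : ℝ} {Ω : Type*} {N : ℕ} {D : StepData ι d s t Ω N}

/-- Adding the conditional mean to the innovation recovers the new state, and adding the segment to
the bridge recovers the path. The weight therefore depends only on old state, noise and `κ`. -/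
lemma path_eq_pathOf (i : Fin N) (c : ι) (ω : Ω) :
    D.path i c ω = pathOf M (D.prev i ω, D.noise M i ω) c := by
  have : (WithLp.toLp 2 fun k => M.transMean s t (D.prev i ω) c k +
      D.innovation M i ω (c, k)) = D.next i ω c := by
    ext k
    simp [innovation]
  simp only [pathOf, noise, bridge, this, sub_add_cancel]

variable (D M) in
/-- The noise of one particle together with its numbers `κ_c`. -/
def particle (i : Fin N) (ω : Ω) : Noise ι d s t × (ι → ℕ) :=
  (D.noise M i ω, fun c => D.κ i c ω)

variable {R : ∀ c, LayerScheme s t (M.phi c)}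

lemma intensity_eq_intensityOf (i : Fin N) (c : ι) (ω : Ω) :
    D.intensity M R i c ω = intensityOf M R (D.prev i ω, D.noise M i ω) c := by
  simp only [intensity, U, intensityOf, upperOf, path_eq_pathOf (M := M)]

lemma rho_eq_weight (i : Fin N) (ω : Ω) :
    D.rho M R i ω = weight M R (D.prev i ω, D.particle M i ω) := by
  simp only [rho, intensity_eq_intensityOf, U, weight, upperOf, particle, path_eq_pathOf (M := M)]
  rfl

variable [DecidableEq ι] [MeasurableSpace Ω] {P : Measure Ω} [IsProbabilityMeasure P]

namespace IsStep

omit [IsProbabilityMeasure P] in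
lemma iSup_sigma_le' (h : D.IsStep M R P) :
    ⨆ q, D.sigma M q ≤ (inferInstance : MeasurableSpace Ω) := iSup_le h.sigma_le

omit [DecidableEq ι] [MeasurableSpace Ω] in
lemma measurable_state_iSup (D : StepData ι d s t Ω N) (i : Fin N) :
    Measurable[⨆ q, D.sigma M q] fun ω => (D.prev i ω, D.noise M i ω) := by
  have h1 := (D.measurable_sigma M (S := Set.univ) (q := .start) trivial
    (D.measurable_prev_sigma M i)).prodMk
    (D.measurable_noise_sigma M (S := Set.univ) (i := i) fun _ _ => trivial)
  rwa [iSup_univ] at h1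

omit [IsProbabilityMeasure P] in
lemma measurableSet_κ (h : D.IsStep M R P) (k : Fin N → ι → ℕ) :
    MeasurableSet {ω | ∀ i c, D.κ i c ω = k i c} := by
  simp only [Set.ofPred_forall]
  exact MeasurableSet.iInter fun i => MeasurableSet.iInter fun c =>
    h.measurable_κ i c (measurableSet_singleton _)

/-- By `κ_law`, restricting `P` to the event and giving `P` the density `q` produce measures that
agree on the σ-algebra of the sources. Trimming both to it carries the identity over to every
integrand measurable there. -/
lemma setLIntegral_κ [Nonempty ι] (h : D.IsStep M R P) (k : Fin N → ι → ℕ) {W : Ω → ℝ≥0∞}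
    (hW : Measurable[⨆ q, D.sigma M q] W) :
    ∫⁻ ω in {ω | ∀ i c, D.κ i c ω = k i c}, W ω ∂P =
      ∫⁻ ω, W ω * ∏ i, poissonKernel M R (D.prev i ω, D.noise M i ω) {k i} ∂P := by
  have hm := h.iSup_sigma_le'
  set A := {ω | ∀ i c, D.κ i c ω = k i c} with hA
  have mA : MeasurableSet A := h.measurableSet_κ k
  set q : Ω → ℝ≥0∞ := fun ω => ∏ i, poissonKernel M R (D.prev i ω, D.noise M i ω) {k i} with hq
  have hst : ∀ i, Measurable fun ω => (D.prev i ω, D.noise M i ω) := fun i =>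
    (h.measurable_prev i).prodMk (h.measurable_noise i)
  have mq : Measurable q := Finset.measurable_prod _ fun i _ =>
    ((poissonKernel M R).measurable_coe (measurableSet_singleton _)).comp (hst i)
  have q1 : ∀ ω, q ω ≤ 1 := fun ω => Finset.prod_le_one' fun i _ => prob_le_one
  have hreal : ∀ ω, (q ω).toReal =
      ∏ i, ∏ c, (poissonMeasure (D.intensity M R i c ω)).real {k i c} := by
    intro ω
    simp only [hq, poissonKernel_apply, Measure.pi_singleton, ENNReal.toReal_prod,
      intensity_eq_intensityOf]
    rfl
  have htrim : (P.restrict A).trim hm = (P.withDensity q).trim hm := by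
    refine @Measure.ext _ (⨆ q, D.sigma M q) _ _ fun B hB => ?_
    have hB' : MeasurableSet B := hm B hB
    rw [trim_measurableSet_eq hm hB, trim_measurableSet_eq hm hB, Measure.restrict_apply hB',
      withDensity_apply _ hB']
    -- The defining property of the conditional expectation in `κ_law`, for sets `B` of the source
    -- σ-algebra.
    have e1 : ∫ ω in B, (q ω).toReal ∂P = P.real (B ∩ A) := by
      have h1 := setIntegral_condExp (μ := P) hm (f := A.indicator fun _ => (1 : ℝ))
        ((integrable_const _).indicator mA) hB
      have h2 := setIntegral_congr_ae (μ := P) hB' (h.κ_law k |>.mono fun ω hω _ => hω)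
      rw [h2, integral_indicator mA] at h1
      simp only [hreal]
      rw [h1, Measure.restrict_restrict mA, Set.inter_comm]
      simp [Measure.real]
    have hfin : ∫⁻ ω in B, q ω ∂P ≠ ⊤ := by
      refine ((lintegral_mono (g := fun _ => 1) q1).trans_lt ?_).ne
      simp
    rw [integral_toReal mq.aemeasurable (ae_of_all _ fun ω => (q1 ω).trans_lt ENNReal.one_lt_top)]
      at e1
    exact ((ENNReal.toReal_eq_toReal_iff' hfin (measure_ne_top _ _)).1 e1).symm
  calc ∫⁻ ω in A, W ω ∂P = ∫⁻ ω, W ω ∂((P.restrict A).trim hm) := (lintegral_trim hm hW).symm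
    _ = ∫⁻ ω, W ω ∂(P.withDensity q) := by rw [htrim, lintegral_trim hm hW]
    _ = ∫⁻ ω, W ω * q ω ∂P := by
        rw [lintegral_withDensity_eq_lintegral_mul _ mq (hW.mono hm le_rfl)]
        simp only [Pi.mul_apply, mul_comm]

/-- Split by the countably many joint values of `κ`, apply `setLIntegral_κ` to each, and resum as an
integral over a product of Poisson laws. All particles are treated at once because `κ_law` gives the
joint law of all numbers. -/
lemma lintegral_prod_particle [Nonempty ι] (h : D.IsStep M R P)
    {F : Fin N → (Config ι d × Noise ι d s t) × (ι → ℕ) → ℝ≥0∞} (hF : ∀ i, Measurable (F i)) :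
    ∫⁻ ω, ∏ i, F i ((D.prev i ω, D.noise M i ω), fun c => D.κ i c ω) ∂P =
      ∫⁻ ω, ∏ i, ∫⁻ k, F i ((D.prev i ω, D.noise M i ω), k)
        ∂poissonKernel M R (D.prev i ω, D.noise M i ω) ∂P := by
  have hst := fun i => measurable_state_iSup (M := M) D i
  have hm := h.iSup_sigma_le'
  have mW : ∀ k : Fin N → ι → ℕ,
      Measurable[⨆ q, D.sigma M q] fun ω => ∏ i, F i ((D.prev i ω, D.noise M i ω), k i) := by
    intro k
    exact Finset.measurable_prod _ fun i _ => ((hF i).comp measurable_prodMk_right).comp (hst i)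
  have e1 : ∀ ω, ∏ i, F i ((D.prev i ω, D.noise M i ω), fun c => D.κ i c ω) =
      ∑' k : Fin N → ι → ℕ, {ω | ∀ i c, D.κ i c ω = k i c}.indicator
        (fun ω => ∏ i, F i ((D.prev i ω, D.noise M i ω), k i)) ω := by
    intro ω
    rw [tsum_eq_single fun i c => D.κ i c ω]
    · rw [Set.indicator_of_mem (by simp)]
    · intro k hk
      rw [Set.indicator_of_notMem]
      intro hω
      exact hk (funext fun i => funext fun c => (hω i c).symm)
  simp only [e1]
  rw [lintegral_tsum fun k => ((mW k).mono hm le_rfl |>.indicator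
    (h.measurableSet_κ k)).aemeasurable]
  simp only [lintegral_indicator (h.measurableSet_κ _), h.setLIntegral_κ _ (mW _)]
  rw [← lintegral_tsum fun k => ?_]
  · refine lintegral_congr fun ω => ?_
    rw [← lintegral_pi_prod (fun i => poissonKernel M R (D.prev i ω, D.noise M i ω))
      (f := fun i k => F i ((D.prev i ω, D.noise M i ω), k))
      fun i => (hF i).comp measurable_prodMk_left, lintegral_countable']
    simp only [Measure.pi_singleton]
  · refine Measurable.aemeasurable (((mW k).mono hm le_rfl).mul ?_)
    exact Finset.measurable_prod _ fun i _ =>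
      ((poissonKernel M R).measurable_coe (measurableSet_singleton _)).comp
        ((hst i).mono hm le_rfl)

/-- Given the old states, the particles are pairwise independent, and the conditional law of a
particle depends only on its own old state. -/
theorem isConditionalSample [Nonempty ι] (h : D.IsStep M R P) {Q : Measure (Noise ι d s t)}
    [IsProbabilityMeasure Q] (hQ : ∀ i, P.map (D.noise M i) = Q) :
    IsConditionalSample (particleKernel M R Q) D.prev (D.particle M) P where
  measurable_left := h.measurable_prev
  measurable_right i := (h.measurable_noise i).prodMk (measurable_pi_lambda _ (h.measurable_κ i))
  lintegral_eq i F hF := by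
    -- The factor `1` for every other particle removes it from the product.
    have e := h.lintegral_prod_particle (F := fun j q =>
      if j = i then F (q.1.1, (q.1.2, q.2)) else 1) fun j => by
        by_cases hj : j = i
        · simp only [hj, if_true]; fun_prop
        · simp only [hj, if_false]; fun_prop
    rw [lintegral_congr fun ω => Finset.prod_eq_single i (fun j _ hj => by simp [hj]) (by simp)] at e
    rw [lintegral_congr (f := fun ω => ∏ j, ∫⁻ _, _ ∂_) fun ω =>
      Finset.prod_eq_single i (fun j _ hj => by simp [hj]) (by simp)] at e
    simp only [if_true] at e
    have mF : Measurable fun q : (Config ι d × Noise ι d s t) × (ι → ℕ) =>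
      F (q.1.1, (q.1.2, q.2)) := by fun_prop
    have m1 := mF.lintegral_kernel_prod_right' (κ := poissonKernel M R)
    have e2 := lintegral_map (μ := P) m1 ((h.measurable_prev i).prodMk (h.measurable_noise i))
    change ∫⁻ ω, F (D.prev i ω, (D.noise M i ω, fun c => D.κ i c ω)) ∂P = _
    rw [e, ← e2, h.map_prev_noise i, hQ, lintegral_prod _ m1.aemeasurable,
      lintegral_map m1.lintegral_prod_right' (h.measurable_prev i)]
    refine lintegral_congr fun ω => ?_
    rw [lintegral_particleKernel M R Q (by fun_prop)]
  lintegral_mul_eq i j hij F F' hF hF' := by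
    have e := h.lintegral_prod_particle (F := fun l q =>
      if l = i then F (q.1.1, (q.1.2, q.2)) else if l = j then F' (q.1.1, (q.1.2, q.2)) else 1)
      fun l => by
        by_cases hl : l = i
        · simp only [hl, if_true]; fun_prop
        · by_cases hl' : l = j
          · simp only [hl', if_true, hij.symm, if_false]; fun_prop
          · simp only [hl, hl', if_false]; fun_prop
    rw [lintegral_congr fun ω => Finset.prod_eq_mul i j hij
      (fun l _ hl => by simp [hl.1, hl.2]) (by simp) (by simp)] at e
    rw [lintegral_congr (f := fun ω => ∏ j, ∫⁻ _, _ ∂_) fun ω =>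
      Finset.prod_eq_mul i j hij (fun l _ hl => by simp [hl.1, hl.2]) (by simp) (by simp)] at e
    simp only [if_true, hij.symm, if_false] at e
    have mF : Measurable fun q : (Config ι d × Noise ι d s t) × (ι → ℕ) =>
      F (q.1.1, (q.1.2, q.2)) := by fun_prop
    have mF' : Measurable fun q : (Config ι d × Noise ι d s t) × (ι → ℕ) =>
      F' (q.1.1, (q.1.2, q.2)) := by fun_prop
    have m1 := mF.lintegral_kernel_prod_right' (κ := poissonKernel M R)
    have m1' := mF'.lintegral_kernel_prod_right' (κ := poissonKernel M R)
    set f : Config ι d × Noise ι d s t → ℝ≥0∞ := fun p =>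
      ∫⁻ k, F (p.1, (p.2, k)) ∂poissonKernel M R p with hf
    set f' : Config ι d × Noise ι d s t → ℝ≥0∞ := fun p =>
      ∫⁻ k, F' (p.1, (p.2, k)) ∂poissonKernel M R p with hf'
    change Measurable f at m1
    change Measurable f' at m1'
    have m2 : Measurable fun r : (Config ι d × Config ι d) × (Noise ι d s t × Noise ι d s t) =>
        f (r.1.1, r.2.1) * f' (r.1.2, r.2.2) := by fun_prop
    have e2 := lintegral_map (μ := P) m2
      (((h.measurable_prev i).prodMk (h.measurable_prev j)).prodMk
        ((h.measurable_noise i).prodMk (h.measurable_noise j)))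
    change ∫⁻ ω, F (D.prev i ω, (D.noise M i ω, fun c => D.κ i c ω)) *
      F' (D.prev j ω, (D.noise M j ω, fun c => D.κ j c ω)) ∂P = _
    rw [e]
    change ∫⁻ ω, f (D.prev i ω, D.noise M i ω) * f' (D.prev j ω, D.noise M j ω) ∂P = _
    rw [← e2, h.map_prev_noise_pair hij, hQ, hQ, lintegral_prod _ m2.aemeasurable,
      lintegral_map m2.lintegral_prod_right' ((h.measurable_prev i).prodMk (h.measurable_prev j))]
    refine lintegral_congr fun ω => ?_
    simp only
    rw [lintegral_particleKernel M R Q (by fun_prop), lintegral_particleKernel M R Q (by fun_prop)]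
    exact lintegral_prod_mul (m1.comp measurable_prodMk_left).aemeasurable
      (m1'.comp measurable_prodMk_left).aemeasurable

end IsStep

end StepData


/-! ### Moments of a Poisson estimator -/

section PoissonSums

lemma lintegral_poissonMeasure (r : ℝ≥0) (f : ℕ → ℝ≥0∞) :
    ∫⁻ k, f k ∂poissonMeasure r = ∑' k, f k * poissonMeasure r {k} := lintegral_countable' _

lemma poissonMeasure_zero_singleton (k : ℕ) : poissonMeasure 0 {k} = if k = 0 then 1 else 0 := by
  rw [poissonMeasure_singleton]
  rcases k with _ | k <;> simp

lemma tsum_ofReal_exp_series (b x : ℝ) (hx : 0 ≤ x) :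
    ∑' k : ℕ, ENNReal.ofReal (Real.exp b * (x ^ k / k.factorial)) =
      ENNReal.ofReal (Real.exp (b + x)) := by
  have h := (NormedSpace.expSeries_div_hasSum_exp (𝔸 := ℝ) x).mul_left (Real.exp b)
  rw [← ENNReal.ofReal_tsum_of_nonneg (fun k => by positivity) h.summable, h.tsum_eq,
    Real.exp_add, Real.exp_eq_exp_ℝ]

/-- The first moment of the estimator for a Poisson number of factors with mean `a`. -/
lemma lintegral_estimator (r : ℝ≥0) (D u a : ℝ) (hD : 0 ≤ D) (ha : 0 ≤ a) (h0 : r = 0 → a = 0) :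
    ∫⁻ k, ENNReal.ofReal (D ^ k * Real.exp (-(u * D)) /
      (k.factorial * (poissonMeasure r).real {k})) * ENNReal.ofReal a ^ k ∂poissonMeasure r =
      ENNReal.ofReal (Real.exp (-(u * D) + D * a)) := by
  rw [lintegral_poissonMeasure]
  rcases eq_or_ne r 0 with rfl | hr
  -- With intensity zero only the empty product is ever seen; `h0` ensures that nothing is lost in
  -- the mean.
  · rw [tsum_eq_single 0 fun k hk => by simp [poissonMeasure_zero_singleton, hk]]
    simp [poissonMeasure_zero_singleton, Measure.real, h0 rfl]
  -- The Poisson mass cancels the denominator of the estimator and leaves the exponential series in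
  -- `D * a`.
  · rw [← tsum_ofReal_exp_series _ _ (mul_nonneg hD ha)]
    refine tsum_congr fun k => ?_
    have hp : 0 < (poissonMeasure r).real {k} :=
      poissonMeasure_real_singleton_pos k (pos_iff_ne_zero.2 hr)
    have hk : (0 : ℝ) < k.factorial := by positivity
    rw [← ofReal_measureReal (μ := poissonMeasure r), ← ENNReal.ofReal_pow ha,
      ← ENNReal.ofReal_mul (by positivity), ← ENNReal.ofReal_mul (by positivity)]
    congr 1
    rw [mul_pow]
    field_simp

/-- The second moment of the estimator for a Poisson number of factors with mean square `a`, for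
the optimal intensity. -/
lemma lintegral_estimator_sq (r : ℝ≥0) (D u a : ℝ) (hD : 0 ≤ D) (ha : 0 ≤ a)
    (h0 : (r : ℝ) ^ 2 = D ^ 2 * a) :
    ∫⁻ k, ENNReal.ofReal (D ^ k * Real.exp (-(u * D)) /
      (k.factorial * (poissonMeasure r).real {k})) ^ 2 * ENNReal.ofReal a ^ k ∂poissonMeasure r =
      ENNReal.ofReal (Real.exp (2 * (r - u * D))) := by
  rw [lintegral_poissonMeasure]
  rcases eq_or_ne r 0 with rfl | hr
  · rw [tsum_eq_single 0 fun k hk => by simp [poissonMeasure_zero_singleton, hk]]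
    rw [← ENNReal.ofReal_pow (by positivity)]
    simp [poissonMeasure_zero_singleton, Measure.real, ← Real.exp_nat_mul]
  · rw [show (2 * (r - u * D) : ℝ) = (r + 2 * (-(u * D))) + r by ring,
      ← tsum_ofReal_exp_series _ _ r.coe_nonneg]
    refine tsum_congr fun k => ?_
    have hr' : (0 : ℝ) < r := NNReal.coe_pos.2 (pos_iff_ne_zero.2 hr)
    have hk : (0 : ℝ) < k.factorial := by positivity
    rw [← ofReal_measureReal (μ := poissonMeasure r), ← ENNReal.ofReal_pow ha,
      ← ENNReal.ofReal_pow (by positivity),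
      ← ENNReal.ofReal_mul (by positivity), ← ENNReal.ofReal_mul (by positivity)]
    congr 1
    rw [poissonMeasure_real_singleton]
    -- The optimal choice of `r` enters here: one power `r ^ k` cancels against the Poisson mass,
    -- the other remains for the exponential series in `r`.
    have e1 : (D ^ k) ^ 2 * a ^ k = (r : ℝ) ^ k * (r : ℝ) ^ k := by
      rw [← pow_mul, mul_comm k 2, pow_mul, ← mul_pow, ← h0, ← mul_pow, sq]
    have e2 : Real.exp (r + 2 * (-(u * D))) * Real.exp (-r) = Real.exp (-(u * D)) ^ 2 := by
      rw [← Real.exp_add, ← Real.exp_nat_mul]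
      congr 1
      push_cast
      ring
    have hE := Real.exp_pos (-(r : ℝ))
    generalize Real.exp (r + 2 * (-(u * D))) = A at e2 ⊢
    generalize Real.exp (-(u * D)) = B at e2 ⊢
    generalize Real.exp (-(r : ℝ)) = E at e2 hE ⊢
    field_simp
    linear_combination B ^ 2 * e1 - (r : ℝ) ^ k * (r : ℝ) ^ k * e2

end PoissonSums

/-! ### Integration over the inspection times -/

section Times

variable {ι T : Type*} [Fintype ι] [MeasurableSpace T] (ν : Measure T) [IsProbabilityMeasure ν]

lemma lintegral_infinitePi_prod (k : ι → ℕ) {f : ι → T → ℝ≥0∞} (hf : ∀ c, Measurable (f c)) :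
    ∫⁻ τ, ∏ c, ∏ r ∈ Finset.range (k c), f c (τ (c, r))
      ∂Measure.infinitePi (fun _ : ι × ℕ => ν) = ∏ c, (∫⁻ x, f c x ∂ν) ^ k c := by
  classical
  set S : Finset (ι × ℕ) :=
    ((Finset.univ : Finset ι) ×ˢ Finset.range (∑ c, k c)).filter fun p => p.2 < k p.1
  have hS : ∀ p, p ∈ S ↔ p.1 ∈ (Finset.univ : Finset ι) ∧ p.2 ∈ Finset.range (k p.1) := by
    intro p
    simp only [S, Finset.mem_filter, Finset.mem_product, Finset.mem_univ, true_and,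
      Finset.mem_range]
    refine ⟨fun h => h.2, fun h => ⟨h.trans_le ?_, h⟩⟩
    exact Finset.single_le_sum (f := k) (fun _ _ => Nat.zero_le _) (Finset.mem_univ p.1)
  have e : ∀ τ : ι × ℕ → T, ∏ c, ∏ r ∈ Finset.range (k c), f c (τ (c, r)) =
      ∏ p ∈ S, f p.1 (τ p) := fun τ =>
    (Finset.prod_finset_product S Finset.univ (fun c => Finset.range (k c)) hS
      (f := fun p => f p.1 (τ p))).symm
  simp only [e]
  rw [lintegral_prod_eq_prod_lintegral_of_indepFun S (fun p (τ : ι × ℕ → T) => f p.1 (τ p))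
    (iIndepFun_infinitePi fun p => hf p.1) fun p => (hf p.1).comp (measurable_pi_apply p)]
  have e2 : ∀ p : ι × ℕ, ∫⁻ τ, f p.1 (τ p) ∂Measure.infinitePi (fun _ : ι × ℕ => ν) =
      ∫⁻ x, f p.1 x ∂ν := fun p =>
    (measurePreserving_eval_infinitePi (fun _ : ι × ℕ => ν) p).lintegral_comp (hf p.1)
  simp only [e2]
  rw [Finset.prod_finset_product S Finset.univ (fun c => Finset.range (k c)) hS]
  simp

/-- Integration of a product of estimators over the times and the Poisson numbers. -/
lemma lintegral_times_poisson (r : ι → ℝ≥0) (C : ι → ℕ → ℝ≥0∞) {f : ι → T → ℝ≥0∞}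
    (hf : ∀ c, Measurable (f c)) :
    ∫⁻ τ, ∫⁻ k : ι → ℕ, ∏ c, (C c (k c) * ∏ j ∈ Finset.range (k c), f c (τ (c, j)))
      ∂Measure.pi (fun c => poissonMeasure (r c)) ∂Measure.infinitePi (fun _ : ι × ℕ => ν) =
    ∏ c, ∫⁻ k, C c k * (∫⁻ x, f c x ∂ν) ^ k ∂poissonMeasure (r c) := by
  have hm : ∀ k : ι → ℕ, Measurable fun τ : ι × ℕ → T =>
      ∏ c, ∏ j ∈ Finset.range (k c), f c (τ (c, j)) := fun k =>
    Finset.measurable_fun_prod _ fun c _ => Finset.measurable_fun_prod _ fun j _ =>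
      (hf c).comp (measurable_pi_apply _)
  -- The number of factors depends on `k`, so the times are integrated first, with `k` fixed.
  rw [lintegral_lintegral_swap]
  · rw [← lintegral_pi_prod (fun c => poissonMeasure (r c))
      (f := fun c k => C c k * (∫⁻ x, f c x ∂ν) ^ k) fun c => measurable_of_countable _]
    refine lintegral_congr fun k => ?_
    simp only [Finset.prod_mul_distrib]
    rw [lintegral_const_mul _ (hm k), lintegral_infinitePi_prod ν k hf]
  · refine Measurable.aemeasurable (measurable_from_prod_countable_left fun k => ?_)
    simp only [Function.uncurry, Finset.prod_mul_distrib]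
    exact (hm k).const_mul _

end Times

section UniformTime

variable {s t : ℝ}

lemma integral_uniformTime (hst : s < t) (f : Set.Icc s t → ℝ) :
    (t - s) * ∫ u, f u ∂uniformTime s t = ∫ u, f u ∂timeMeasure s t := by
  have : (0 : ℝ) < t - s := sub_pos.2 hst
  rw [uniformTime, ProbabilityTheory.cond, Measure.restrict_univ, integral_smul_measure,
    timeMeasure_univ, ENNReal.toReal_inv, ENNReal.toReal_ofReal this.le, smul_eq_mul,
    mul_inv_cancel_left₀ this.ne']

lemma Continuous.integrable_Icc {f : Set.Icc s t → ℝ} (hf : Continuous f)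
    (ν : Measure (Set.Icc s t)) [IsFiniteMeasure ν] : Integrable f ν := by
  obtain ⟨C, hC⟩ := isCompact_univ.exists_bound_of_continuousOn hf.continuousOn
  exact Integrable.of_bound hf.measurable.aestronglyMeasurable C
    (ae_of_all _ fun u => hC u (Set.mem_univ u))

end UniformTime

/-! ### First and second moments of the weight given the paths -/

section Moments

variable {ι : Type*} [Fintype ι] [DecidableEq ι] [Nonempty ι] {d : ℕ} (M : GaussianModel ι d)
  {s t : ℝ} (R : ∀ c, LayerScheme s t (M.phi c))

/-- The integral of `φ_c` along the path. -/
def phiInt (p : Config ι d × Noise ι d s t) (c : ι) : ℝ :=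
  ∫ u, M.phi c (pathOf M p c u) ∂timeMeasure s t

variable {M} in
omit [DecidableEq ι] in
lemma continuous_phi_pathOf (p : Config ι d × Noise ι d s t) (c : ι) :
    Continuous fun u => M.phi c (pathOf M p c u) :=
  (M.continuous_phi c).comp (pathOf M p c).continuous

omit [DecidableEq ι] in
lemma measurable_phiInt (c : ι) :
    Measurable fun p : Config ι d × Noise ι d s t => phiInt M p c :=
  ((measurable_phi_pathOf M c).stronglyMeasurable.integral_prod_right'
    (ν := timeMeasure s t)).measurable

variable {R} in
omit [DecidableEq ι] [Nonempty ι] in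
lemma phi_le_upperOf (p : Config ι d × Noise ι d s t) (c : ι) (u : Set.Icc s t) :
    M.phi c (pathOf M p c u) ≤ upperOf M R p c :=
  (R c).le_upper _ _ ((R c).mem_region _ u)

omit [DecidableEq ι] [Nonempty ι] in
-- With the time integral written as a uniform mean, this is the relation between intensity and mean
-- square that `lintegral_estimator_sq` requires.
lemma sq_intensityOf (hst : s < t) (p : Config ι d × Noise ι d s t) (c : ι) :
    (intensityOf M R p c : ℝ) ^ 2 = (t - s) ^ 2 *
      ∫ u, (upperOf M R p c - M.phi c (pathOf M p c u)) ^ 2 ∂uniformTime s t := by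
  rw [sq (t - s), mul_assoc, integral_uniformTime hst, intensityOf, optimalIntensity,
    Real.coe_toNNReal _ (Real.sqrt_nonneg _), Real.sq_sqrt]
  exact mul_nonneg (sub_pos.2 hst).le (integral_nonneg fun u => sq_nonneg _)

set_option synthInstance.maxHeartbeats 400000 in
omit [Nonempty ι] in
-- The times are the innermost coordinate. Once they are integrated out with innovation and bridges
-- fixed, the result may be read off at an arbitrary `τ'`.
lemma lintegral_noiseLaw_congr (hst : s < t) {β : ι → Measure (Path d s t)}
    [∀ c, IsProbabilityMeasure (β c)] {F G : Noise ι d s t → ℝ≥0∞} (hF : Measurable F)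
    (hG : Measurable G) (h : ∀ z w τ', ∫⁻ τ, F (z, w, τ)
      ∂Measure.infinitePi (fun _ : ι × ℕ => uniformTime s t) = G (z, w, τ')) :
    ∫⁻ y, F y ∂noiseLaw M β = ∫⁻ y, G y ∂noiseLaw M β := by
  have := isProbabilityMeasure_uniformTime hst
  have key : ∀ {H : Noise ι d s t → ℝ≥0∞}, Measurable H → ∫⁻ y, H y ∂noiseLaw M β =
      ∫⁻ z, ∫⁻ w, ∫⁻ τ, H (z, w, τ) ∂Measure.infinitePi (fun _ : ι × ℕ => uniformTime s t)
        ∂Measure.pi β ∂multivariateGaussian 0 (M.transCov s t) := by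
    intro H hH
    rw [noiseLaw, lintegral_prod _ hH.aemeasurable]
    refine lintegral_congr fun z => ?_
    rw [lintegral_prod (fun q => H (z, q)) (hH.comp measurable_prodMk_left).aemeasurable]
  rw [key hF, key hG]
  refine lintegral_congr fun z => lintegral_congr fun w => ?_
  rw [← lintegral_congr fun τ' => h z w τ', lintegral_const, measure_univ, mul_one]

variable {β : ι → Measure (Path d s t)} [∀ c, IsProbabilityMeasure (β c)]

omit [Nonempty ι] in
lemma isProbabilityMeasure_noiseLaw (hst : s < t) : IsProbabilityMeasure (noiseLaw M β) := by
  have := isProbabilityMeasure_uniformTime hst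
  unfold noiseLaw; infer_instance

lemma weight_nonneg (hst : s < t) (q : Config ι d × (Noise ι d s t × (ι → ℕ))) :
    0 ≤ weight M R q := by
  have : 0 < t - s := sub_pos.2 hst
  refine Finset.prod_nonneg fun c _ => ?_
  unfold estimatorFactor
  refine mul_nonneg (by positivity) (Finset.prod_nonneg fun r _ => ?_)
  exact sub_nonneg.2 (phi_le_upperOf M _ _ _)

/-- The conditional mean of the weight given the path. -/
lemma lintegral_weight (hst : s < t) (x : Config ι d) :
    ∫⁻ z, ENNReal.ofReal (weight M R (x, z)) ∂particleKernel M R (noiseLaw M β) x =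
      ∫⁻ y, ENNReal.ofReal (Real.exp (-∑ c, phiInt M (x, y) c)) ∂noiseLaw M β := by
  have hΔ : 0 < t - s := sub_pos.2 hst
  have := isProbabilityMeasure_uniformTime hst
  have := isProbabilityMeasure_noiseLaw M (β := β) hst
  have mw := measurable_weight M R
  have mw' : Measurable fun q : (Config ι d × Noise ι d s t) × (ι → ℕ) =>
      ENNReal.ofReal (weight M R (q.1.1, (q.1.2, q.2))) := by fun_prop
  have mF := mw'.lintegral_kernel_prod_right' (κ := poissonKernel M R)
  have mI := fun c => measurable_phiInt M (s := s) (t := t) c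
  rw [lintegral_particleKernel M R _ (by fun_prop)]
  refine lintegral_noiseLaw_congr M hst (mF.comp measurable_prodMk_left)
    (by fun_prop) fun z w τ' => ?_
  -- `τ'` is a dummy in `p`: path, layer bound and intensity depend on `x`, `z`, `w` alone, so they
  -- are the same for every `τ`.
  set p : Config ι d × Noise ι d s t := (x, z, w, τ') with hp
  have hV : ∀ c u, 0 ≤ upperOf M R p c - M.phi c (pathOf M p c u) := fun c u =>
    sub_nonneg.2 (phi_le_upperOf M p c u)
  have cV : ∀ c, Continuous fun u => upperOf M R p c - M.phi c (pathOf M p c u) := fun c =>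
    continuous_const.sub (continuous_phi_pathOf p c)
  have iV := fun c => (Continuous.integrable_Icc (cV c)) (uniformTime s t)
  have hw : ∀ τ (k : ι → ℕ), ENNReal.ofReal (weight M R (x, (z, w, τ), k)) =
      ∏ c, (ENNReal.ofReal ((t - s) ^ k c * Real.exp (-(upperOf M R p c * (t - s))) /
        ((k c).factorial * (poissonMeasure (intensityOf M R p c)).real {k c})) *
        ∏ j ∈ Finset.range (k c),
          ENNReal.ofReal (upperOf M R p c - M.phi c (pathOf M p c (τ (c, j))))) := by
    intro τ k
    change ENNReal.ofReal (∏ c, ((t - s) ^ k c * Real.exp (-(upperOf M R p c * (t - s))) /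
        ((k c).factorial * (poissonMeasure (intensityOf M R p c)).real {k c}) *
        ∏ j ∈ Finset.range (k c), (upperOf M R p c - M.phi c (pathOf M p c (τ (c, j)))))) = _
    rw [ENNReal.ofReal_prod_of_nonneg fun c _ =>
      mul_nonneg (by positivity) (Finset.prod_nonneg fun j _ => hV c _)]
    refine Finset.prod_congr rfl fun c _ => ?_
    rw [ENNReal.ofReal_mul (by positivity), ENNReal.ofReal_prod_of_nonneg fun j _ => hV c _]
  change ∫⁻ τ, ∫⁻ k, ENNReal.ofReal (weight M R (x, (z, w, τ), k))
    ∂Measure.pi (fun c => poissonMeasure (intensityOf M R p c))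
    ∂Measure.infinitePi (fun _ : ι × ℕ => uniformTime s t) = _
  simp only [hw]
  rw [lintegral_times_poisson (uniformTime s t) (fun c => intensityOf M R p c)
    (fun c k => ENNReal.ofReal ((t - s) ^ k * Real.exp (-(upperOf M R p c * (t - s))) /
        (k.factorial * (poissonMeasure (intensityOf M R p c)).real {k})))
    fun c => (cV c).measurable.ennreal_ofReal]
  simp only [← ofReal_integral_eq_lintegral_ofReal (iV _) (ae_of_all _ (hV _))]
  rw [← Finset.sum_neg_distrib, Real.exp_sum, ENNReal.ofReal_prod_of_nonneg fun c _ =>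
    (Real.exp_pos _).le]
  refine Finset.prod_congr rfl fun c _ => ?_
  rw [lintegral_estimator _ _ _ _ hΔ.le (integral_nonneg (hV c))]
  · congr 2
    rw [integral_uniformTime hst, integral_sub (integrable_const _)
      (Continuous.integrable_Icc (continuous_phi_pathOf p c) _), integral_const]
    simp only [Measure.real, timeMeasure_univ, ENNReal.toReal_ofReal hΔ.le, phiInt, smul_eq_mul]
    ring
  -- Intensity zero means that `φ_c` equals its upper bound at almost every time, so the mean of the
  -- difference vanishes too.
  · intro h0
    have h1 := sq_intensityOf M R hst p c
    rw [h0] at h1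
    have h2 : ∫ u, (upperOf M R p c - M.phi c (pathOf M p c u)) ^ 2 ∂uniformTime s t = 0 := by
      rcases mul_eq_zero.1 (h1.symm.trans (by simp)) with h | h
      · exact absurd h (by positivity)
      · exact h
    rw [integral_eq_zero_iff_of_nonneg (fun u => sq_nonneg _)
      ((Continuous.integrable_Icc ((cV c).pow 2)) _)] at h2
    rw [integral_eq_zero_iff_of_nonneg (hV c) (iV c)]
    filter_upwards [h2] with u hu
    simpa using hu

/-- The conditional mean square of the weight given the path. -/
lemma lintegral_weight_sq (hst : s < t) (x : Config ι d) :
    ∫⁻ z, ENNReal.ofReal (weight M R (x, z) ^ 2) ∂particleKernel M R (noiseLaw M β) x =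
      ∫⁻ y, ENNReal.ofReal (Real.exp (∑ c, 2 * (intensityOf M R (x, y) c -
        upperOf M R (x, y) c * (t - s)))) ∂noiseLaw M β := by
  have hΔ : 0 < t - s := sub_pos.2 hst
  have := isProbabilityMeasure_uniformTime hst
  have := isProbabilityMeasure_noiseLaw M (β := β) hst
  have mw := measurable_weight M R
  have mw' : Measurable fun q : (Config ι d × Noise ι d s t) × (ι → ℕ) =>
      ENNReal.ofReal (weight M R (q.1.1, (q.1.2, q.2)) ^ 2) := by fun_prop
  have mF := mw'.lintegral_kernel_prod_right' (κ := poissonKernel M R)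
  have mU := measurable_upperOf M R
  have mL := measurable_intensityOf M R
  rw [lintegral_particleKernel M R _ (by fun_prop)]
  refine lintegral_noiseLaw_congr M hst (mF.comp measurable_prodMk_left)
    (by fun_prop) fun z w τ' => ?_
  set p : Config ι d × Noise ι d s t := (x, z, w, τ') with hp
  have cV : ∀ c, Continuous fun u => (upperOf M R p c - M.phi c (pathOf M p c u)) ^ 2 := fun c =>
    (continuous_const.sub (continuous_phi_pathOf p c)).pow 2
  have iV := fun c => (Continuous.integrable_Icc (cV c)) (uniformTime s t)
  have hw : ∀ τ (k : ι → ℕ), ENNReal.ofReal (weight M R (x, (z, w, τ), k) ^ 2) =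
      ∏ c, (ENNReal.ofReal ((t - s) ^ k c * Real.exp (-(upperOf M R p c * (t - s))) /
        ((k c).factorial * (poissonMeasure (intensityOf M R p c)).real {k c})) ^ 2 *
        ∏ j ∈ Finset.range (k c),
          ENNReal.ofReal ((upperOf M R p c - M.phi c (pathOf M p c (τ (c, j)))) ^ 2)) := by
    intro τ k
    change ENNReal.ofReal ((∏ c, ((t - s) ^ k c * Real.exp (-(upperOf M R p c * (t - s))) /
        ((k c).factorial * (poissonMeasure (intensityOf M R p c)).real {k c}) *
        ∏ j ∈ Finset.range (k c),
          (upperOf M R p c - M.phi c (pathOf M p c (τ (c, j)))))) ^ 2) = _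
    rw [← Finset.prod_pow, ENNReal.ofReal_prod_of_nonneg fun c _ => sq_nonneg _]
    refine Finset.prod_congr rfl fun c _ => ?_
    rw [mul_pow, ENNReal.ofReal_mul (by positivity), ENNReal.ofReal_pow (by positivity),
      ← Finset.prod_pow, ENNReal.ofReal_prod_of_nonneg fun j _ => sq_nonneg _]
  change ∫⁻ τ, ∫⁻ k, ENNReal.ofReal (weight M R (x, (z, w, τ), k) ^ 2)
    ∂Measure.pi (fun c => poissonMeasure (intensityOf M R p c))
    ∂Measure.infinitePi (fun _ : ι × ℕ => uniformTime s t) = _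
  simp only [hw]
  rw [lintegral_times_poisson (uniformTime s t) (fun c => intensityOf M R p c)
    (fun c k => ENNReal.ofReal ((t - s) ^ k * Real.exp (-(upperOf M R p c * (t - s))) /
        (k.factorial * (poissonMeasure (intensityOf M R p c)).real {k})) ^ 2)
    fun c => (cV c).measurable.ennreal_ofReal]
  simp only [← ofReal_integral_eq_lintegral_ofReal (iV _) (ae_of_all _ fun _ => sq_nonneg _)]
  rw [Real.exp_sum, ENNReal.ofReal_prod_of_nonneg fun c _ => (Real.exp_pos _).le]
  refine Finset.prod_congr rfl fun c _ => ?_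
  exact lintegral_estimator_sq _ _ _ _ hΔ.le (integral_nonneg fun _ => sq_nonneg _)
    (sq_intensityOf M R hst p c)

end Moments


/-! ### Bounds for `φ_c`, the weighted mean as a projection, and `ν` -/

namespace GaussianModel

variable {ι : Type*} [Fintype ι] [Nonempty ι] {d : ℕ} (M : GaussianModel ι d)

/-- The inverse of the common scale `b|C|/m` of the covariance matrices. -/
def scale : ℝ := M.m / (M.b * M.card)

lemma scale_pos : 0 < M.scale :=
  div_pos M.m_pos (mul_pos M.b_pos M.card_pos)

lemma neg_le_phi (c : ι) (x : Pt d) : -(M.scale * d / 2) ≤ M.phi c x := by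
  rw [M.phi_eq, ← scale]
  have := quad_nonneg (M.Λ_posDef c).inv (x - M.a c)
  have h2 : 0 ≤ M.scale ^ 2 * quad (M.Λ c)⁻¹ (x - M.a c) := by positivity
  linarith

lemma phi_le (c : ι) (x : Pt d) :
    M.phi c x ≤ M.scale ^ 2 / 2 * quad (M.Λ c)⁻¹ (x - M.a c) := by
  rw [M.phi_eq, ← scale]
  have : 0 ≤ M.scale * d := mul_nonneg M.scale_pos.le (by positivity)
  linarith

lemma posDef_sum_inv : (∑ c, (M.Λ c)⁻¹).PosDef := by
  classical
  obtain ⟨c⟩ := ‹Nonempty ι›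
  rw [← Finset.add_sum_erase _ _ (Finset.mem_univ c)]
  exact (M.Λ_posDef c).inv.add_posSemidef
    (Matrix.posSemidef_sum _ fun c' _ => (M.Λ_posDef c').inv.posSemidef)

lemma posDef_ΛC : M.ΛC.PosDef := M.posDef_sum_inv.inv

omit [Nonempty ι] in
lemma wmean_sub (x y : Config ι d) : M.wmean (x - y) = M.wmean x - M.wmean y := by
  simp only [wmean, Pi.sub_apply, WithLp.ofLp_sub, Matrix.mulVec_sub, Finset.sum_sub_distrib]
  rfl

/-- The weighted mean is an orthogonal projection. -/
lemma sum_quad_wmean_le (x : Config ι d) :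
    ∑ c, quad (M.Λ c)⁻¹ (M.wmean x) ≤ ∑ c, quad (M.Λ c)⁻¹ (x c) := by
  set y := M.wmean x with hy
  have hA : (∑ c, (M.Λ c)⁻¹) *ᵥ y.ofLp = ∑ c, (M.Λ c)⁻¹ *ᵥ (x c).ofLp := by
    rw [hy, wmean, Matrix.mulVec_mulVec, ΛC,
      Matrix.mul_nonsing_inv _ M.posDef_sum_inv.det_pos.ne'.isUnit, Matrix.one_mulVec]
  -- Orthogonality of `x - y` and the constant configuration `y` for the inner product with blocks
  -- `Λ_c⁻¹`.
  have h1 : ∑ c, inner ℝ (x c) (Matrix.toEuclideanCLM (𝕜 := ℝ) (M.Λ c)⁻¹ y) =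
      ∑ c, quad (M.Λ c)⁻¹ y := by
    simp only [inner_toEuclideanCLM_comm (M.Λ_posDef _).inv.isHermitian (x _) y,
      Matrix.inner_toEuclideanCLM, quad]
    rw [← dotProduct_sum, ← hA, ← dotProduct_sum, Matrix.sum_mulVec]
  have h2 : 0 ≤ ∑ c, quad (M.Λ c)⁻¹ (x c + (-1 : ℝ) • y) :=
    Finset.sum_nonneg fun c _ => quad_nonneg (M.Λ_posDef c).inv _
  simp only [quad_add (M.Λ_posDef _).inv.isHermitian, quad_smul, map_smul, inner_smul_right,
    Finset.sum_add_distrib, ← Finset.mul_sum, h1] at h2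
  linarith

lemma card_mul_nu (x : Config ι d) :
    M.card * M.nu x = ∑ c, quad (M.Λ c)⁻¹ (x c - M.a c) := by
  rw [nu, mul_inv_cancel_left₀ M.card_pos.ne']

lemma nu_nonneg (x : Config ι d) : 0 ≤ M.nu x :=
  mul_nonneg (inv_nonneg.2 M.card_pos.le)
    (Finset.sum_nonneg fun c _ => quad_nonneg (M.Λ_posDef c).inv _)

/-- A bound for the quadratic form `vᵀ Λ_c⁻¹ v` on the unit sphere. -/
def invNorm (c : ι) : ℝ := ‖Matrix.toEuclideanCLM (𝕜 := ℝ) (M.Λ c)⁻¹‖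

omit [Nonempty ι] in
omit [Fintype ι] in
lemma invNorm_nonneg (c : ι) : 0 ≤ M.invNorm c := norm_nonneg _

end GaussianModel

/-! ### Quadratic forms along a path -/

section PathBounds

variable {ι : Type*} [Fintype ι] [Nonempty ι] {d : ℕ} (M : GaussianModel ι d)
  {s t : ℝ}

lemma norm_add₃_sq_le {E : Type*} [SeminormedAddCommGroup E] (u v w : E) :
    ‖u + v + w‖ ^ 2 ≤ 3 * (‖u‖ ^ 2 + ‖v‖ ^ 2 + ‖w‖ ^ 2) := by
  have h := norm_add₃_le (a := u) (b := v) (c := w)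
  have h2 : ‖u + v + w‖ ^ 2 ≤ (‖u‖ + ‖v‖ + ‖w‖) ^ 2 := pow_le_pow_left₀ (norm_nonneg _) h 2
  nlinarith [sq_nonneg (‖u‖ - ‖v‖), sq_nonneg (‖v‖ - ‖w‖), sq_nonneg (‖u‖ - ‖w‖)]

/-- The part of the noise that belongs to the index `c`. -/
def innovationComp (z : EuclideanSpace ℝ (ι × Fin d)) (c : ι) : Pt d :=
  WithLp.toLp 2 fun i => z (c, i)

omit [Nonempty ι] in
-- The signal, a convex combination of `x - a` and its weighted mean, is split from the remainder
-- made of the offset of the centres, the innovation and the bridge. The formulas for `θ` and `r`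
-- are recorded because they do not depend on `c`.
lemma pathOf_sub_eq (hst : s < t) (htT : t ≤ M.T) (p : Config ι d × Noise ι d s t) (c : ι)
    (u : Set.Icc s t) :
    ∃ θ : ℝ, 0 ≤ θ ∧ θ ≤ 1 ∧ ∃ r : ℝ, 0 ≤ r ∧ r ≤ 1 ∧ θ = (u - s) / (t - s) ∧
      r = θ * ((t - s) / (M.T - s)) ∧
      pathOf M p c u - M.a c = ((1 - r) • (p.1 c - M.a c) + r • M.wmean (p.1 - M.a)) +
        (r • (M.wmean M.a - M.a c) + θ • innovationComp p.2.1 c + p.2.2.1 c u) := by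
  have h1 : 0 < t - s := sub_pos.2 hst
  have h2 : 0 < M.T - s := by linarith
  have hu := u.2
  refine ⟨(u - s) / (t - s), div_nonneg (by linarith [hu.1]) h1.le,
    (div_le_one h1).2 (by linarith [hu.2]), (u - s) / (t - s) * ((t - s) / (M.T - s)), ?_, ?_, rfl,
    rfl, ?_⟩
  · exact mul_nonneg (div_nonneg (by linarith [hu.1]) h1.le) (div_nonneg h1.le h2.le)
  · exact mul_le_one₀ ((div_le_one h1).2 (by linarith [hu.2])) (div_nonneg h1.le h2.le)
      ((div_le_one h2).2 (by linarith))
  · have e1 : (t - u) / (t - s) = 1 - ((u : ℝ) - s) / (t - s) := by field_simp; ring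
    have e2 : (M.T - t) / (M.T - s) = 1 - (t - s) / (M.T - s) := by field_simp; ring
    have e3 : (WithLp.toLp 2 fun i => M.transMean s t p.1 c i + p.2.1 (c, i) : Pt d) =
        M.transMean s t p.1 c + innovationComp p.2.1 c := rfl
    change p.2.2.1 c u + interpolate (p.1 c)
      (WithLp.toLp 2 fun i => M.transMean s t p.1 c i + p.2.1 (c, i)) u - M.a c = _
    rw [e3, interpolate, GaussianModel.transMean, e1, e2, M.wmean_sub]
    module

/-- The quadratic form along a path is controlled by `ν` at the old state and by the noise. -/
lemma sum_quad_pathOf_le (hst : s < t) (htT : t ≤ M.T) {η : ℝ} (hη : 0 < η)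
    (p : Config ι d × Noise ι d s t) (u : Set.Icc s t) :
    ∑ c, quad (M.Λ c)⁻¹ (pathOf M p c u - M.a c) ≤ (1 + η) * (M.card * M.nu p.1) +
      (1 + η⁻¹) * 3 * ∑ c, M.invNorm c * (‖M.wmean M.a - M.a c‖ ^ 2 +
        ‖innovationComp p.2.1 c‖ ^ 2 + ‖p.2.2.1 c u‖ ^ 2) := by
  -- One `r` must serve every `c`: the projection inequality `sum_quad_wmean_le` holds only for the
  -- sum over `c`.
  obtain ⟨θ, hθ0, hθ1, r, hr0, hr1, hθ, hr, -⟩ := pathOf_sub_eq M hst htT p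
    (Classical.arbitrary ι) u
  have hc : ∀ c, quad (M.Λ c)⁻¹ (pathOf M p c u - M.a c) ≤
      (1 + η) * ((1 - r) * quad (M.Λ c)⁻¹ (p.1 c - M.a c) +
        r * quad (M.Λ c)⁻¹ (M.wmean (p.1 - M.a))) +
      (1 + η⁻¹) * (3 * (M.invNorm c * (‖M.wmean M.a - M.a c‖ ^ 2 +
        ‖innovationComp p.2.1 c‖ ^ 2 + ‖p.2.2.1 c u‖ ^ 2))) := by
    intro c
    have hpd := (M.Λ_posDef c).inv
    obtain ⟨θ', -, -, r', -, -, hθ', hr', e⟩ := pathOf_sub_eq M hst htT p c u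
    obtain rfl : θ' = θ := by rw [hθ, hθ']
    obtain rfl : r' = r := by rw [hr, hr']
    rw [e]
    refine (quad_add_le hpd hη _ _).trans ?_
    have h1 : 0 ≤ 1 + η := by positivity
    have h2 : 0 ≤ 1 + η⁻¹ := by positivity
    refine add_le_add (mul_le_mul_of_nonneg_left (quad_convex hpd hr0 hr1 _ _) h1)
      (mul_le_mul_of_nonneg_left ?_ h2)
    refine (quad_le_norm _ _).trans ?_
    have h3 : ‖r' • (M.wmean M.a - M.a c)‖ ^ 2 ≤ ‖M.wmean M.a - M.a c‖ ^ 2 := by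
      refine pow_le_pow_left₀ (norm_nonneg _) ?_ 2
      rw [norm_smul, Real.norm_eq_abs, abs_of_nonneg hr0]
      exact mul_le_of_le_one_left (norm_nonneg _) hr1
    have h4 : ‖θ' • innovationComp p.2.1 c‖ ^ 2 ≤ ‖innovationComp p.2.1 c‖ ^ 2 := by
      refine pow_le_pow_left₀ (norm_nonneg _) ?_ 2
      rw [norm_smul, Real.norm_eq_abs, abs_of_nonneg hθ0]
      exact mul_le_of_le_one_left (norm_nonneg _) hθ1
    have h5 := norm_add₃_sq_le (r' • (M.wmean M.a - M.a c)) (θ' • innovationComp p.2.1 c)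
      (p.2.2.1 c u)
    have h6 := M.invNorm_nonneg c
    calc _ ≤ M.invNorm c * (3 * (‖M.wmean M.a - M.a c‖ ^ 2 + ‖innovationComp p.2.1 c‖ ^ 2 +
          ‖p.2.2.1 c u‖ ^ 2)) := by
          refine mul_le_mul_of_nonneg_left ?_ h6
          linarith
      _ = _ := by ring
  refine (Finset.sum_le_sum fun c _ => hc c).trans ?_
  rw [Finset.sum_add_distrib, ← Finset.mul_sum, ← Finset.mul_sum, ← Finset.mul_sum, ← mul_assoc,
    Finset.sum_add_distrib, ← Finset.mul_sum, ← Finset.mul_sum, M.card_mul_nu]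
  have h7 := M.sum_quad_wmean_le (p.1 - M.a)
  simp only [Pi.sub_apply] at h7
  have h8 := mul_le_mul_of_nonneg_left h7 hr0
  gcongr
  linarith

end PathBounds

/-! ### Uniform bounds for the conditional moments of the weight -/

section Bounds

variable {ι : Type*} [Fintype ι] [DecidableEq ι] [Nonempty ι] {d : ℕ} (M : GaussianModel ι d)
  {s t : ℝ} (R : ∀ c, LayerScheme s t (M.phi c))

lemma neg_le_phiInt (hst : s < t) (p : Config ι d × Noise ι d s t) (c : ι) :
    -((t - s) * (M.scale * d / 2)) ≤ phiInt M p c := by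
  have hΔ : 0 < t - s := sub_pos.2 hst
  calc -((t - s) * (M.scale * d / 2)) = ∫ _, -(M.scale * d / 2) ∂timeMeasure s t := by
        rw [integral_const]
        simp only [Measure.real, timeMeasure_univ, ENNReal.toReal_ofReal hΔ.le, smul_eq_mul]
        ring
    _ ≤ _ := integral_mono (integrable_const _)
      (Continuous.integrable_Icc (continuous_phi_pathOf p c) _) fun u => M.neg_le_phi c _

/-- Since `0 ≤ U - φ ≤ U + σd/2` along the path, the intensity is at most `Δ(U + σd/2)`. The term
`UΔ` cancels, so the bound does not depend on how coarse the layer is. -/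
lemma intensityOf_sub_le (hst : s < t) (p : Config ι d × Noise ι d s t) (c : ι) :
    intensityOf M R p c - upperOf M R p c * (t - s) ≤ (t - s) * (M.scale * d / 2) := by
  have hΔ : 0 < t - s := sub_pos.2 hst
  have := isProbabilityMeasure_uniformTime hst
  have hU : 0 ≤ upperOf M R p c + M.scale * d / 2 := by
    have h1 := phi_le_upperOf M (R := R) p c ⟨s, le_rfl, hst.le⟩
    linarith [M.neg_le_phi c (pathOf M p c ⟨s, le_rfl, hst.le⟩)]
  have h1 : ∫ u, (upperOf M R p c - M.phi c (pathOf M p c u)) ^ 2 ∂uniformTime s t ≤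
      (upperOf M R p c + M.scale * d / 2) ^ 2 := by
    calc _ ≤ ∫ _, (upperOf M R p c + M.scale * d / 2) ^ 2 ∂uniformTime s t := by
          refine integral_mono (Continuous.integrable_Icc ((continuous_const.sub
            (continuous_phi_pathOf p c)).pow 2) _) (integrable_const _) fun u => ?_
          refine pow_le_pow_left₀ (sub_nonneg.2 (phi_le_upperOf M p c u)) ?_ 2
          linarith [M.neg_le_phi c (pathOf M p c u)]
      _ = _ := by rw [integral_const, probReal_univ, one_smul]
  have h2 : (intensityOf M R p c : ℝ) ^ 2 ≤
      ((t - s) * (upperOf M R p c + M.scale * d / 2)) ^ 2 := by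
    rw [sq_intensityOf M R hst, mul_pow]
    gcongr
  have h3 := (abs_le_of_sq_le_sq' h2 (by positivity)).2
  linarith

variable {β : ι → Measure (Path d s t)} [∀ c, IsProbabilityMeasure (β c)]

lemma lintegral_weight_le (hst : s < t) (x : Config ι d) :
    ∫⁻ z, ENNReal.ofReal (weight M R (x, z)) ∂particleKernel M R (noiseLaw M β) x ≤
      ENNReal.ofReal (Real.exp (M.card * ((t - s) * (M.scale * d / 2)))) := by
  have := isProbabilityMeasure_noiseLaw M (β := β) hst
  rw [lintegral_weight M R hst]
  calc _ ≤ ∫⁻ _, ENNReal.ofReal (Real.exp (M.card * ((t - s) * (M.scale * d / 2))))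
        ∂noiseLaw M β := by
        refine lintegral_mono fun y => ENNReal.ofReal_le_ofReal (Real.exp_le_exp.2 ?_)
        have := Finset.sum_le_sum fun c (_ : c ∈ Finset.univ) => neg_le_phiInt M hst (x, y) c
        rw [Finset.sum_const, Finset.card_univ, nsmul_eq_mul] at this
        simp only [GaussianModel.card]
        linarith
    _ = _ := by rw [lintegral_const, measure_univ, mul_one]

lemma lintegral_weight_sq_le (hst : s < t) (x : Config ι d) :
    ∫⁻ z, ENNReal.ofReal (weight M R (x, z) ^ 2) ∂particleKernel M R (noiseLaw M β) x ≤
      ENNReal.ofReal (Real.exp (M.card * (M.scale * d) * (t - s))) := by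
  have := isProbabilityMeasure_noiseLaw M (β := β) hst
  rw [lintegral_weight_sq M R hst]
  calc _ ≤ ∫⁻ _, ENNReal.ofReal (Real.exp (M.card * (M.scale * d) * (t - s)))
        ∂noiseLaw M β := by
        refine lintegral_mono fun y => ENNReal.ofReal_le_ofReal (Real.exp_le_exp.2 ?_)
        have := Finset.sum_le_sum fun c (_ : c ∈ Finset.univ) => mul_le_mul_of_nonneg_left
          (intensityOf_sub_le M R hst (x, y) c) zero_le_two
        refine this.trans (le_of_eq ?_)
        rw [Finset.sum_const, Finset.card_univ, nsmul_eq_mul]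
        simp only [GaussianModel.card]
        ring
    _ = _ := by rw [lintegral_const, measure_univ, mul_one]

end Bounds



/-! ### Jensen's inequality and variances of the noise -/

section Moments

lemma lintegral_sq_eq_variance {Ω : Type*} [MeasurableSpace Ω] {P : Measure Ω} [IsFiniteMeasure P]
    {X : Ω → ℝ} (hX : MemLp X 2 P) (h0 : ∫ ω, X ω ∂P = 0) :
    ∫⁻ ω, ENNReal.ofReal (X ω ^ 2) ∂P = ENNReal.ofReal Var[X; P] := by
  rw [ofReal_variance hX, evariance_eq_lintegral_ofReal, h0]
  simp only [sub_zero]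

lemma lintegral_ofReal_norm_sq_le {Ω : Type*} [MeasurableSpace Ω] {P : Measure Ω} {d : ℕ}
    {X : Ω → Pt d} (hX : Measurable X) {v : Fin d → ℝ} (hv : ∀ i, 0 ≤ v i)
    (h : ∀ i, ∫⁻ ω, ENNReal.ofReal (X ω i ^ 2) ∂P ≤ ENNReal.ofReal (v i)) :
    ∫⁻ ω, ENNReal.ofReal (‖X ω‖ ^ 2) ∂P ≤ ENNReal.ofReal (∑ i, v i) := by
  simp_rw [EuclideanSpace.real_norm_sq_eq, ENNReal.ofReal_sum_of_nonneg fun _ _ => sq_nonneg _]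
  rw [lintegral_finsetSum _ fun i _ => by fun_prop, ENNReal.ofReal_sum_of_nonneg fun i _ => hv i]
  exact Finset.sum_le_sum fun i _ => h i

/-- A lower bound for the mean of `exp (-W)`, by the convexity of the exponential function. -/
lemma exp_neg_le_lintegral {Ω : Type*} [MeasurableSpace Ω] {P : Measure Ω}
    [IsProbabilityMeasure P] {W : Ω → ℝ} (hW : Measurable W) (h0 : ∀ ω, 0 ≤ W ω) {A : ℝ}
    (hA : 0 ≤ A) (h : ∫⁻ ω, ENNReal.ofReal (W ω) ∂P ≤ ENNReal.ofReal A) :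
    ENNReal.ofReal (Real.exp (-A)) ≤ ∫⁻ ω, ENNReal.ofReal (Real.exp (-W ω)) ∂P := by
  -- The tangent of `exp(-w)` at `w = A`, with the negative term moved across so that both sides can
  -- be integrated in `ℝ≥0∞`.
  have h1 : ∀ ω, ENNReal.ofReal (Real.exp (-A)) + ENNReal.ofReal (Real.exp (-A) * A) ≤
      ENNReal.ofReal (Real.exp (-W ω)) + ENNReal.ofReal (Real.exp (-A)) * ENNReal.ofReal (W ω) := by
    intro ω
    rw [← ENNReal.ofReal_mul (Real.exp_nonneg _), ← ENNReal.ofReal_add (Real.exp_nonneg _)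
      (by positivity), ← ENNReal.ofReal_add (Real.exp_nonneg _)
      (mul_nonneg (Real.exp_nonneg _) (h0 ω))]
    refine ENNReal.ofReal_le_ofReal ?_
    have h2 := Real.add_one_le_exp (A - W ω)
    have h3 : Real.exp (-W ω) = Real.exp (-A) * Real.exp (A - W ω) := by
      rw [← Real.exp_add]; ring_nf
    rw [h3]
    nlinarith [Real.exp_pos (-A)]
  have h2 := lintegral_mono (μ := P) h1
  rw [lintegral_const, measure_univ, mul_one, lintegral_add_left (by fun_prop),
    lintegral_const_mul _ (by fun_prop)] at h2
  refine (ENNReal.add_le_add_iff_right (ENNReal.ofReal_ne_top (r := Real.exp (-A) * A))).1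
    (h2.trans ?_)
  rw [ENNReal.ofReal_mul (Real.exp_nonneg _)]
  gcongr

variable {ι : Type*} [Fintype ι] [DecidableEq ι] [Nonempty ι] {d : ℕ} (M : GaussianModel ι d)
  {s t : ℝ}

lemma GaussianModel.transCov_diag_le (hst : s < t) (htT : t ≤ M.T) (p : ι × Fin d) :
    M.transCov s t p p ≤ (t - s) * (M.Λ p.1 p.2 p.2 + M.ΛC p.2 p.2) := by
  have h1 : 0 < t - s := sub_pos.2 hst
  have h2 : 0 < M.T - s := by linarith
  have h3 : 0 ≤ M.Λ p.1 p.2 p.2 := (M.Λ_posDef p.1).diag_pos.le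
  have h4 : 0 ≤ M.ΛC p.2 p.2 := M.posDef_ΛC.diag_pos.le
  have h5 : (M.T - t) / (M.T - s) ≤ 1 := (div_le_one h2).2 (by linarith)
  have h6 : (t - s) / (M.T - s) ≤ 1 := (div_le_one h2).2 (by linarith)
  simp only [transCov, Matrix.of_apply, if_true]
  have e1 : (t - s) * (M.T - t) / (M.T - s) * M.Λ p.1 p.2 p.2 =
      (t - s) * (((M.T - t) / (M.T - s)) * M.Λ p.1 p.2 p.2) := by ring
  have e2 : (t - s) ^ 2 / (M.T - s) * M.ΛC p.2 p.2 =
      (t - s) * (((t - s) / (M.T - s)) * M.ΛC p.2 p.2) := by ring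
  rw [e1, e2, ← mul_add]
  refine mul_le_mul_of_nonneg_left (add_le_add ?_ ?_) h1.le
  · exact mul_le_of_le_one_left h3 h5
  · exact mul_le_of_le_one_left h4 h6

/-- For a matrix that is not positive semidefinite, `multivariateGaussian 0 S` is a point mass at
`0`. The bound thus holds for every `S`, and positivity of `transCov` need not be checked. -/
lemma lintegral_sq_multivariateGaussian_le {κ : Type*} [Fintype κ] [DecidableEq κ]
    (S : Matrix κ κ ℝ) (p : κ) :
    ∫⁻ z, ENNReal.ofReal (z p ^ 2) ∂multivariateGaussian 0 S ≤ ENNReal.ofReal (S p p) := by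
  by_cases hS : S.PosSemidef
  · have hm : MemLp (fun z : EuclideanSpace ℝ κ => z p) 2 (multivariateGaussian 0 S) :=
      IsGaussian.memLp_two_id.continuousLinearMap_comp (EuclideanSpace.proj (𝕜 := ℝ) p)
    rw [lintegral_sq_eq_variance hm, variance_eval_multivariateGaussian hS]
    have h := (EuclideanSpace.proj (𝕜 := ℝ) p).integral_comp_comm
      (IsGaussian.integrable_id (μ := multivariateGaussian (0 : EuclideanSpace ℝ κ) S))
    simpa using h
  · rw [multivariateGaussian_of_not_posSemidef _ hS, lintegral_dirac]
    simp

lemma IsBrownianBridge.lintegral_sq_le {Ω : Type*} [MeasurableSpace Ω] {P : Measure Ω}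
    [IsProbabilityMeasure P] {Λ : Matrix (Fin d) (Fin d) ℝ} (hΛ : Λ.PosDef)
    {B : Set.Icc s t → Ω → Pt d} (h : IsBrownianBridge Λ B P) (hst : s < t) (u : Set.Icc s t)
    (i : Fin d) :
    ∫⁻ ω, ENNReal.ofReal (B u ω i ^ 2) ∂P ≤ ENNReal.ofReal ((t - s) * Λ i i) := by
  have hm := h.memLp u i
  rw [lintegral_sq_eq_variance hm (h.mean u i), ← covariance_self hm.1.aemeasurable,
    h.covariance u u i i, min_self, max_self]
  refine ENNReal.ofReal_le_ofReal (mul_le_mul_of_nonneg_right ?_ hΛ.diag_pos.le)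
  have h1 : 0 < t - s := sub_pos.2 hst
  have hu := u.2
  rw [div_le_iff₀ h1]
  exact mul_le_mul (by linarith [hu.2]) (by linarith [hu.1]) (by linarith [hu.2]) h1.le

end Moments

/-! ### The mean cost of the noise is of order `Δ` -/

section Cost

variable {ι : Type*} [Fintype ι] [DecidableEq ι] [Nonempty ι] {d : ℕ} (M : GaussianModel ι d)
  {s t : ℝ}

/-- The contribution of the noise to the bound for the time integral of the quadratic forms. -/
def noiseCost (y : Noise ι d s t) : ℝ :=
  ∑ c, M.invNorm c * ((t - s) * ‖M.wmean M.a - M.a c‖ ^ 2 + (t - s) * ‖innovationComp y.1 c‖ ^ 2 +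
    ∫ u, ‖y.2.1 c u‖ ^ 2 ∂timeMeasure s t)

/-- A bound for the mean of `noiseCost`, per unit of time. -/
def noiseRate : ℝ :=
  ∑ c, M.invNorm c * (‖M.wmean M.a - M.a c‖ ^ 2 + M.T * ∑ i, (M.Λ c i i + M.ΛC i i) +
    M.T * ∑ i, M.Λ c i i)

omit [DecidableEq ι] in
lemma noiseRate_nonneg : 0 ≤ noiseRate M := by
  refine Finset.sum_nonneg fun c _ => mul_nonneg (M.invNorm_nonneg c) ?_
  have h1 : ∀ i, 0 ≤ M.Λ c i i := fun i => (M.Λ_posDef c).diag_pos.le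
  have h2 : ∀ i, 0 ≤ M.ΛC i i := fun i => M.posDef_ΛC.diag_pos.le
  have h3 := Finset.sum_nonneg fun i (_ : i ∈ Finset.univ) => h1 i
  have h4 := Finset.sum_nonneg fun i (_ : i ∈ Finset.univ) => add_nonneg (h1 i) (h2 i)
  have := M.T_pos.le
  positivity

omit [DecidableEq ι] [Nonempty ι] in
lemma noiseCost_nonneg (hst : s < t) (y : Noise ι d s t) : 0 ≤ noiseCost M y := by
  have : 0 < t - s := sub_pos.2 hst
  refine Finset.sum_nonneg fun c _ => mul_nonneg (norm_nonneg _) ?_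
  have : 0 ≤ ∫ u, ‖y.2.1 c u‖ ^ 2 ∂timeMeasure s t := integral_nonneg fun u => sq_nonneg _
  positivity

omit [Fintype ι] [DecidableEq ι] [Nonempty ι] in
lemma measurable_eval_uncurry (c : ι) :
    Measurable fun q : Noise ι d s t × Set.Icc s t => q.1.2.1 c q.2 := by
  have h : Measurable fun q : Noise ι d s t × Set.Icc s t => (q.1.2.1 c, q.2) :=
    ((measurable_pi_apply c).comp
      (measurable_fst.comp (measurable_snd.comp measurable_fst))).prodMk measurable_snd
  exact measurable_path_eval_uncurry.comp h

omit [DecidableEq ι] [Nonempty ι] in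
lemma measurable_noiseCost : Measurable (noiseCost M : Noise ι d s t → ℝ) := by
  refine Finset.measurable_fun_sum _ fun c _ => ?_
  have h1 : Measurable fun y : Noise ι d s t => ∫ u, ‖y.2.1 c u‖ ^ 2 ∂timeMeasure s t :=
    ((measurable_eval_uncurry c).norm.pow_const 2).stronglyMeasurable.integral_prod_right'
      (ν := timeMeasure s t) |>.measurable
  have h2 : Measurable fun y : Noise ι d s t => innovationComp y.1 c := by
    unfold innovationComp; fun_prop
  fun_prop

/-- The path estimate integrated over time. The first term depends on the old state only and the
second on the noise only, so the two can be averaged separately. -/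
lemma sum_phiInt_le (hst : s < t) (htT : t ≤ M.T) {η : ℝ} (hη : 0 < η) (x : Config ι d)
    (y : Noise ι d s t) :
    ∑ c, phiInt M (x, y) c ≤ M.scale ^ 2 / 2 * ((1 + η) * ((t - s) * (M.card * M.nu x))) +
      M.scale ^ 2 / 2 * ((1 + η⁻¹) * 3) * noiseCost M y := by
  have hΔ : 0 < t - s := sub_pos.2 hst
  have hi : ∀ c, Continuous fun u => ‖y.2.1 c u‖ ^ 2 := fun c => (y.2.1 c).continuous.norm.pow 2
  simp only [phiInt]
  rw [← integral_finsetSum _ fun c _ =>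
    Continuous.integrable_Icc (continuous_phi_pathOf (x, y) c) _]
  calc _ ≤ ∫ u, M.scale ^ 2 / 2 * ((1 + η) * (M.card * M.nu x) +
        (1 + η⁻¹) * 3 * ∑ c, M.invNorm c * (‖M.wmean M.a - M.a c‖ ^ 2 +
          ‖innovationComp y.1 c‖ ^ 2 + ‖y.2.1 c u‖ ^ 2)) ∂timeMeasure s t := by
        refine integral_mono (Continuous.integrable_Icc (continuous_finsetSum _ fun c _ =>
          continuous_phi_pathOf (x, y) c) _) (Continuous.integrable_Icc (by fun_prop) _) fun u => ?_
        refine le_trans ?_ (mul_le_mul_of_nonneg_left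
          (sum_quad_pathOf_le M hst htT hη (x, y) u) (by positivity))
        rw [Finset.mul_sum]
        exact Finset.sum_le_sum fun c _ => M.phi_le c _
    _ = _ := by
        have hv : (timeMeasure s t).real Set.univ = t - s := by
          rw [Measure.real, timeMeasure_univ, ENNReal.toReal_ofReal hΔ.le]
        rw [integral_const_mul, integral_add (integrable_const _)
          (Continuous.integrable_Icc (by fun_prop) _), integral_const, hv, integral_const_mul,
          integral_finsetSum _ fun c _ => Continuous.integrable_Icc (by fun_prop) _, noiseCost]
        have : ∀ c, ∫ u, M.invNorm c * (‖M.wmean M.a - M.a c‖ ^ 2 +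
            ‖innovationComp y.1 c‖ ^ 2 + ‖y.2.1 c u‖ ^ 2) ∂timeMeasure s t =
            M.invNorm c * ((t - s) * ‖M.wmean M.a - M.a c‖ ^ 2 +
              (t - s) * ‖innovationComp y.1 c‖ ^ 2 + ∫ u, ‖y.2.1 c u‖ ^ 2 ∂timeMeasure s t) := by
          intro c
          rw [integral_const_mul, integral_add (integrable_const _)
            (Continuous.integrable_Icc (hi c) _), integral_const, hv, smul_eq_mul]
          ring
        simp_rw [this, smul_eq_mul]
        ring

variable {β : ι → Measure (Path d s t)} [∀ c, IsProbabilityMeasure (β c)]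

set_option synthInstance.maxHeartbeats 400000 in
omit [Nonempty ι] in
lemma measurePreserving_fst_noiseLaw (hst : s < t) :
    MeasurePreserving Prod.fst (noiseLaw M β) (multivariateGaussian 0 (M.transCov s t)) := by
  have := isProbabilityMeasure_uniformTime hst
  have : IsProbabilityMeasure ((Measure.pi β).prod
    (Measure.infinitePi fun _ : ι × ℕ => uniformTime s t)) := inferInstance
  exact measurePreserving_fst

set_option synthInstance.maxHeartbeats 400000 in
omit [Nonempty ι] in
lemma measurePreserving_bridge_noiseLaw (hst : s < t) (c : ι) :
    MeasurePreserving (fun y : Noise ι d s t => y.2.1 c) (noiseLaw M β) (β c) := by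
  have := isProbabilityMeasure_uniformTime hst
  have : IsProbabilityMeasure ((Measure.pi β).prod
    (Measure.infinitePi fun _ : ι × ℕ => uniformTime s t)) := inferInstance
  have h1 : MeasurePreserving Prod.snd (noiseLaw M β) ((Measure.pi β).prod
    (Measure.infinitePi fun _ : ι × ℕ => uniformTime s t)) := measurePreserving_snd
  exact (measurePreserving_eval β c).comp (measurePreserving_fst.comp h1)

lemma lintegral_innovationComp_le (hst : s < t) (htT : t ≤ M.T) (c : ι) :
    ∫⁻ y, ENNReal.ofReal (‖innovationComp y.1 c‖ ^ 2) ∂noiseLaw M β ≤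
      ENNReal.ofReal ((t - s) * ∑ i, (M.Λ c i i + M.ΛC i i)) := by
  have := isProbabilityMeasure_uniformTime hst
  have hm : Measurable fun z : EuclideanSpace ℝ (ι × Fin d) => innovationComp z c := by
    unfold innovationComp; fun_prop
  have e : ∫⁻ y, ENNReal.ofReal (‖innovationComp y.1 c‖ ^ 2) ∂noiseLaw M β =
      ∫⁻ z, ENNReal.ofReal (‖innovationComp z c‖ ^ 2) ∂multivariateGaussian 0 (M.transCov s t) :=
    (measurePreserving_fst_noiseLaw M hst).lintegral_comp
      (f := fun z => ENNReal.ofReal (‖innovationComp z c‖ ^ 2)) (by fun_prop)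
  rw [e, Finset.mul_sum]
  refine lintegral_ofReal_norm_sq_le hm (fun i => ?_) fun i => ?_
  · exact mul_nonneg (sub_pos.2 hst).le
      (add_nonneg (M.Λ_posDef c).diag_pos.le M.posDef_ΛC.diag_pos.le)
  · exact (lintegral_sq_multivariateGaussian_le _ (c, i)).trans
      (ENNReal.ofReal_le_ofReal (M.transCov_diag_le hst htT (c, i)))

lemma lintegral_bridge_le (hst : s < t)
    (hβ : ∀ c u i, ∫⁻ w, ENNReal.ofReal (w u i ^ 2) ∂β c ≤ ENNReal.ofReal ((t - s) * M.Λ c i i))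
    (c : ι) :
    ∫⁻ y, ENNReal.ofReal (∫ u, ‖y.2.1 c u‖ ^ 2 ∂timeMeasure s t) ∂noiseLaw M β ≤
      ENNReal.ofReal ((t - s) * ((t - s) * ∑ i, M.Λ c i i)) := by
  have := isProbabilityMeasure_uniformTime hst
  have := isProbabilityMeasure_noiseLaw M (β := β) hst
  have hm := measurable_eval_uncurry (d := d) (s := s) (t := t) c
  have hΔ : 0 < t - s := sub_pos.2 hst
  have e : ∀ y : Noise ι d s t, ENNReal.ofReal (∫ u, ‖y.2.1 c u‖ ^ 2 ∂timeMeasure s t) =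
      ∫⁻ u, ENNReal.ofReal (‖y.2.1 c u‖ ^ 2) ∂timeMeasure s t := fun y =>
    ofReal_integral_eq_lintegral_ofReal
      (Continuous.integrable_Icc ((y.2.1 c).continuous.norm.pow 2) _)
      (ae_of_all _ fun u => sq_nonneg _)
  simp_rw [e]
  rw [lintegral_lintegral_swap (hm.norm.pow_const 2).ennreal_ofReal.aemeasurable]
  have h1 : ∀ u, ∫⁻ y, ENNReal.ofReal (‖y.2.1 c u‖ ^ 2) ∂noiseLaw M β ≤
      ENNReal.ofReal ((t - s) * ∑ i, M.Λ c i i) := by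
    intro u
    have hw := measurable_path_eval (d := d) u
    have e2 : ∫⁻ y, ENNReal.ofReal (‖y.2.1 c u‖ ^ 2) ∂noiseLaw M β =
        ∫⁻ w, ENNReal.ofReal (‖w u‖ ^ 2) ∂β c :=
      (measurePreserving_bridge_noiseLaw M hst c).lintegral_comp
        (f := fun w => ENNReal.ofReal (‖w u‖ ^ 2)) (hw.norm.pow_const 2).ennreal_ofReal
    rw [e2, Finset.mul_sum]
    exact lintegral_ofReal_norm_sq_le hw
      (fun i => mul_nonneg hΔ.le (M.Λ_posDef c).diag_pos.le) fun i => hβ c u i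
  refine (lintegral_mono h1).trans (le_of_eq ?_)
  rw [lintegral_const, timeMeasure_univ, ← ENNReal.ofReal_mul' hΔ.le, mul_comm]

/-- Innovation and bridge have variances of order `Δ`, so their time integrals are of order `Δ²`; `Δ
≤ T` converts one factor into the constant in `noiseRate`. -/
lemma lintegral_noiseCost_le (hs : 0 ≤ s) (hst : s < t) (htT : t ≤ M.T)
    (hβ : ∀ c u i, ∫⁻ w, ENNReal.ofReal (w u i ^ 2) ∂β c ≤ ENNReal.ofReal ((t - s) * M.Λ c i i)) :
    ∫⁻ y, ENNReal.ofReal (noiseCost M y) ∂noiseLaw M β ≤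
      ENNReal.ofReal ((t - s) * noiseRate M) := by
  have := isProbabilityMeasure_noiseLaw M (β := β) hst
  have hΔ : 0 < t - s := sub_pos.2 hst
  have hΔT : t - s ≤ M.T := by linarith
  have h1 : ∀ c, Measurable fun y : Noise ι d s t => ∫ u, ‖y.2.1 c u‖ ^ 2 ∂timeMeasure s t :=
    fun c => ((measurable_eval_uncurry c).norm.pow_const 2).stronglyMeasurable.integral_prod_right'
      (ν := timeMeasure s t) |>.measurable
  have h2 : ∀ c, Measurable fun y : Noise ι d s t => innovationComp y.1 c := fun c => by
    unfold innovationComp; fun_prop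
  have n1 : ∀ (y : Noise ι d s t) c, 0 ≤ ∫ u, ‖y.2.1 c u‖ ^ 2 ∂timeMeasure s t := fun y c =>
    integral_nonneg fun u => sq_nonneg _
  have n2 : ∀ c i, 0 ≤ M.Λ c i i := fun c i => (M.Λ_posDef c).diag_pos.le
  have n3 : ∀ i, 0 ≤ M.ΛC i i := fun i => M.posDef_ΛC.diag_pos.le
  have n4 : ∀ c, 0 ≤ ∑ i, M.Λ c i i := fun c => Finset.sum_nonneg fun i _ => n2 c i
  have n5 : ∀ c, 0 ≤ ∑ i, (M.Λ c i i + M.ΛC i i) := fun c =>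
    Finset.sum_nonneg fun i _ => add_nonneg (n2 c i) (n3 i)
  have nT := M.T_pos.le
  have nK := M.invNorm_nonneg
  have key : ∀ c, ∫⁻ y, ENNReal.ofReal (M.invNorm c * ((t - s) * ‖M.wmean M.a - M.a c‖ ^ 2 +
      (t - s) * ‖innovationComp y.1 c‖ ^ 2 + ∫ u, ‖y.2.1 c u‖ ^ 2 ∂timeMeasure s t)) ∂noiseLaw M β ≤
      ENNReal.ofReal (M.invNorm c * ((t - s) * ‖M.wmean M.a - M.a c‖ ^ 2 +
        (t - s) * ((t - s) * ∑ i, (M.Λ c i i + M.ΛC i i)) +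
        (t - s) * ((t - s) * ∑ i, M.Λ c i i))) := by
    intro c
    have e : ∀ y : Noise ι d s t, ENNReal.ofReal (M.invNorm c *
        ((t - s) * ‖M.wmean M.a - M.a c‖ ^ 2 + (t - s) * ‖innovationComp y.1 c‖ ^ 2 +
          ∫ u, ‖y.2.1 c u‖ ^ 2 ∂timeMeasure s t)) = ENNReal.ofReal (M.invNorm c) *
        (ENNReal.ofReal ((t - s) * ‖M.wmean M.a - M.a c‖ ^ 2) +
          ENNReal.ofReal (t - s) * ENNReal.ofReal (‖innovationComp y.1 c‖ ^ 2) +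
          ENNReal.ofReal (∫ u, ‖y.2.1 c u‖ ^ 2 ∂timeMeasure s t)) := by
      intro y
      have := n1 y c
      rw [ENNReal.ofReal_mul (nK c), ENNReal.ofReal_add (by positivity) this,
        ENNReal.ofReal_add (by positivity) (by positivity),
        ENNReal.ofReal_mul (q := ‖innovationComp y.1 c‖ ^ 2) hΔ.le]
    have i1 := n4 c
    have i2 := n5 c
    have m1 := h1 c
    have m2 := h2 c
    simp_rw [e]
    rw [lintegral_const_mul _ (by fun_prop), lintegral_add_left (by fun_prop),
      lintegral_add_left (by fun_prop), lintegral_const, measure_univ, mul_one,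
      lintegral_const_mul _ (by fun_prop), ENNReal.ofReal_mul (nK c),
      ENNReal.ofReal_add (by positivity) (by positivity),
      ENNReal.ofReal_add (by positivity) (by positivity),
      ENNReal.ofReal_mul (q := (t - s) * ∑ i, (M.Λ c i i + M.ΛC i i)) hΔ.le]
    gcongr
    · exact lintegral_innovationComp_le M hst htT c
    · exact lintegral_bridge_le M hst hβ c
  have hm : ∀ c, Measurable fun y : Noise ι d s t => ENNReal.ofReal (M.invNorm c *
      ((t - s) * ‖M.wmean M.a - M.a c‖ ^ 2 + (t - s) * ‖innovationComp y.1 c‖ ^ 2 +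
        ∫ u, ‖y.2.1 c u‖ ^ 2 ∂timeMeasure s t)) := fun c => by
    have m1 := h1 c
    have m2 := h2 c
    fun_prop
  have e : ∀ y : Noise ι d s t, ENNReal.ofReal (noiseCost M y) = ∑ c, ENNReal.ofReal (M.invNorm c *
      ((t - s) * ‖M.wmean M.a - M.a c‖ ^ 2 + (t - s) * ‖innovationComp y.1 c‖ ^ 2 +
        ∫ u, ‖y.2.1 c u‖ ^ 2 ∂timeMeasure s t)) := by
    intro y
    refine ENNReal.ofReal_sum_of_nonneg fun c _ => mul_nonneg (nK c) ?_
    have := n1 y c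
    positivity
  simp_rw [e]
  rw [lintegral_finsetSum _ fun c _ => hm c]
  refine (Finset.sum_le_sum fun c _ => key c).trans ?_
  rw [← ENNReal.ofReal_sum_of_nonneg fun c _ => ?_]
  · refine ENNReal.ofReal_le_ofReal ?_
    rw [noiseRate, Finset.mul_sum]
    refine Finset.sum_le_sum fun c _ => ?_
    have i1 := mul_le_mul_of_nonneg_right hΔT (n4 c)
    have i2 := mul_le_mul_of_nonneg_right hΔT (n5 c)
    calc _ = (t - s) * (M.invNorm c * (‖M.wmean M.a - M.a c‖ ^ 2 +
          (t - s) * ∑ i, (M.Λ c i i + M.ΛC i i) + (t - s) * ∑ i, M.Λ c i i)) := by ring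
      _ ≤ _ := by
        have := nK c
        gcongr
  · have i1 := n4 c
    have i2 := n5 c
    have := nK c
    positivity

end Cost



/-! ### The limiting constant and its lower bound -/

section Ratio

lemma tendstoInMeasure_of_continuousAt {Ω : Type*} [MeasurableSpace Ω] {P : Measure Ω}
    {A B : ℕ → Ω → ℝ} {a b : ℝ} (hA : TendstoInMeasure P A atTop fun _ => a)
    (hB : TendstoInMeasure P B atTop fun _ => b) {F : ℝ × ℝ → ℝ} (hF : ContinuousAt F (a, b)) :
    TendstoInMeasure P (fun N ω => F (A N ω, B N ω)) atTop fun _ => F (a, b) := by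
  rw [tendstoInMeasure_iff_dist] at hA hB ⊢
  intro ε hε
  obtain ⟨δ, hδ, h⟩ := Metric.continuousAt_iff.1 hF ε hε
  have hlim := (hA δ hδ).add (hB δ hδ)
  rw [add_zero] at hlim
  refine tendsto_of_tendsto_of_tendsto_of_le_of_le tendsto_const_nhds hlim
    (fun _ => zero_le) fun N => (measure_mono fun ω hω => ?_).trans (measure_union_le _ _)
  by_contra hc
  simp only [Set.mem_union, Set.mem_ofPred_eq, not_or, not_le] at hc hω
  exact absurd (h (show dist (A N ω, B N ω) (a, b) < δ from max_lt hc.1 hc.2)) (not_lt.2 hω)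

/-- Expresses `N⁻¹ CESS` through the averages of the weights and of their squares; with `0⁻¹ = 0` it
also covers `N = 0`. -/
lemma inv_mul_sq_div (n x y : ℝ) : n⁻¹ * (x ^ 2 / y) = (n⁻¹ * x) ^ 2 / (n⁻¹ * y) := by
  rcases eq_or_ne n 0 with rfl | hn
  · simp
  · rw [show (n⁻¹ * x) ^ 2 = n⁻¹ * (n⁻¹ * x ^ 2) by ring, mul_div_mul_left _ _ (inv_ne_zero hn),
      mul_div_assoc]

end Ratio

section WeightMoments

variable {ι : Type*} [Fintype ι] [DecidableEq ι] [Nonempty ι] {d : ℕ} (M : GaussianModel ι d)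
  {s t : ℝ} (R : ∀ c, LayerScheme s t (M.phi c)) (β : ι → Measure (Path d s t))
  (μ : Measure (Config ι d))

/-- The joint law of the old state, the noise and the numbers `κ` of one particle. -/
def jointLaw : Measure (Config ι d × (Noise ι d s t × (ι → ℕ))) :=
  μ ⊗ₘ particleKernel M R (noiseLaw M β)

variable [∀ c, IsProbabilityMeasure (β c)] [IsProbabilityMeasure μ]

lemma isProbabilityMeasure_jointLaw (hst : s < t) : IsProbabilityMeasure (jointLaw M R β μ) := by
  have := isProbabilityMeasure_noiseLaw M (β := β) hst
  unfold jointLaw; infer_instance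

lemma lintegral_jointLaw (hst : s < t) {f : Config ι d × (Noise ι d s t × (ι → ℕ)) → ℝ≥0∞}
    (hf : Measurable f) :
    ∫⁻ q, f q ∂jointLaw M R β μ =
      ∫⁻ x, ∫⁻ z, f (x, z) ∂particleKernel M R (noiseLaw M β) x ∂μ := by
  have := isProbabilityMeasure_noiseLaw M (β := β) hst
  exact Measure.lintegral_compProd hf

lemma lintegral_jointLaw_weight_sq_le (hst : s < t) :
    ∫⁻ q, ENNReal.ofReal (weight M R q ^ 2) ∂jointLaw M R β μ ≤
      ENNReal.ofReal (Real.exp (M.card * (M.scale * d) * (t - s))) := by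
  have hm := measurable_weight M R
  rw [lintegral_jointLaw M R β μ hst (by fun_prop)]
  refine (lintegral_mono fun x => lintegral_weight_sq_le M R hst x).trans (le_of_eq ?_)
  rw [lintegral_const, measure_univ, mul_one]

lemma memLp_weight (hst : s < t) : MemLp (weight M R) 2 (jointLaw M R β μ) := by
  have hm := measurable_weight M R
  refine (memLp_two_iff_integrable_sq hm.aestronglyMeasurable).2
    ⟨(hm.pow_const 2).aestronglyMeasurable, ?_⟩
  rw [hasFiniteIntegral_iff_ofReal (ae_of_all _ fun _ => sq_nonneg _)]
  exact (lintegral_jointLaw_weight_sq_le M R β μ hst).trans_lt ENNReal.ofReal_lt_top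

lemma integral_weight_sq_le (hst : s < t) :
    ∫ q, weight M R q ^ 2 ∂jointLaw M R β μ ≤ Real.exp (M.card * (M.scale * d) * (t - s)) := by
  rw [← ENNReal.ofReal_le_ofReal_iff (Real.exp_nonneg _),
    ofReal_integral_eq_lintegral_ofReal (memLp_weight M R β μ hst).integrable_sq
      (ae_of_all _ fun _ => sq_nonneg _)]
  exact lintegral_jointLaw_weight_sq_le M R β μ hst

lemma sq_integral_weight_le (hst : s < t) :
    (∫ q, weight M R q ∂jointLaw M R β μ) ^ 2 ≤ ∫ q, weight M R q ^ 2 ∂jointLaw M R β μ := by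
  have := isProbabilityMeasure_jointLaw M R β μ hst
  have h := variance_nonneg (weight M R) (jointLaw M R β μ)
  rw [variance_eq_sub (memLp_weight M R β μ hst)] at h
  simpa using h

/-- Half of the bound for `-log` of the squared mean weight. -/
def costBound (η V Δ : ℝ) : ℝ :=
  M.scale ^ 2 / 2 * ((1 + η) * (Δ * (M.card * V))) +
    M.scale ^ 2 / 2 * ((1 + η⁻¹) * 3) * (Δ * noiseRate M)

lemma exp_neg_costBound_le_integral_weight (hs : 0 ≤ s) (hst : s < t) (htT : t ≤ M.T)
    (hβ : ∀ c u i, ∫⁻ w, ENNReal.ofReal (w u i ^ 2) ∂β c ≤ ENNReal.ofReal ((t - s) * M.Λ c i i))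
    (hν : Integrable M.nu μ) {η : ℝ} (hη : 0 < η) :
    Real.exp (-costBound M η (∫ x, M.nu x ∂μ) (t - s)) ≤
      ∫ q, weight M R q ∂jointLaw M R β μ := by
  have := isProbabilityMeasure_noiseLaw M (β := β) hst
  have := isProbabilityMeasure_jointLaw M R β μ hst
  have hΔ : 0 < t - s := sub_pos.2 hst
  have hm := measurable_weight M R
  have hc := M.card_pos
  have hr := noiseRate_nonneg M
  have hS := measurable_noiseCost M (s := s) (t := t)
  have hS0 := noiseCost_nonneg M hst
  have hn0 := M.nu_nonneg
  have hnm : Measurable M.nu := by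
    have hq : ∀ c, Continuous (quad (M.Λ c)⁻¹) := fun c => continuous_quad _
    have : Continuous M.nu := by
      unfold GaussianModel.nu
      exact continuous_const.mul (continuous_finsetSum _ fun c _ => (hq c).comp (by fun_prop))
    exact this.measurable
  have hV : 0 ≤ ∫ x, M.nu x ∂μ := integral_nonneg hn0
  set k₁ := M.scale ^ 2 / 2 * ((1 + η) * ((t - s) * M.card)) with hk₁
  set k₂ := M.scale ^ 2 / 2 * ((1 + η⁻¹) * 3) with hk₂
  have hk₁0 : 0 ≤ k₁ := by positivity
  have hk₂0 : 0 ≤ k₂ := by positivity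
  -- Jensen's inequality is used twice: here over the noise for a fixed old state, and in `h2` over
  -- the old state.
  have h1 : ∀ x, ENNReal.ofReal (Real.exp (-(k₁ * M.nu x + k₂ * ((t - s) * noiseRate M)))) ≤
      ∫⁻ y, ENNReal.ofReal (Real.exp (-∑ c, phiInt M (x, y) c)) ∂noiseLaw M β := by
    intro x
    refine (exp_neg_le_lintegral (P := noiseLaw M β)
      (W := fun y => k₁ * M.nu x + k₂ * noiseCost M y) (by fun_prop) (fun y => ?_) ?_ ?_).trans
      (lintegral_mono fun y => ENNReal.ofReal_le_ofReal (Real.exp_le_exp.2 (neg_le_neg ?_)))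
    · have := hn0 x; have := hS0 y; positivity
    · have := hn0 x; positivity
    · have e : ∀ y : Noise ι d s t, ENNReal.ofReal (k₁ * M.nu x + k₂ * noiseCost M y) =
          ENNReal.ofReal (k₁ * M.nu x) + ENNReal.ofReal k₂ * ENNReal.ofReal (noiseCost M y) := by
        intro y
        rw [ENNReal.ofReal_add (mul_nonneg hk₁0 (hn0 x)) (mul_nonneg hk₂0 (hS0 y)),
          ENNReal.ofReal_mul hk₂0]
      simp_rw [e]
      rw [lintegral_add_left (by fun_prop), lintegral_const, measure_univ, mul_one,
        lintegral_const_mul _ (by fun_prop), ENNReal.ofReal_add (mul_nonneg hk₁0 (hn0 x))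
        (by positivity), ENNReal.ofReal_mul hk₂0]
      gcongr
      exact lintegral_noiseCost_le M hs hst htT hβ
    · refine (sum_phiInt_le M hst htT hη x y).trans (le_of_eq ?_)
      rw [hk₁, hk₂]; ring
  have h2 : ENNReal.ofReal (Real.exp (-costBound M η (∫ x, M.nu x ∂μ) (t - s))) ≤
      ∫⁻ x, ENNReal.ofReal (Real.exp (-(k₁ * M.nu x + k₂ * ((t - s) * noiseRate M)))) ∂μ := by
    have e : costBound M η (∫ x, M.nu x ∂μ) (t - s) =
        ∫ x, (k₁ * M.nu x + k₂ * ((t - s) * noiseRate M)) ∂μ := by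
      rw [integral_add (hν.const_mul _) (integrable_const _), integral_const_mul, integral_const,
        probReal_univ, one_smul, costBound, hk₁, hk₂]
      ring
    rw [e]
    have h0 : ∀ x, 0 ≤ k₁ * M.nu x + k₂ * ((t - s) * noiseRate M) := fun x => by
      have := hn0 x; positivity
    refine exp_neg_le_lintegral (by fun_prop) h0 (integral_nonneg h0) (le_of_eq ?_)
    exact (ofReal_integral_eq_lintegral_ofReal ((hν.const_mul _).add (integrable_const _))
      (ae_of_all _ h0)).symm
  have h3 : ENNReal.ofReal (∫ q, weight M R q ∂jointLaw M R β μ) =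
      ∫⁻ x, ∫⁻ y, ENNReal.ofReal (Real.exp (-∑ c, phiInt M (x, y) c)) ∂noiseLaw M β ∂μ := by
    rw [ofReal_integral_eq_lintegral_ofReal
      ((memLp_weight M R β μ hst).integrable one_le_two)
      (ae_of_all _ fun q => weight_nonneg M R hst q), lintegral_jointLaw M R β μ hst (by fun_prop)]
    exact lintegral_congr fun x => lintegral_weight M R hst x
  rw [← ENNReal.ofReal_le_ofReal_iff (integral_nonneg fun q => weight_nonneg M R hst q), h3]
  exact h2.trans (lintegral_mono h1)

/-- The limit of the relative conditional effective sample size. -/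
def cessLimit : ℝ :=
  (∫ q, weight M R q ∂jointLaw M R β μ) ^ 2 / ∫ q, weight M R q ^ 2 ∂jointLaw M R β μ

/-- The mean weight is positive by the exponential lower bound, here with `η = 1`, though any `η`
would do. Positivity makes the quotient in `cessLimit` continuous at the limiting moments. -/
lemma integral_weight_sq_pos (hs : 0 ≤ s) (hst : s < t) (htT : t ≤ M.T)
    (hβ : ∀ c u i, ∫⁻ w, ENNReal.ofReal (w u i ^ 2) ∂β c ≤ ENNReal.ofReal ((t - s) * M.Λ c i i))
    (hν : Integrable M.nu μ) : 0 < ∫ q, weight M R q ^ 2 ∂jointLaw M R β μ :=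
  (pow_pos ((Real.exp_pos _).trans_le (exp_neg_costBound_le_integral_weight M R β μ hs hst htT hβ hν
    one_pos)) 2).trans_le (sq_integral_weight_le M R β μ hst)

lemma cessLimit_le_one (hst : s < t) : cessLimit M R β μ ≤ 1 :=
  div_le_one_of_le₀ (sq_integral_weight_le M R β μ hst) (integral_nonneg fun _ => sq_nonneg _)

lemma exp_le_cessLimit (hs : 0 ≤ s) (hst : s < t) (htT : t ≤ M.T)
    (hβ : ∀ c u i, ∫⁻ w, ENNReal.ofReal (w u i ^ 2) ∂β c ≤ ENNReal.ofReal ((t - s) * M.Λ c i i))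
    (hν : Integrable M.nu μ) {η : ℝ} (hη : 0 < η) :
    Real.exp (-(2 * costBound M η (∫ x, M.nu x ∂μ) (t - s) +
      M.card * (M.scale * d) * (t - s))) ≤ cessLimit M R β μ := by
  have h1 := exp_neg_costBound_le_integral_weight M R β μ hs hst htT hβ hν hη
  have h2 := integral_weight_sq_le M R β μ hst
  rw [cessLimit, le_div_iff₀ (integral_weight_sq_pos M R β μ hs hst htT hβ hν)]
  calc _ ≤ Real.exp (-(2 * costBound M η (∫ x, M.nu x ∂μ) (t - s) +
        M.card * (M.scale * d) * (t - s))) * Real.exp (M.card * (M.scale * d) * (t - s)) := by gcongr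
    _ = Real.exp (-costBound M η (∫ x, M.nu x ∂μ) (t - s)) ^ 2 := by
      rw [← Real.exp_add, ← Real.exp_nat_mul]; push_cast; ring_nf
    _ ≤ _ := pow_le_pow_left₀ (Real.exp_nonneg _) h1 2

end WeightMoments

/-! ### Convergence in probability for one iteration -/

section Limit

variable {ι : Type*} [Fintype ι] [DecidableEq ι] [Nonempty ι] {d : ℕ} {M : GaussianModel ι d}
  {s t : ℝ} {R : ∀ c, LayerScheme s t (M.phi c)} {Ω : Type*} [MeasurableSpace Ω] {P : Measure Ω}
  [IsProbabilityMeasure P]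

/-- The laws of the bridges of one particle. -/
def StepData.bridgeLaw {N : ℕ} (D : StepData ι d s t Ω N) (P : Measure Ω) (i : Fin N) (c : ι) :
    Measure (Path d s t) := P.map (D.bridge i c)

omit [Nonempty ι] in
lemma StepData.IsStep.isProbabilityMeasure_bridgeLaw {N : ℕ} {D : StepData ι d s t Ω N}
    (h : D.IsStep M R P) (i : Fin N) (c : ι) : IsProbabilityMeasure (D.bridgeLaw P i c) :=
  Measure.isProbabilityMeasure_map (h.measurable_bridge i c).aemeasurable

omit [Nonempty ι] in
lemma StepData.IsStep.lintegral_bridgeLaw_le {N : ℕ} {D : StepData ι d s t Ω N}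
    (h : D.IsStep M R P) (hst : s < t) (i : Fin N) (c : ι) (u : Set.Icc s t) (j : Fin d) :
    ∫⁻ w, ENNReal.ofReal (w u j ^ 2) ∂D.bridgeLaw P i c ≤
      ENNReal.ofReal ((t - s) * M.Λ c j j) := by
  have hu := measurable_path_eval (d := d) u
  have hm : Measurable fun w : Path d s t => ENNReal.ofReal (w u j ^ 2) := by
    have h1 : Measurable fun v : Pt d => ENNReal.ofReal (v j ^ 2) := by fun_prop
    exact h1.comp hu
  rw [StepData.bridgeLaw, lintegral_map hm (h.measurable_bridge i c)]
  exact (h.bridge_law i c).lintegral_sq_le (M.Λ_posDef c) hst u j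

/-- The relative conditional effective sample size of one iteration converges in probability. -/
theorem tendstoInMeasure_cess (hs : 0 ≤ s) (hst : s < t) (htT : t ≤ M.T) {μ : Measure (Config ι d)}
    [IsProbabilityMeasure μ] (hν : Integrable M.nu μ) {D : ∀ N, StepData ι d s t Ω N}
    (hD : ∀ N, (D N).IsStep M R P) (hrep : Represents (fun N i => (D N).prev i) μ P) :
    TendstoInMeasure P (fun (N : ℕ) ω => (N : ℝ)⁻¹ * (D N).cess M R ω) atTop
      fun _ => cessLimit M R ((D 1).bridgeLaw P 0) μ := by
  -- The only particle of the run with `N = 1` supplies reference bridge laws; by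
  -- `IsBrownianBridge.map_eq` they are the laws for every particle in every run.
  set β := (D 1).bridgeLaw P 0 with hβdef
  have hβP : ∀ c, IsProbabilityMeasure (β c) := (hD 1).isProbabilityMeasure_bridgeLaw 0
  have hβ := (hD 1).lintegral_bridgeLaw_le hst 0
  have := isProbabilityMeasure_noiseLaw M (β := β) hst
  have hβN : ∀ N i, P.map ((D N).noise M i) = noiseLaw M β := by
    intro N i
    rw [(hD N).map_noise i]
    congr 1
    funext c
    exact ((hD N).bridge_law i c).map_eq ((hD 1).bridge_law 0 c) ((hD N).measurable_bridge i c)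
      ((hD 1).measurable_bridge 0 c)
  have hS : ∀ N, IsConditionalSample (particleKernel M R (noiseLaw M β)) (D N).prev
      ((D N).particle M) P := fun N => (hD N).isConditionalSample (hβN N)
  have hm := measurable_weight M R
  have h1 := tendstoInMeasure_average hS hrep hm (weight_nonneg M R hst)
    (lintegral_weight_le M R hst)
  have h2 := tendstoInMeasure_average hS hrep (hm.pow_const 2) (fun q => sq_nonneg _)
    (lintegral_weight_sq_le M R hst)
  have hpos := integral_weight_sq_pos M R β μ hs hst htT hβ hν
  have h3 := tendstoInMeasure_of_continuousAt h1 h2 (F := fun q => q.1 ^ 2 / q.2)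
    ((continuousAt_fst.pow 2).div continuousAt_snd hpos.ne')
  have e : (fun (N : ℕ) ω => (N : ℝ)⁻¹ * (D N).cess M R ω) = fun (N : ℕ) ω =>
      ((N : ℝ)⁻¹ * ∑ i, weight M R ((D N).prev i ω, (D N).particle M i ω)) ^ 2 /
        ((N : ℝ)⁻¹ * ∑ i, weight M R ((D N).prev i ω, (D N).particle M i ω) ^ 2) := by
    funext N ω
    simp only [StepData.cess, StepData.rho_eq_weight]
    exact inv_mul_sq_div _ _ _
  rw [e]
  exact h3

end Limit


/-! ### The mesh condition and the limits along the sequence -/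

section Mesh

variable {ι : Type*} [Fintype ι] [Nonempty ι] {d : ℕ} (M : GaussianModel ι d)

/-- The part of the cost of an iteration that vanishes with its length, per unit of time. -/
def errorRate (η : ℝ) : ℝ :=
  M.scale ^ 2 * ((1 + η⁻¹) * 3) * noiseRate M + M.card * (M.scale * d)

omit [Nonempty ι] in
lemma costBound_eq (η V Δ : ℝ) :
    2 * costBound M η V Δ + M.card * (M.scale * d) * Δ =
      (1 + η) * (M.scale ^ 2 * M.card * (Δ * V)) + errorRate M η * Δ := by
  unfold costBound errorRate
  ring

/-- Since `σ²|C| = m²/(b²|C|)`, the main term of the cost is exactly the quantity that the mesh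
condition compares with `k₃`. -/
lemma scale_sq_mul_le_of_meshCondition {k₃ k₄ s t : ℝ} {μ : Measure (Config ι d)}
    (h : M.MeshCondition k₃ k₄ μ s t) :
    M.scale ^ 2 * M.card * ((t - s) * ∫ x, M.nu x ∂μ) ≤ k₃ := by
  have h1 := M.card_pos
  have h2 := M.b_pos
  have h3 := h.1
  have e : M.scale ^ 2 * M.card * ((t - s) * ∫ x, M.nu x ∂μ) =
      (t - s) * ((∫ x, M.nu x ∂μ) * M.m ^ 2) / (M.b ^ 2 * M.card) := by
    unfold GaussianModel.scale
    field_simp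
  rw [e, div_le_iff₀ (by positivity)]
  linarith

end Mesh

end
end GBF

theorem mainTheorem5 {ι : Type*} [Fintype ι] [DecidableEq ι] [Nonempty ι] {d : ℕ} (hd : 0 < d)
    (M : GBF.GaussianModel ι d)
    {Ω : Type*} [MeasurableSpace Ω] (P : Measure Ω) [IsProbabilityMeasure P]
    (k₃ k₄ : ℝ) (hk₃ : 0 < k₃) (hk₄ : 0 < k₄)
    -- a sequence of iterations, the `l`-th one from time `s l` to time `t l`
    (s t : ℕ → ℝ) (hs : ∀ l, 0 ≤ s l) (hst : ∀ l, s l < t l) (htT : ∀ l, t l ≤ M.T)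
    (hΔ : Tendsto (fun l => t l - s l) atTop (𝓝 0))
    -- the law of the state at time `s l`
    (μ : ℕ → Measure (GBF.Config ι d)) (hμ : ∀ l, IsProbabilityMeasure (μ l))
    (hν : ∀ l, Integrable M.nu (μ l))
    (hmesh : ∀ l, M.MeshCondition k₃ k₄ (μ l) (s l) (t l))
    -- for each `N`, the `l`-th iteration with `N` particles
    (R : ∀ l c, GBF.LayerScheme (s l) (t l) (M.phi c))
    (D : ∀ l N, GBF.StepData ι d (s l) (t l) Ω N)
    (hD : ∀ l N, (D l N).IsStep M (R l) P)
    (hrep : ∀ l, GBF.Represents (fun N i => (D l N).prev i) (μ l) P) :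
    ∃ L : ℕ → ℝ,
      (∀ l, TendstoInMeasure P (fun (N : ℕ) ω => (N : ℝ)⁻¹ * (D l N).cess M (R l) ω) atTop
        fun _ => L l) ∧
      (∀ ε > 0, ∀ᶠ l in atTop, Real.exp (-k₃ - k₄) - ε ≤ L l) ∧
      ((∃ K, ∀ l, ∫ x, M.nu x ∂(μ l) ≤ K) →
        ∃ L', Tendsto L atTop (𝓝 L') ∧ Real.exp (-k₃ - k₄) ≤ L') := by
  have hβ : ∀ l c, IsProbabilityMeasure ((D l 1).bridgeLaw P 0 c) := fun l =>
    (hD l 1).isProbabilityMeasure_bridgeLaw 0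
  have hL : ∀ l, ∀ η > 0, Real.exp (-((1 + η) *
      (M.scale ^ 2 * M.card * ((t l - s l) * ∫ x, M.nu x ∂(μ l))) + GBF.errorRate M η * (t l - s l))) ≤
      GBF.cessLimit M (R l) ((D l 1).bridgeLaw P 0) (μ l) := by
    intro l η hη
    rw [← GBF.costBound_eq]
    exact GBF.exp_le_cessLimit M (R l) _ (μ l) (hs l) (hst l) (htT l)
      ((hD l 1).lintegral_bridgeLaw_le (hst l) 0) (hν l) hη
  refine ⟨fun l => GBF.cessLimit M (R l) ((D l 1).bridgeLaw P 0) (μ l), fun l =>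
    GBF.tendstoInMeasure_cess (hs l) (hst l) (htT l) (hν l) (hD l) (hrep l), fun ε hε => ?_, ?_⟩
  -- This `η` solves `(1 + η) k₃ = k₃ + k₄`: the loss in Young's inequality is paid for by `k₄`, and
  -- the remaining error is a fixed multiple of `Δ`.
  · have hη : 0 < k₄ / k₃ := div_pos hk₄ hk₃
    have hlim : Tendsto (fun l => Real.exp (-k₃ - k₄ - GBF.errorRate M (k₄ / k₃) * (t l - s l))) atTop
        (𝓝 (Real.exp (-k₃ - k₄))) := by
      have := (Real.continuous_exp.tendsto _).comp
        ((hΔ.const_mul (GBF.errorRate M (k₄ / k₃))).const_sub (-k₃ - k₄))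
      simpa [Function.comp_def] using this
    filter_upwards [hlim.eventually (lt_mem_nhds (sub_lt_self _ hε))] with l hl
    refine hl.le.trans ((Real.exp_le_exp.2 ?_).trans (hL l _ hη))
    have h1 := mul_le_mul_of_nonneg_left (GBF.scale_sq_mul_le_of_meshCondition M (hmesh l))
      (by positivity : 0 ≤ 1 + k₄ / k₃)
    have h2 : (1 + k₄ / k₃) * k₃ = k₃ + k₄ := by field_simp
    linarith
  · rintro ⟨K, hK⟩
    -- With `E[ν] ≤ K` the whole exponent is of order `Δ`, so the constants are squeezed up to `1`;
    -- the fixed choice `η = 1` suffices.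
    refine ⟨1, ?_, Real.exp_le_one_iff.2 (by linarith)⟩
    have hlim : Tendsto (fun l => Real.exp (-((1 + 1) * (M.scale ^ 2 * M.card * ((t l - s l) * K)) +
        GBF.errorRate M 1 * (t l - s l)))) atTop (𝓝 1) := by
      have := (Real.continuous_exp.tendsto _).comp
        (((((hΔ.mul_const K).const_mul (M.scale ^ 2 * M.card)).const_mul (1 + 1)).add
          (hΔ.const_mul (GBF.errorRate M 1))).neg)
      simpa [Function.comp_def] using this
    refine tendsto_of_tendsto_of_tendsto_of_le_of_le hlim tendsto_const_nhds (fun l => ?_)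
      fun l => GBF.cessLimit_le_one M (R l) _ (μ l) (hst l)
    refine (Real.exp_le_exp.2 (neg_le_neg ?_)).trans (hL l 1 one_pos)
    have h1 := M.card_pos
    have h2 := sub_pos.2 (hst l)
    have h3 := hK l
    gcongr
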